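/- Let $V_0:\mathbb R\to\mathbb R$ be locally integrable and $1$-periodic, and let $H_0=-\frac{d^2}{dx^2}+V_0$ be the half-line operator on $L^2(0,\infty)$ with boundary condition $u'(0)\sin\theta=u(0)\cos\theta$, $\theta\in[0,\pi)$. Let $V$ be a real-valued function on $(0,\infty)$ of the form $$V(x)=\sum_{l=1}^\infty c_l e^{-i\phi_l x}\gamma_l(x),\qquad x>0,$$ with $c_l\in\mathbb C$, $\phi_l\in\mathbb R$ and functions $\gamma_l:(0,\infty)\to\mathbb C$ such that $\sup_l \mathrm{Var}(\gamma_l,(0,\infty))<\infty$ and, for some integer $p\ge 2$, $\sup_l\int_0^\infty|\gamma_l(x)|^p\,dx<\infty$. Let $E$ be a real number in the interior of the essential spectrum of $H_0$ (which does not depend on $\theta$ and, by Weyl's theorem, is also the essential spectrum of $H_0+V$), and let $k\in\mathbb R$ be a quasimomentum at $E$, that is, the equation $-\varphi''+V_0\varphi=E\varphi$ has a nontrivial (Floquet) solution of the form $\varphi(x)=p_0(x)e^{ikx}$ with $p_0$ of period $1$. Define $h_0=1$ and, for $J\ge1$, $$h_J(\phi_1,\dots,\phi_J)=\frac{1}{\left|1-e^{i(2k-\phi_1-\dots-\phi_J)}\right|}\sum_{j=0}^{J-1}h_j(\phi_1,\dots,\phi_j)\,h_{J-j-1}(\phi_{j+1},\dots,\phi_{J-1}),$$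 with value $+\infty$ when the denominator vanishes. Suppose that (i) $\sum_{l=1}^\infty|c_l|<\infty$, and (ii) for $j=1,\dots,p-1$, $\ \sum_{l_1,\dots,l_j=1}^\infty |c_{l_1}\cdots c_{l_j}|\,h_j(\phi_{l_1},\dots,\phi_{l_j})<\infty$, where a term with $c_{l_1}\cdots c_{l_j}=0$ counts as $0$. Then every solution $u$ (real or complex valued, with $u,u'$ locally absolutely continuous on $[0,\infty)$ and the equation holding almost everywhere on $(0,\infty)$) of $$-u''(x)+(V(x)+V_0(x))u(x)=Eu(x)$$ is bounded on $[0,\infty)$. -/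

import Mathlib

open Set MeasureTheory Filter
open scoped ENNReal Topology

noncomputable section

namespace PeriodicSchrodinger

/-- Lebesgue measure on the half line `(0, ∞)`. -/
def halfLine : Measure ℝ := volume.restrict (Ioi 0)

/-- The derivative `u'` of a function on `[0, ∞)` (one-sided at `0`). -/
def D (u : ℝ → ℂ) : ℝ → ℂ := derivWithin u (Ici 0)

/-- `u` and `u'` are locally absolutely continuous on `[0, ∞)`: `u` is differentiable and `u'` is
absolutely continuous on every `[0, b]` (so `u` is `C¹`, in particular itself absolutely
continuous). -/
structure IsACLoc (u : ℝ → ℂ) : Prop where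
  diff : DifferentiableOn ℝ u (Ici 0)
  ac : ∀ b : ℝ, 0 < b → AbsolutelyContinuousOnInterval (D u) 0 b

/-- The differential expression `-u'' + q u` (`u''` exists almost everywhere if `u' ∈ AC_loc`). -/
def schrodinger (q : ℝ → ℝ) (u : ℝ → ℂ) (x : ℝ) : ℂ := -deriv (D u) x + (q x : ℂ) * u x

/-- `u` is a solution of `-u'' + q u = E u` on the half line. -/
structure IsSolution (q : ℝ → ℝ) (E : ℝ) (u : ℝ → ℂ) : Prop where
  acLoc : IsACLoc u
  eqn : ∀ᵐ x ∂halfLine, schrodinger q u x = (E : ℂ) * u x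

/-- The domain of the operator `-d²/dx² + q` on `L²(0, ∞)` with the boundary condition
`u'(0) sin θ = u(0) cos θ`. -/
structure InDomain (θ : ℝ) (q : ℝ → ℝ) (u : ℝ → ℂ) : Prop where
  acLoc : IsACLoc u
  memLp : MemLp u 2 halfLine
  memLp_apply : MemLp (schrodinger q u) 2 halfLine
  boundary : D u 0 * (Real.sin θ : ℂ) = u 0 * (Real.cos θ : ℂ)

/-- The essential spectrum of the operator `-d²/dx² + q` on `L²(0, ∞)` with the boundary condition
`u'(0) sin θ = u(0) cos θ`: all `E` with a singular sequence, that is, an orthonormal sequence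
`u_n` in the domain such that `‖(-d²/dx² + q - E) u_n‖ → 0` in `L²(0, ∞)`. -/
def essSpectrum (θ : ℝ) (q : ℝ → ℝ) : Set ℝ :=
  {E | ∃ u : ℕ → ℝ → ℂ,
    (∀ n, InDomain θ q (u n)) ∧
    (∀ m n, ∫ x, (starRingEnd ℂ) (u m x) * u n x ∂halfLine = if m = n then 1 else 0) ∧
    Tendsto (fun n => eLpNorm (fun x => schrodinger q (u n) x - (E : ℂ) * u n x) 2 halfLine)
      atTop (𝓝 0)}

/-- `φ` is a Floquet solution of `-φ'' + q φ = E φ` with quasimomentum `k`: a nontrivial solution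
of the form `φ(x) = p(x) e^{ikx}` with `p` of period `1`. -/
def IsFloquetSolution (q : ℝ → ℝ) (E k : ℝ) (φ : ℝ → ℂ) : Prop :=
  IsSolution q E φ ∧ (∃ x, 0 ≤ x ∧ φ x ≠ 0) ∧
    ∃ p : ℝ → ℂ, Function.Periodic p 1 ∧
      ∀ x, 0 ≤ x → φ x = p x * Complex.exp (Complex.I * k * x)

/-- The small-divisor functions: `h_0 = 1` and
`h_J(φ_1, …, φ_J) = |1 - e^{i(2k - φ_1 - ⋯ - φ_J)}|⁻¹ *
  ∑_{j=0}^{J-1} h_j(φ_1, …, φ_j) h_{J-j-1}(φ_{j+1}, …, φ_{J-1})`,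
with values in `[0, ∞]`: a vanishing denominator makes `h_J` infinite. -/
def h (k : ℝ) : (J : ℕ) → (Fin J → ℝ) → ℝ≥0∞
  | 0, _ => 1
  | J + 1, φ =>
    ‖(1 : ℂ) - Complex.exp (Complex.I * ((2 * k - ∑ i, φ i : ℝ) : ℂ))‖ₑ⁻¹ *
      ∑ j : Fin (J + 1),
        h k j (fun i => φ ⟨i, by omega⟩) *
          h k (J - j) (fun i => φ ⟨j + i, by omega⟩)
termination_by J => J
decreasing_by all_goals omega

end PeriodicSchrodinger

end

/-!
In the interior of the essential spectrum the periodic equation has a Floquet solution `Φ` that is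
independent of `conj Φ`. Writing a solution of the perturbed equation as `u = α Φ + β conj Φ` and
varying the constants, the quotient `f = β / α` formally satisfies the Riccati equation
`f' = -(V / w) (Φ + conj Φ f)²`, where the Wronskian `w` is purely imaginary. It suffices to solve
this equation approximately, by an `f` with `f → 0` at infinity and with integrable error: for an
exact solution the quantity `|β - f α|² / (1 - |f|²)` would be constant, so for an approximate one
it changes little near infinity, and together with the same quantity for `conj u` it controls
`|α|² + |β|²`. This is `isPrimitive_riccati_invariant` and `bounded_of_approximate_riccati`.

**The approximate solution.** It is a truncated power series in the coefficient functions `γ_l`. A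
term of degree `J` is a product of `J` of the `c_l γ_l(x)` and of an oscillating amplitude, and the
amplitudes are determined recursively: the right-hand side of the Riccati equation at degree
`J + 1` is a product of two lower amplitudes and of an exponential, is multiplied by
`e^{i(2k - φ_1 - ⋯ - φ_{J+1})}` when `x` increases by one, and hence, unless that factor is one, has
the quasiperiodic primitive obtained by dividing its integral over `[x, x + 1]` by the factor minus
one. These divisors are those in the recursion for `h`, so `h` bounds the amplitudes
(`exists_enorm_amp_le`) and the small divisor condition makes the series converge. With truncation
after degree `p - 1` there remain two errors (`exists_approximate_riccati`): terms in which the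
derivative falls on a coefficient function, integrable because of bounded variation, and products of
at least `p` coefficient functions, integrable because these lie in `L^p`. As the `γ_l` are only of
bounded variation, they are first replaced by smooth functions, by averaging twice
(`exists_smoothing`); the difference is integrable.

**The Floquet solutions.** For `e^{2ik} ≠ 1` the given Floquet solution serves as `Φ`. For
`e^{2ik} = 1` there is a real solution `r` with `r(x + 1) = ± r(x)`, and reduction of order gives a
second real solution `z` with `z(x + 1) = ± (z(x) + κ r(x))`. If `κ = 0`, then `Φ = r + i z`. If
`κ ≠ 0`, the monodromy matrix is a Jordan block, and the energies near `E` on one side lie in a gap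
of the essential spectrum, contrary to the hypothesis. This is shown directly. In the coordinates of
a function with respect to the fundamental system of `E`, made bounded by removing the linear growth
of `z`, there is a Lyapunov function that bounds `‖u‖₂` by `‖-u'' + (V₀ - E - ε) u‖₂` whenever `u`
has zero initial data (`IsEdgeSystem.integral_sq_le`). Since the boundary condition leaves only a
line of initial data, two members of a singular sequence have a combination that violates this bound
(`IsEdgeSystem.notMem_essSpectrum`).
-/

noncomputable section

namespace PeriodicSchrodinger

/-! ### Locally absolutely continuous functions on a half line -/

/-- `F` is locally absolutely continuous on `[X, ∞)` with almost everywhere derivative `f`. -/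
structure IsPrimitive (X : ℝ) (F f : ℝ → ℂ) : Prop where
  ac : ∀ b, X ≤ b → AbsolutelyContinuousOnInterval F X b
  hasDerivAt : ∀ᵐ x, X < x → HasDerivAt F (f x) x

theorem _root_.AbsolutelyContinuousOnInterval.lipschitz_comp {f : ℝ → ℂ} {a b : ℝ}
    {Y : Type*} [PseudoMetricSpace Y] {L : ℂ → Y} {K : NNReal} (hL : LipschitzWith K L)
    (hf : AbsolutelyContinuousOnInterval f a b) :
    AbsolutelyContinuousOnInterval (fun x => L (f x)) a b := by
  unfold AbsolutelyContinuousOnInterval at *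
  refine squeeze_zero (fun t => Finset.sum_nonneg fun i _ => dist_nonneg) (fun t => ?_)
    (by simpa using hf.const_mul (K : ℝ))
  rw [Finset.mul_sum]
  exact Finset.sum_le_sum fun i _ => hL.dist_le_mul _ _

namespace IsPrimitive

variable {X Y : ℝ} {F G f g : ℝ → ℂ}

theorem mono (hF : IsPrimitive X F f) (h : X ≤ Y) : IsPrimitive Y F f where
  ac b hb := (hF.ac b (h.trans hb)).mono (by
    rw [uIcc_of_le hb, uIcc_of_le (h.trans hb)]; exact Icc_subset_Icc_left h)
  hasDerivAt := by
    filter_upwards [hF.hasDerivAt] with x hx hXx using hx (h.trans_lt hXx)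

theorem continuousOn (hF : IsPrimitive X F f) : ContinuousOn F (Ici X) := by
  intro x hx
  have h1 := (hF.ac (x + 1) (by linarith [mem_Ici.1 hx])).continuousOn
  rw [uIcc_of_le (by linarith [mem_Ici.1 hx])] at h1
  refine (h1 x ⟨hx, by linarith⟩).mono_of_mem_nhdsWithin ?_
  rw [← Ici_inter_Iic]
  exact inter_mem_nhdsWithin _ (Iic_mem_nhds (by linarith))

theorem add (hF : IsPrimitive X F f) (hG : IsPrimitive X G g) :
    IsPrimitive X (fun x => F x + G x) (fun x => f x + g x) where
  ac b hb := (hF.ac b hb).fun_add (hG.ac b hb)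
  hasDerivAt := by
    filter_upwards [hF.hasDerivAt, hG.hasDerivAt] with x h1 h2 hx using (h1 hx).add (h2 hx)

theorem sub (hF : IsPrimitive X F f) (hG : IsPrimitive X G g) :
    IsPrimitive X (fun x => F x - G x) (fun x => f x - g x) where
  ac b hb := (hF.ac b hb).fun_sub (hG.ac b hb)
  hasDerivAt := by
    filter_upwards [hF.hasDerivAt, hG.hasDerivAt] with x h1 h2 hx using (h1 hx).sub (h2 hx)

theorem mul (hF : IsPrimitive X F f) (hG : IsPrimitive X G g) :
    IsPrimitive X (fun x => F x * G x) (fun x => f x * G x + F x * g x) where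
  ac b hb := (hF.ac b hb).fun_smul (hG.ac b hb)
  hasDerivAt := by
    filter_upwards [hF.hasDerivAt, hG.hasDerivAt] with x h1 h2 hx using (h1 hx).mul (h2 hx)

theorem const_mul (c : ℂ) (hF : IsPrimitive X F f) :
    IsPrimitive X (fun x => c * F x) (fun x => c * f x) where
  ac b hb := (hF.ac b hb).const_smul c
  hasDerivAt := by
    filter_upwards [hF.hasDerivAt] with x h1 hx using (h1 hx).const_mul c

theorem conj (hF : IsPrimitive X F f) :
    IsPrimitive X (fun x => starRingEnd ℂ (F x)) (fun x => starRingEnd ℂ (f x)) where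
  ac b hb := (hF.ac b hb).lipschitz_comp Complex.isometry_conj.lipschitz
  hasDerivAt := by
    filter_upwards [hF.hasDerivAt] with x h1 hx using (h1 hx).star

theorem congr_right (hF : IsPrimitive X F f) (h : ∀ᵐ x, X < x → f x = g x) :
    IsPrimitive X F g where
  ac := hF.ac
  hasDerivAt := by
    filter_upwards [hF.hasDerivAt, h] with x h1 h2 hx using h2 hx ▸ h1 hx

theorem congr_right' (hF : IsPrimitive X F f) (h : ∀ x, X < x → f x = g x) :
    IsPrimitive X F g := hF.congr_right (Eventually.of_forall h)

theorem congr_left (hF : IsPrimitive X F f) (h : ∀ x, X ≤ x → F x = G x) :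
    IsPrimitive X G f where
  ac b hb := by
    refine (hF.ac b hb).congr' ?_
    rw [EventuallyEq, eventually_inf_principal]
    refine Eventually.of_forall fun E hE => Finset.sum_congr rfl fun i hi => ?_
    have := hE.1 i hi
    rw [uIcc_of_le hb] at this
    rw [h _ this.1.1, h _ this.2.1]
  hasDerivAt := by
    filter_upwards [hF.hasDerivAt] with x h1 hx
    exact (h1 hx).congr_of_eventuallyEq
      (by filter_upwards [Ioi_mem_nhds hx] with y hy using (h y (le_of_lt hy)).symm)

theorem of_hasDerivWithinAt (hf : ContinuousOn f (Ici X))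
    (h : ∀ x, X ≤ x → HasDerivWithinAt F (f x) (Ici X) x) : IsPrimitive X F f where
  ac b hb := by
    obtain ⟨C, hC⟩ := isCompact_Icc.exists_bound_of_continuousOn 
      (hf.mono (Icc_subset_Ici_self : Icc X b ⊆ Ici X))
    refine LipschitzOnWith.absolutelyContinuousOnInterval (K := C.toNNReal) ?_
    rw [uIcc_of_le hb]
    refine (convex_Icc X b).lipschitzOnWith_of_nnnorm_hasDerivWithin_le (f' := f)
      (fun x hx => (h x hx.1).mono Icc_subset_Ici_self) fun x hx => ?_
    exact NNReal.coe_le_coe.1 ((hC x hx).trans (Real.le_coe_toNNReal C))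
  hasDerivAt := Eventually.of_forall fun x hx => (h x hx.le).hasDerivAt (Ici_mem_nhds hx)

theorem of_hasDerivAt (hf : ContinuousOn f (Ici X))
    (h : ∀ x, X ≤ x → HasDerivAt F (f x) x) : IsPrimitive X F f :=
  of_hasDerivWithinAt hf fun x hx => (h x hx).hasDerivWithinAt

theorem const (X : ℝ) (c : ℂ) : IsPrimitive X (fun _ => c) (fun _ => 0) :=
  of_hasDerivAt continuousOn_const fun x _ => hasDerivAt_const x c

theorem ac_re (hF : IsPrimitive X F f) {b : ℝ} (hb : X ≤ b) :
    AbsolutelyContinuousOnInterval (fun x => (F x).re) X b :=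
  (hF.ac b hb).lipschitz_comp Complex.reCLM.lipschitz

theorem ac_im (hF : IsPrimitive X F f) {b : ℝ} (hb : X ≤ b) :
    AbsolutelyContinuousOnInterval (fun x => (F x).im) X b :=
  (hF.ac b hb).lipschitz_comp Complex.imCLM.lipschitz

theorem _root_.HasDerivAt.re_comp {F : ℝ → ℂ} {f : ℂ} {x : ℝ} (h : HasDerivAt F f x) :
    HasDerivAt (fun x => (F x).re) f.re x :=
  (Complex.reCLM.hasFDerivAt (x := F x)).comp_hasDerivAt x h

theorem _root_.HasDerivAt.im_comp {F : ℝ → ℂ} {f : ℂ} {x : ℝ} (h : HasDerivAt F f x) :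
    HasDerivAt (fun x => (F x).im) f.im x :=
  (Complex.imCLM.hasFDerivAt (x := F x)).comp_hasDerivAt x h

theorem deriv_re_eq (hF : IsPrimitive X F f) (b : ℝ) :
    ∀ᵐ x, x ∈ uIoc X b → X ≤ b → deriv (fun x => (F x).re) x = (f x).re := by
  filter_upwards [hF.hasDerivAt] with x h1 hx hb
  rw [uIoc_of_le hb] at hx
  exact (h1 hx.1).re_comp.deriv

theorem deriv_im_eq (hF : IsPrimitive X F f) (b : ℝ) :
    ∀ᵐ x, x ∈ uIoc X b → X ≤ b → deriv (fun x => (F x).im) x = (f x).im := by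
  filter_upwards [hF.hasDerivAt] with x h1 hx hb
  rw [uIoc_of_le hb] at hx
  exact (h1 hx.1).im_comp.deriv

theorem intervalIntegrable_re (hF : IsPrimitive X F f) {b : ℝ} (hb : X ≤ b) :
    IntervalIntegrable (fun x => (f x).re) volume X b := by
  refine (hF.ac_re hb).intervalIntegrable_deriv.congr_ae ?_
  rw [EventuallyEq, ae_restrict_iff' measurableSet_uIoc]
  filter_upwards [hF.deriv_re_eq b] with x h hx using h hx hb

theorem intervalIntegrable_im (hF : IsPrimitive X F f) {b : ℝ} (hb : X ≤ b) :
    IntervalIntegrable (fun x => (f x).im) volume X b := by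
  refine (hF.ac_im hb).intervalIntegrable_deriv.congr_ae ?_
  rw [EventuallyEq, ae_restrict_iff' measurableSet_uIoc]
  filter_upwards [hF.deriv_im_eq b] with x h hx using h hx hb

theorem integral_re (hF : IsPrimitive X F f) {b : ℝ} (hb : X ≤ b) :
    ∫ x in X..b, (f x).re = (F b).re - (F X).re := by
  rw [← (hF.ac_re hb).integral_deriv_eq_sub]
  exact intervalIntegral.integral_congr_ae
    (by filter_upwards [hF.deriv_re_eq b] with x h hx using (h hx hb).symm)

theorem integral_im (hF : IsPrimitive X F f) {b : ℝ} (hb : X ≤ b) :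
    ∫ x in X..b, (f x).im = (F b).im - (F X).im := by
  rw [← (hF.ac_im hb).integral_deriv_eq_sub]
  exact intervalIntegral.integral_congr_ae
    (by filter_upwards [hF.deriv_im_eq b] with x h hx using (h hx hb).symm)

theorem _root_.IntervalIntegrable.complex_ofReal {r : ℝ → ℝ} {a b : ℝ}
    (h : IntervalIntegrable r volume a b) :
    IntervalIntegrable (fun x => (r x : ℂ)) volume a b :=
  ⟨Integrable.ofReal h.1, Integrable.ofReal h.2⟩

theorem intervalIntegrable (hF : IsPrimitive X F f) {b : ℝ} (hb : X ≤ b) :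
    IntervalIntegrable f volume X b := by
  have h1 := (hF.intervalIntegrable_re hb).complex_ofReal
  have h2 := (hF.intervalIntegrable_im hb).complex_ofReal
  refine (h1.add (h2.mul_const Complex.I)).congr_ae (Eventually.of_forall fun x => ?_)
  exact Complex.re_add_im (f x)

theorem integral_eq (hF : IsPrimitive X F f) {b : ℝ} (hb : X ≤ b) :
    ∫ x in X..b, f x = F b - F X := by
  have h1 := (hF.intervalIntegrable_re hb).complex_ofReal
  have h2 := (hF.intervalIntegrable_im hb).complex_ofReal
  have : ∫ x in X..b, f x = ∫ x in X..b, (((f x).re : ℂ) + ((f x).im : ℂ) * Complex.I) := by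
    simp only [Complex.re_add_im]
  rw [this]
  erw [intervalIntegral.integral_add h1 (h2.mul_const Complex.I)]
  rw [intervalIntegral.integral_mul_const]
  erw [intervalIntegral.integral_ofReal, intervalIntegral.integral_ofReal]
  rw [hF.integral_re hb, hF.integral_im hb]
  apply Complex.ext <;> simp

theorem eq_of_deriv_eq_zero (hF : IsPrimitive X F f) (h : ∀ᵐ x, X < x → f x = 0) {b : ℝ}
    (hb : X ≤ b) : F b = F X := by
  have h1 := hF.integral_eq hb
  rw [intervalIntegral.integral_congr_ae (g := fun _ => 0)] at h1
  · simpa [sub_eq_zero, eq_comm] using h1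
  · filter_upwards [h] with x hx hm
    rw [uIoc_of_le hb] at hm
    exact hx hm.1

/-- The fundamental theorem of calculus for a real integrable function, in complex form. -/
theorem of_integral {r : ℝ → ℝ} (hr : ∀ b, X ≤ b → IntervalIntegrable r volume X b) :
    IsPrimitive X (fun x => ((∫ t in X..x, r t : ℝ) : ℂ)) (fun x => (r x : ℂ)) where
  ac b hb := by
    have h1 := (hr b hb).absolutelyContinuousOnInterval_intervalIntegral (c := X) (by simp)
    have := h1.fun_smul (M := ℝ) (F := ℂ) (LipschitzOnWith.absolutelyContinuousOnInterval
      (K := 0) (f := fun _ => (1 : ℂ)) (LipschitzWith.const _).lipschitzOnWith)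
    simpa using this
  hasDerivAt := by
    have : ∀ n : ℕ, ∀ᵐ x, x ∈ uIcc X (X + n) →
        HasDerivAt (fun x => ∫ t in X..x, r t) (r x) x := fun n => by
      filter_upwards [(hr (X + n) (by simp)).ae_hasDerivAt_integral] with x hx hm
      exact hx hm X (by simp)
    filter_upwards [ae_all_iff.2 this] with x hx hXx
    obtain ⟨n, hn⟩ := exists_nat_ge (x - X)
    refine (hx n ?_).ofReal_comp
    rw [uIcc_of_le (by simp)]
    exact ⟨hXx.le, by linarith⟩

end IsPrimitive

/-- Grönwall's inequality with an integrable coefficient, for zero initial data: iterating the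
hypothesis gives `y ≤ M K ^ n / n!` with `K` the primitive of `κ`. -/
theorem eq_zero_of_le_integral {X b : ℝ} {y κ : ℝ → ℝ} (hb : X ≤ b) (hy : ContinuousOn y (Icc X b))
    (hy0 : ∀ x, 0 ≤ y x) (hκ : ∀ b, X ≤ b → IntervalIntegrable κ volume X b) (hκ0 : ∀ x, 0 ≤ κ x)
    (h : ∀ x ∈ Icc X b, y x ≤ ∫ t in X..x, κ t * y t) : y b = 0 := by
  set K : ℝ → ℝ := fun x => ∫ t in X..x, κ t with hK
  obtain ⟨M, hM⟩ := isCompact_Icc.exists_bound_of_continuousOn hy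
  have hprim : ∀ n : ℕ, IsPrimitive X (fun x => (K x : ℂ) ^ (n + 1))
      (fun x => (n + 1) * (κ x * (K x : ℂ) ^ n)) := by
    intro n
    induction n with
    | zero => simpa using IsPrimitive.of_integral hκ
    | succ n ih =>
      refine ((ih.mul (IsPrimitive.of_integral hκ)).congr_left fun x _ => (pow_succ _ _).symm)
        |>.congr_right' fun x _ => ?_
      push_cast
      ring
  have hint : ∀ n : ℕ, ∀ x, X ≤ x → IntervalIntegrable (fun t => κ t * K t ^ n) volume X x ∧
      ∫ t in X..x, κ t * K t ^ n = K x ^ (n + 1) / (n + 1) := by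
    intro n x hx
    have h1 := (((hprim n).const_mul (1 / (n + 1))).congr_right'
      (g := fun x => ((κ x * K x ^ n : ℝ) : ℂ)) fun x _ => by
        push_cast; field_simp)
    refine ⟨by simpa only [Complex.ofReal_re] using h1.intervalIntegrable_re hx, ?_⟩
    have h2 := h1.integral_eq hx
    rw [intervalIntegral.integral_ofReal] at h2
    apply Complex.ofReal_injective
    rw [h2]
    simp [hK]
    ring
  have key : ∀ n : ℕ, ∀ x ∈ Icc X b, y x ≤ M * (K x ^ n / n.factorial) := by
    intro n
    induction n with
    | zero => intro x hx; simpa using (le_abs_self _).trans (hM x hx)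
    | succ n ih =>
      intro x hx
      obtain ⟨i1, i2⟩ := hint n x hx.1
      have hyc : ContinuousOn y (uIcc X x) := by
        rw [uIcc_of_le hx.1]; exact hy.mono (Icc_subset_Icc_right hx.2)
      calc y x ≤ ∫ t in X..x, κ t * y t := h x hx
        _ ≤ ∫ t in X..x, (M / n.factorial) * (κ t * K t ^ n) := by
          refine intervalIntegral.integral_mono_on hx.1 ((hκ x hx.1).mul_continuousOn hyc)
            (i1.const_mul _) fun t ht => ?_
          have := mul_le_mul_of_nonneg_left (ih t ⟨ht.1, ht.2.trans hx.2⟩) (hκ0 t)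
          calc _ ≤ _ := this
            _ = _ := by ring
        _ = _ := by
          rw [intervalIntegral.integral_const_mul, i2, Nat.factorial_succ]
          push_cast
          field_simp
  have hlim := (FloorSemiring.tendsto_pow_div_factorial_atTop (K b)).const_mul M
  rw [mul_zero] at hlim
  exact le_antisymm (ge_of_tendsto' hlim fun n => key n b ⟨hb, le_rfl⟩) (hy0 b)

/-- Uniqueness for the initial value problem `u'' = q u`, to the right of the initial point. -/
theorem eq_zero_of_initial_eq_zero {X : ℝ} {u u' : ℝ → ℂ} {q : ℝ → ℝ}
    (hq : ∀ b, X ≤ b → IntervalIntegrable q volume X b)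
    (hu : IsPrimitive X u u') (hu' : IsPrimitive X u' fun x => q x * u x)
    (h0 : u X = 0) (h0' : u' X = 0) {b : ℝ} (hb : X ≤ b) : u b = 0 ∧ u' b = 0 := by
  have hc : ContinuousOn (fun x => ‖u x‖ + ‖u' x‖) (Ici X) :=
    hu.continuousOn.norm.add hu'.continuousOn.norm
  have := eq_zero_of_le_integral (y := fun x => ‖u x‖ + ‖u' x‖) (κ := fun x => 1 + |q x|) hb
    (hc.mono Icc_subset_Ici_self) (fun x => by positivity)
    (fun b hb => intervalIntegrable_const.add (hq b hb).abs) (fun x => by positivity) ?_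
  · have h1 := norm_nonneg (u b)
    have h2 := norm_nonneg (u' b)
    exact ⟨norm_eq_zero.1 (by linarith), norm_eq_zero.1 (by linarith)⟩
  intro x hx
  have hcx : ContinuousOn (fun x => ‖u x‖ + ‖u' x‖) (uIcc X x) := by
    rw [uIcc_of_le hx.1]; exact hc.mono Icc_subset_Ici_self
  have e1 := hu.integral_eq hx.1
  have e2 := hu'.integral_eq hx.1
  rw [h0, sub_zero] at e1
  rw [h0', sub_zero] at e2
  have i1 := (hu.intervalIntegrable hx.1).norm
  have i2 := (hu'.intervalIntegrable hx.1).norm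
  calc ‖u x‖ + ‖u' x‖ ≤ (∫ t in X..x, ‖u' t‖) + ∫ t in X..x, ‖(q t : ℂ) * u t‖ := by
        rw [← e1, ← e2]
        exact add_le_add (intervalIntegral.norm_integral_le_integral_norm hx.1)
          (intervalIntegral.norm_integral_le_integral_norm hx.1)
    _ = ∫ t in X..x, (‖u' t‖ + ‖(q t : ℂ) * u t‖) := (intervalIntegral.integral_add i1 i2).symm
    _ ≤ _ := by
      refine intervalIntegral.integral_mono_on hx.1 (i1.add i2)
        ((intervalIntegrable_const.add (hq x hx.1).abs).mul_continuousOn hcx) fun t _ => ?_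
      simp only [norm_mul, Complex.norm_real, Real.norm_eq_abs]
      nlinarith [norm_nonneg (u t), norm_nonneg (u' t), abs_nonneg (q t)]

/-! ### Solutions of the Schrödinger equation -/

theorem IsACLoc.isPrimitive {u : ℝ → ℂ} (hu : IsACLoc u) : IsPrimitive 0 u (D u) := by
  refine .of_hasDerivWithinAt ?_ fun x hx => (hu.diff x hx).hasDerivWithinAt
  intro x hx
  have h1 := (hu.ac (x + 1) (by linarith [mem_Ici.1 hx])).continuousOn
  rw [uIcc_of_le (by linarith [mem_Ici.1 hx])] at h1
  refine (h1 x ⟨hx, by linarith⟩).mono_of_mem_nhdsWithin ?_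
  rw [← Ici_inter_Iic]
  exact inter_mem_nhdsWithin _ (Iic_mem_nhds (by linarith))

theorem IsACLoc.isPrimitive_deriv {u : ℝ → ℂ} (hu : IsACLoc u) :
    IsPrimitive 0 (D u) (deriv (D u)) where
  ac b hb := by
    rcases hb.eq_or_lt with rfl | hb
    · exact (hu.ac 1 one_pos).mono (by simp)
    · exact hu.ac b hb
  hasDerivAt := by
    have : ∀ n : ℕ, ∀ᵐ x, x ∈ uIcc (0 : ℝ) (n + 1) → DifferentiableAt ℝ (D u) x := fun n =>
      (hu.ac (n + 1) (by positivity)).boundedVariationOn.ae_differentiableAt_of_mem_uIcc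
    filter_upwards [ae_all_iff.2 this] with x hx h0
    obtain ⟨n, hn⟩ := exists_nat_ge x
    refine (hx n ?_).hasDerivAt
    rw [uIcc_of_le (by positivity)]
    exact ⟨h0.le, by linarith⟩

theorem IsSolution.isPrimitive_deriv {u : ℝ → ℂ} {q : ℝ → ℝ} {E : ℝ} (hu : IsSolution q E u) :
    IsPrimitive 0 (D u) (fun x => ((q x - E : ℝ) : ℂ) * u x) := by
  refine hu.acLoc.isPrimitive_deriv.congr_right ?_
  have := hu.eqn
  rw [halfLine, ae_restrict_iff' measurableSet_Ioi] at this
  filter_upwards [this] with x hx h0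
  have := hx h0
  rw [schrodinger] at this
  push_cast
  linear_combination -this

open scoped ComplexConjugate

/-! ### Approximate solutions of the Riccati equation bound all solutions -/

theorem IsPrimitive.inv {X : ℝ} {F f : ℝ → ℂ} (hF : IsPrimitive X F f) {m : ℝ} (hm : 0 < m)
    (h : ∀ x, X ≤ x → m ≤ ‖F x‖) :
    IsPrimitive X (fun x => (F x)⁻¹) (fun x => -f x / F x ^ 2) where
  ac b hb := by
    have hF' := hF.ac b hb
    unfold AbsolutelyContinuousOnInterval at *
    refine squeeze_zero' (Eventually.of_forall fun t => Finset.sum_nonneg fun i _ => dist_nonneg)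
      ?_ (by simpa using hF'.const_mul (m⁻¹ * m⁻¹))
    rw [eventually_inf_principal]
    refine Eventually.of_forall fun P hP => ?_
    rw [Finset.mul_sum]
    refine Finset.sum_le_sum fun i hi => ?_
    have := hP.1 i hi
    rw [uIcc_of_le hb] at this
    have h1 := h _ this.1.1
    have h2 := h _ this.2.1
    have n1 : F (P.2 i).1 ≠ 0 := norm_pos_iff.1 (hm.trans_le h1)
    have n2 : F (P.2 i).2 ≠ 0 := norm_pos_iff.1 (hm.trans_le h2)
    rw [dist_eq_norm, dist_eq_norm, inv_sub_inv n1 n2, norm_div, norm_mul, norm_sub_rev,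
      div_eq_inv_mul, mul_inv]
    gcongr
  hasDerivAt := by
    filter_upwards [hF.hasDerivAt] with x hx hXx
    exact (hx hXx).inv (norm_pos_iff.1 (hm.trans_le (h x hXx.le)))

theorem norm_sub_le_lintegral {X : ℝ} {F f : ℝ → ℂ} (hF : IsPrimitive X F f) {b : ℝ} (hb : X ≤ b)
    {r : ℝ → ℝ≥0∞} (h : ∀ᵐ x, X < x → x ≤ b → ‖f x‖ₑ ≤ r x) :
    ‖F b - F X‖ₑ ≤ ∫⁻ x in Ioc X b, r x := by
  rw [← hF.integral_eq hb, intervalIntegral.integral_of_le hb]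
  refine (enorm_integral_le_lintegral_enorm _).trans (lintegral_mono_ae ?_)
  refine (ae_restrict_iff' measurableSet_Ioc).2 ?_
  filter_upwards [h] with x hx hm using hx hm.1 hm.2

/-- Let `(α, β)` be the coordinates of a solution and let `f` solve the Riccati equation up to an
error `ε`. The quantity `|β - f α|² / (1 - |f|²)`, which is exactly conserved when `ε = 0` because
`v` is purely imaginary, then varies only through `ε`. -/
theorem isPrimitive_riccati_invariant {X : ℝ} {Φ v α β f f' ε : ℝ → ℂ}
    (hv : ∀ x, conj (v x) = -v x)
    (hα : IsPrimitive X α fun x => v x * conj (Φ x) * (α x * Φ x + β x * conj (Φ x)))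
    (hβ : IsPrimitive X β fun x => -(v x * Φ x * (α x * Φ x + β x * conj (Φ x))))
    (hf : IsPrimitive X f f') (hf2 : ∀ x, X ≤ x → ‖f x‖ ≤ 1 / 2)
    (hε : ∀ x, X < x → f' x = -(v x * (Φ x + conj (Φ x) * f x) ^ 2) + ε x) :
    ∃ n : ℝ → ℂ, IsPrimitive X (fun x => ((‖β x - f x * α x‖ ^ 2 / (1 - ‖f x‖ ^ 2) : ℝ) : ℂ)) n ∧
      ∀ x, X < x → ‖n x‖ ≤ 8 * ‖ε x‖ * (‖α x‖ ^ 2 + ‖β x‖ ^ 2) := by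
  have hη : ∀ x, X ≤ x → 3 / 4 ≤ 1 - ‖f x‖ ^ 2 := fun x hx => by
    nlinarith [hf2 x hx, norm_nonneg (f x)]
  have hηC : ∀ x, 1 - f x * conj (f x) = ((1 - ‖f x‖ ^ 2 : ℝ) : ℂ) := fun x => by
    rw [Complex.mul_conj, Complex.normSq_eq_norm_sq]; push_cast; ring
  have hB := hβ.sub (hf.mul hα)
  have hηp := (IsPrimitive.const X 1).sub (hf.mul hf.conj)
  have hηinv := hηp.inv (m := 3 / 4) (by norm_num) fun x hx => by
    rw [hηC, Complex.norm_real, Real.norm_eq_abs]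
    exact (hη x hx).trans (le_abs_self _)
  refine ⟨_, (((hB.mul hB.conj).mul hηinv).congr_left fun x _ => ?_).congr_right'
    (g := fun x => -(conj (β x - f x * α x) * ε x * α x
        + (β x - f x * α x) * conj (ε x) * conj (α x)) / (1 - f x * conj (f x))
      + (β x - f x * α x) * conj (β x - f x * α x) * (conj (f x) * ε x + f x * conj (ε x))
        / (1 - f x * conj (f x)) ^ 2) fun x hx => ?_, fun x hx => ?_⟩
  · rw [hηC, Complex.mul_conj, Complex.normSq_eq_norm_sq]
    push_cast
    rfl
  · have hne : 1 - f x * conj (f x) ≠ 0 := by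
      rw [hηC]
      exact_mod_cast (by linarith [hη x hx.le] : (0 : ℝ) < 1 - ‖f x‖ ^ 2).ne'
    simp only [map_add, map_sub, map_mul, map_neg, map_pow, Complex.conj_conj, hv, hε x hx]
    field_simp
    ring
  · have hpos := hη x hx.le
    have e1 : ‖(1 - f x * conj (f x))‖ = 1 - ‖f x‖ ^ 2 := by
      rw [hηC, Complex.norm_real, Real.norm_eq_abs, abs_of_nonneg (by linarith)]
    have hB : ‖β x - f x * α x‖ ≤ ‖β x‖ + 1 / 2 * ‖α x‖ := by
      refine (norm_sub_le _ _).trans ?_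
      rw [norm_mul]
      gcongr
      exact hf2 x hx.le
    set T := ‖α x‖ ^ 2 + ‖β x‖ ^ 2 with hT
    have t1 : ‖β x - f x * α x‖ * ‖α x‖ ≤ T := by
      nlinarith [mul_le_mul_of_nonneg_right hB (norm_nonneg (α x)), sq_nonneg (‖α x‖ - ‖β x‖)]
    have t2 : ‖β x - f x * α x‖ ^ 2 ≤ 2 * T := by
      nlinarith [norm_nonneg (β x - f x * α x), norm_nonneg (α x), norm_nonneg (β x),
        sq_nonneg (‖α x‖ / 2 - ‖β x‖), pow_le_pow_left₀ (norm_nonneg _) hB 2]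
    have T0 : 0 ≤ T := by positivity
    have hε0 := norm_nonneg (ε x)
    clear_value T
    calc _ ≤ (2 * ‖ε x‖ * (‖β x - f x * α x‖ * ‖α x‖)) / (1 - ‖f x‖ ^ 2)
          + ‖β x - f x * α x‖ ^ 2 * (2 * ‖f x‖ * ‖ε x‖) / (1 - ‖f x‖ ^ 2) ^ 2 := by
          refine (norm_add_le _ _).trans (add_le_add ?_ ?_)
          · rw [norm_div, e1, norm_neg]
            gcongr
            refine (norm_add_le _ _).trans (le_of_eq ?_)
            simp only [norm_mul, Complex.norm_conj]
            ring
          · rw [norm_div, norm_pow, e1, norm_mul, norm_mul, Complex.norm_conj, ← sq]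
            gcongr
            refine (norm_add_le _ _).trans (le_of_eq ?_)
            simp only [norm_mul, Complex.norm_conj]
            ring
      _ ≤ (2 * ‖ε x‖ * T) / (3 / 4) + 2 * T * (2 * (1 / 2) * ‖ε x‖) / (3 / 4) ^ 2 := by
          gcongr
          exact hf2 x hx.le
      _ = 56 / 9 * (‖ε x‖ * T) := by ring
      _ ≤ 8 * ‖ε x‖ * T := by linarith [mul_nonneg hε0 T0]

theorem exists_setLIntegral_Ioi_lt {X₀ : ℝ} {e : ℝ → ℝ≥0∞} (h : ∫⁻ x in Ioi X₀, e x ≠ ⊤)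
    {δ : ℝ≥0∞} (hδ : 0 < δ) : ∀ᶠ X in atTop, ∫⁻ x in Ioi X, e x < δ := by
  set μ := (volume.restrict (Ioi X₀)).withDensity e with hμ
  have hfin : IsFiniteMeasure μ := isFiniteMeasure_withDensity h
  have hlim : Tendsto (fun n : ℕ => μ (Ioi (n : ℝ))) atTop (𝓝 (μ (⋂ n : ℕ, Ioi (n : ℝ)))) :=
    tendsto_measure_iInter_atTop (fun n => measurableSet_Ioi.nullMeasurableSet)
      (fun m n hmn => Ioi_subset_Ioi (by exact_mod_cast hmn)) ⟨0, measure_ne_top _ _⟩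
  have hemp : ⋂ n : ℕ, Ioi (n : ℝ) = ∅ := by
    ext x
    simp only [mem_iInter, mem_Ioi, mem_empty_iff_false, iff_false, not_forall, not_lt]
    exact exists_nat_ge x
  rw [hemp, measure_empty] at hlim
  obtain ⟨N, hN⟩ := (hlim.eventually (gt_mem_nhds hδ)).exists
  filter_upwards [eventually_ge_atTop (N : ℝ), eventually_ge_atTop X₀] with X h1 h2
  refine lt_of_le_of_lt ?_ hN
  rw [hμ, withDensity_apply _ measurableSet_Ioi, Measure.restrict_restrict measurableSet_Ioi]
  exact lintegral_mono_set fun x hx => ⟨lt_of_le_of_lt h1 hx, lt_of_le_of_lt h2 hx⟩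

/-- If the Riccati equation `f' = -v (Φ + conj Φ f)²` has an approximate solution `f` that vanishes
at infinity with integrable error, then all solutions of the perturbed equation are bounded. -/
theorem bounded_of_approximate_riccati {V q : ℝ → ℝ} {Φ Φ' u u' f f' : ℝ → ℂ} {w : ℂ} {A X₀ : ℝ}
    {e : ℝ → ℝ≥0∞} (hX₀ : 0 ≤ X₀)
    (hΦ : IsPrimitive 0 Φ Φ') (hΦ' : IsPrimitive 0 Φ' fun x => q x * Φ x)
    (hA : ∀ x, 0 ≤ x → ‖Φ x‖ ≤ A)
    (hw : ∀ x, 0 ≤ x → conj (Φ x) * Φ' x - conj (Φ' x) * Φ x = w) (hw0 : w ≠ 0)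
    (hu : IsPrimitive 0 u u') (hu' : IsPrimitive 0 u' fun x => ((V x + q x : ℝ) : ℂ) * u x)
    (hf : IsPrimitive X₀ f f') (hf0 : Tendsto f atTop (𝓝 0))
    (hfe : ∀ x, X₀ < x → ‖f' x + V x / w * (Φ x + conj (Φ x) * f x) ^ 2‖ₑ ≤ e x)
    (he : ∫⁻ x in Ioi X₀, e x ≠ ⊤) :
    ∃ C : ℝ, ∀ x, 0 ≤ x → ‖u x‖ ≤ C := by
  have hwc : conj w = -w := by
    rw [← hw 0 le_rfl]; simp only [map_sub, map_mul, Complex.conj_conj]; ring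
  set v : ℝ → ℂ := fun x => V x / w with hvdef
  have hv : ∀ x, conj (v x) = -v x := fun x => by
    simp only [hvdef, map_div₀, Complex.conj_ofReal, hwc, div_neg]
  have hA0 : 0 ≤ A := (norm_nonneg _).trans (hA 0 le_rfl)
  -- the coordinates of `u` in the basis `Φ, conj Φ`
  set α : ℝ → ℂ := fun x => w⁻¹ * (u' x * conj (Φ x) - u x * conj (Φ' x)) with hα
  set β : ℝ → ℂ := fun x => w⁻¹ * (u x * Φ' x - u' x * Φ x) with hβ
  have huab : ∀ x, 0 ≤ x → u x = α x * Φ x + β x * conj (Φ x) := fun x hx => by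
    simp only [hα, hβ]
    field_simp
    rw [← hw x hx]
    ring
  have pα : IsPrimitive 0 α fun x => v x * conj (Φ x) * (α x * Φ x + β x * conj (Φ x)) := by
    refine (((hu'.mul hΦ.conj).sub (hu.mul hΦ'.conj)).const_mul w⁻¹).congr_right' fun x hx => ?_
    rw [← huab x hx.le]
    simp only [hvdef, map_mul, Complex.conj_ofReal]
    push_cast
    field_simp
    ring
  have pβ : IsPrimitive 0 β fun x => -(v x * Φ x * (α x * Φ x + β x * conj (Φ x))) := by
    refine (((hu.mul hΦ').sub (hu'.mul hΦ)).const_mul w⁻¹).congr_right' fun x hx => ?_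
    rw [← huab x hx.le]
    simp only [hvdef]
    push_cast
    field_simp
    ring
  -- the threshold `1 / 256` makes the terms with `T` on the right in `hTb` add up to `T / 2`
  obtain ⟨X, hXf, hXe, hX0⟩ : ∃ X, (∀ x, X ≤ x → ‖f x‖ ≤ 1 / 2) ∧
      ∫⁻ x in Ioi X, e x < ENNReal.ofReal (1 / 256) ∧ X₀ ≤ X := by
    have h1 : ∀ᶠ X in atTop, ∀ x, X ≤ x → ‖f x‖ ≤ 1 / 2 := by
      have := (tendsto_zero_iff_norm_tendsto_zero.1 hf0).eventually
        (ge_mem_nhds (by norm_num : (0 : ℝ) < 1 / 2))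
      obtain ⟨X, hX⟩ := eventually_atTop.1 this
      filter_upwards [eventually_ge_atTop X] with Y hY x hx using hX x (hY.trans hx)
    exact (h1.and ((exists_setLIntegral_Ioi_lt he (by simp)).and
      (eventually_ge_atTop X₀))).exists
  have hX : 0 ≤ X := hX₀.trans hX0
  set ε : ℝ → ℂ := fun x => f' x + v x * (Φ x + conj (Φ x) * f x) ^ 2 with hε
  have hεe : ∀ x, X < x → ‖ε x‖ₑ ≤ e x := fun x hx => hfe x (hX0.trans_lt hx)
  have hεf : ∀ x, X < x → f' x = -(v x * (Φ x + conj (Φ x) * f x) ^ 2) + ε x := fun x _ => by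
    simp only [hε]; ring
  obtain ⟨n₁, hn₁, hb₁⟩ := isPrimitive_riccati_invariant hv (pα.mono hX) (pβ.mono hX)
    (hf.mono hX0) hXf hεf
  -- conjugation exchanges the two coordinates of a solution
  have pβ' : IsPrimitive X (fun x => conj (β x)) fun x =>
      v x * conj (Φ x) * (conj (β x) * Φ x + conj (α x) * conj (Φ x)) :=
    (pβ.mono hX).conj.congr_right' fun x _ => by
      simp only [map_neg, map_mul, map_add, Complex.conj_conj, hv]; ring
  have pα' : IsPrimitive X (fun x => conj (α x)) fun x =>
      -(v x * Φ x * (conj (β x) * Φ x + conj (α x) * conj (Φ x))) :=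
    (pα.mono hX).conj.congr_right' fun x _ => by
      simp only [map_mul, map_add, Complex.conj_conj, hv]; ring
  obtain ⟨n₂, hn₂, hb₂⟩ := isPrimitive_riccati_invariant hv pβ' pα' (hf.mono hX0) hXf hεf
  simp only [Complex.norm_conj] at hb₂
  set N₁ : ℝ → ℝ := fun x => ‖β x - f x * α x‖ ^ 2 / (1 - ‖f x‖ ^ 2) with hN₁
  set N₂ : ℝ → ℝ := fun x => ‖conj (α x) - f x * conj (β x)‖ ^ 2 / (1 - ‖f x‖ ^ 2) with hN₂
  set T : ℝ → ℝ := fun x => ‖α x‖ ^ 2 + ‖β x‖ ^ 2 with hT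
  have hTN : ∀ x, X ≤ x → T x ≤ 8 * (N₁ x + N₂ x) := fun x hx => by
    have hfx := hXf x hx
    have hη1 : 1 - ‖f x‖ ^ 2 ≤ 1 := by linarith [sq_nonneg ‖f x‖]
    have hη0 : 0 < 1 - ‖f x‖ ^ 2 := by nlinarith [norm_nonneg (f x)]
    have l₁ : ‖β x - f x * α x‖ ^ 2 ≤ N₁ x := le_div_self (by positivity) hη0 hη1
    have l₂ : ‖conj (α x) - f x * conj (β x)‖ ^ 2 ≤ N₂ x := le_div_self (by positivity) hη0 hη1
    have k₁ : ‖β x‖ ≤ ‖β x - f x * α x‖ + 1 / 2 * ‖α x‖ := by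
      have := norm_add_le (β x - f x * α x) (f x * α x)
      rw [sub_add_cancel, norm_mul (f x)] at this
      nlinarith [norm_nonneg (α x)]
    have k₂ : ‖α x‖ ≤ ‖conj (α x) - f x * conj (β x)‖ + 1 / 2 * ‖β x‖ := by
      have := norm_add_le (conj (α x) - f x * conj (β x)) (f x * conj (β x))
      rw [sub_add_cancel, norm_mul (f x), Complex.norm_conj, Complex.norm_conj] at this
      nlinarith [norm_nonneg (β x)]
    have k₃ : ‖α x‖ + ‖β x‖ ≤ 2 * (‖β x - f x * α x‖ + ‖conj (α x) - f x * conj (β x)‖) := by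
      linarith
    have := pow_le_pow_left₀ (by positivity) k₃ 2
    simp only [hT]
    nlinarith [norm_nonneg (α x), norm_nonneg (β x), mul_nonneg (norm_nonneg (α x))
      (norm_nonneg (β x)), sq_nonneg (‖β x - f x * α x‖ - ‖conj (α x) - f x * conj (β x)‖)]
  have hTc : ContinuousOn T (Ici X) :=
    ((pα.mono hX).continuousOn.norm.pow 2).add ((pβ.mono hX).continuousOn.norm.pow 2)
  -- the error is absorbed at a point where `T` is maximal on `[X, Y]`
  have hTb : ∀ Y, X ≤ Y → T Y ≤ 16 * (N₁ X + N₂ X) := by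
    intro Y hY
    obtain ⟨y, hy, hmax⟩ := isCompact_Icc.exists_isMaxOn (nonempty_Icc.2 hY)
      (hTc.mono (Icc_subset_Ici_self : Icc X Y ⊆ Ici X))
    have hT0 : 0 ≤ T y := by positivity
    have key : ∀ (N : ℝ → ℝ) (n : ℝ → ℂ), IsPrimitive X (fun x => (N x : ℂ)) n →
        (∀ x, X < x → ‖n x‖ ≤ 8 * ‖ε x‖ * (‖α x‖ ^ 2 + ‖β x‖ ^ 2)) →
        N y ≤ N X + 8 * T y * (1 / 256) := by
      intro N n hN hn
      have h1 := norm_sub_le_lintegral hN hy.1 (r := fun x => ENNReal.ofReal (8 * T y) * e x) <|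
        Eventually.of_forall fun x h1 h2 => by
          calc ‖n x‖ₑ ≤ ENNReal.ofReal (8 * T y * ‖ε x‖) := by
                rw [← ofReal_norm]
                refine ENNReal.ofReal_le_ofReal ((hn x h1).trans ?_)
                have : T x ≤ T y := hmax ⟨h1.le, h2.trans hy.2⟩
                nlinarith [norm_nonneg (ε x)]
            _ = ENNReal.ofReal (8 * T y) * ‖ε x‖ₑ := by
                rw [ENNReal.ofReal_mul (by positivity), ofReal_norm]
            _ ≤ _ := by gcongr; exact hεe x h1
      rw [lintegral_const_mul' _ _ ENNReal.ofReal_ne_top] at h1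
      have h2 : ‖(N y : ℂ) - N X‖ₑ ≤ ENNReal.ofReal (8 * T y * (1 / 256)) := by
        rw [ENNReal.ofReal_mul (by positivity)]
        refine h1.trans ?_
        gcongr
        exact (lintegral_mono_set Ioc_subset_Ioi_self).trans hXe.le
      rw [← Complex.ofReal_sub, ← ofReal_norm,
        ENNReal.ofReal_le_ofReal_iff (by positivity), Complex.norm_real, Real.norm_eq_abs] at h2
      linarith [le_abs_self (N y - N X)]
    have k₁ := key N₁ n₁ hn₁ hb₁
    have k₂ := key N₂ n₂ hn₂ fun x hx => by simpa only [add_comm] using hb₂ x hx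
    have k₃ := hTN y hy.1
    have k₄ : T Y ≤ T y := hmax (right_mem_Icc.2 hY)
    linarith
  obtain ⟨C₁, hC₁⟩ := isCompact_Icc.exists_bound_of_continuousOn
    (hu.continuousOn.mono (Icc_subset_Ici_self : Icc 0 X ⊆ Ici 0))
  refine ⟨max C₁ (A * (16 * (N₁ X + N₂ X) + 2)), fun x hx => ?_⟩
  rcases le_total x X with h | h
  · exact (hC₁ x ⟨hx, h⟩).trans (le_max_left _ _)
  · refine le_trans ?_ (le_max_right _ _)
    rw [huab x hx]
    have := hTb x h
    simp only [hT] at this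
    calc _ ≤ ‖α x‖ * ‖Φ x‖ + ‖β x‖ * ‖Φ x‖ := by
          refine (norm_add_le _ _).trans (le_of_eq ?_)
          rw [norm_mul (α x), norm_mul (β x), Complex.norm_conj]
      _ = ‖Φ x‖ * (‖α x‖ + ‖β x‖) := by ring
      _ ≤ A * (16 * (N₁ X + N₂ X) + 2) := by
          refine mul_le_mul (hA x hx) ?_ (by positivity) hA0
          nlinarith [sq_nonneg (‖α x‖ - 1), sq_nonneg (‖β x‖ - 1)]

/-! ### Energies in a gap next to a band edge are not in the essential spectrum -/

theorem tendsto_setLIntegral_Ioc_of_sq {y : ℝ → ℝ≥0∞} (hy : ∫⁻ x in Ioi (0 : ℝ), y x ^ 2 ≠ ⊤) :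
    Tendsto (fun x : ℝ => ∫⁻ t in Ioc x (x + 1), y t) atTop (𝓝 0) := by
  rw [ENNReal.tendsto_nhds_zero]
  intro δ hδ
  rcases eq_or_ne δ ⊤ with rfl | hδt
  · simp
  set η := δ / 2 with hη
  have hη0 : η ≠ 0 := (ENNReal.half_pos hδ.ne').ne'
  have hηt : η ≠ ⊤ := (ENNReal.half_lt_self hδ.ne' hδt).ne_top
  have := exists_setLIntegral_Ioi_lt hy (δ := η * η) (by positivity)
  filter_upwards [this] with x hx
  have hpt : ∀ t, y t ≤ η + η⁻¹ * y t ^ 2 := fun t => by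
    rcases le_total (y t) η with h | h
    · exact h.trans le_self_add
    · refine le_trans ?_ le_add_self
      calc y t = η⁻¹ * (η * y t) := by
            rw [← mul_assoc, ENNReal.inv_mul_cancel hη0 hηt, one_mul]
        _ ≤ η⁻¹ * y t ^ 2 := by rw [sq]; gcongr
  calc ∫⁻ t in Ioc x (x + 1), y t ≤ ∫⁻ t in Ioc x (x + 1), (η + η⁻¹ * y t ^ 2) :=
        lintegral_mono hpt
    _ = η + η⁻¹ * ∫⁻ t in Ioc x (x + 1), y t ^ 2 := by
        rw [lintegral_add_left measurable_const, lintegral_const_mul' _ _ (ENNReal.inv_ne_top.2 hη0)]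
        simp
    _ ≤ η + η⁻¹ * (η * η) := by
        gcongr
        exact (lintegral_mono_set Ioc_subset_Ioi_self).trans hx.le
    _ = δ := by
        rw [← mul_assoc, ENNReal.inv_mul_cancel hη0 hηt, one_mul, hη, ENNReal.add_halves]

theorem tendsto_zero_of_enorm_le {a : ℝ → ℂ} {r : ℝ → ℝ≥0∞} (h : ∀ᶠ x in atTop, ‖a x‖ₑ ≤ r x)
    (hr : Tendsto r atTop (𝓝 0)) : Tendsto a atTop (𝓝 0) :=
  tendsto_zero_iff_enorm_tendsto_zero.2
    (tendsto_of_tendsto_of_tendsto_of_le_of_le' tendsto_const_nhds hr (by simp) h)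

/-- A real solution `r` of `-r'' + q r = 0` together with a function `χ` such that `χ + κ x r` is a
second solution, of Wronskian one with `r`; all of `r, r', χ` and `χ₁ = χ' + κ r` are bounded. For a
periodic `q` this is the fundamental system at an edge of the spectrum, and `κ ≠ 0` when the
monodromy matrix is a nontrivial Jordan block. -/
structure IsEdgeSystem (q : ℝ → ℝ) (r r' χ χ₁ : ℝ → ℝ) (κ A : ℝ) : Prop where
  prim_r : IsPrimitive 0 (fun x => (r x : ℂ)) (fun x => (r' x : ℂ))
  prim_r' : IsPrimitive 0 (fun x => (r' x : ℂ)) (fun x => q x * r x)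
  prim_χ : IsPrimitive 0 (fun x => (χ x : ℂ)) (fun x => χ₁ x - κ * r x)
  prim_χ₁ : IsPrimitive 0 (fun x => (χ₁ x : ℂ)) (fun x => q x * χ x - κ * r' x)
  wronskian : ∀ x, 0 ≤ x → r x * χ₁ x - r' x * χ x = 1
  r_le : ∀ x, 0 ≤ x → |r x| ≤ A
  r'_le : ∀ x, 0 ≤ x → |r' x| ≤ A
  χ_le : ∀ x, 0 ≤ x → |χ x| ≤ A
  χ₁_le : ∀ x, 0 ≤ x → |χ₁ x| ≤ A

/-- The cubic equal to one at `x` and to zero at `x + 1`, with vanishing derivative at both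
points. -/
def cutoff (x t : ℝ) : ℝ := 1 - 3 * (t - x) ^ 2 + 2 * (t - x) ^ 3

/-- The first derivative of `cutoff`. -/
def cutoff' (x t : ℝ) : ℝ := -6 * (t - x) + 6 * (t - x) ^ 2

/-- The second derivative of `cutoff`. -/
def cutoff'' (x t : ℝ) : ℝ := -6 + 12 * (t - x)

theorem isPrimitive_cutoff (X x : ℝ) :
    IsPrimitive X (fun t => (cutoff x t : ℂ)) (fun t => (cutoff' x t : ℂ)) := by
  refine .of_hasDerivAt (by unfold cutoff'; fun_prop) fun t _ => ?_
  have h1 : HasDerivAt (fun t : ℝ => t - x) 1 t := (hasDerivAt_id t).sub_const x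
  have := (((h1.pow 2).const_mul 3).const_sub 1).add ((h1.pow 3).const_mul 2)
  refine HasDerivAt.ofReal_comp ?_
  refine this.congr_deriv ?_
  simp only [cutoff']; push_cast; ring

theorem isPrimitive_cutoff' (X x : ℝ) :
    IsPrimitive X (fun t => (cutoff' x t : ℂ)) (fun t => (cutoff'' x t : ℂ)) := by
  refine .of_hasDerivAt (by unfold cutoff''; fun_prop) fun t _ => ?_
  have h1 : HasDerivAt (fun t : ℝ => t - x) 1 t := (hasDerivAt_id t).sub_const x
  have := (h1.const_mul (-6)).add ((h1.pow 2).const_mul 6)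
  refine HasDerivAt.ofReal_comp ?_
  refine this.congr_deriv ?_
  simp only [cutoff'']; push_cast; ring

theorem abs_cutoff_le {x t : ℝ} (h1 : x < t) (h2 : t ≤ x + 1) :
    |cutoff x t| ≤ 6 ∧ |cutoff' x t| ≤ 6 ∧ |cutoff'' x t| ≤ 6 := by
  obtain ⟨s, rfl⟩ : ∃ s, t = x + s := ⟨t - x, by ring⟩
  have hs0 : 0 < s := by linarith
  have hs1 : s ≤ 1 := by linarith
  have h2 : 0 ≤ s ^ 2 := by positivity
  have h2' : s ^ 2 ≤ 1 := pow_le_one₀ hs0.le hs1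
  have h3 : 0 ≤ s ^ 3 := by positivity
  have h3' : s ^ 3 ≤ 1 := pow_le_one₀ hs0.le hs1
  simp only [cutoff, cutoff', cutoff'', add_sub_cancel_left]
  refine ⟨abs_le.2 ⟨?_, ?_⟩, abs_le.2 ⟨?_, ?_⟩, abs_le.2 ⟨?_, ?_⟩⟩ <;> linarith

namespace IsEdgeSystem

variable {q r r' χ χ₁ : ℝ → ℝ} {κ A ε : ℝ} {u u' g : ℝ → ℂ}

/-- The coordinates of `u` with respect to `r` and `χ`, for a solution of the inhomogeneous equation
`-u'' + q u - ε u = g`; see `eq_fst_add_snd`. -/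
theorem isPrimitive_fst (S : IsEdgeSystem q r r' χ χ₁ κ A) (hu : IsPrimitive 0 u u')
    (hu' : IsPrimitive 0 u' fun x => q x * u x - ε * u x - g x) :
    IsPrimitive 0 (fun x => u x * χ₁ x - u' x * χ x)
      (fun x => κ * (r x * u' x - r' x * u x) + (ε * u x + g x) * χ x) :=
  ((hu.mul S.prim_χ₁).sub (hu'.mul S.prim_χ)).congr_right' fun x _ => by ring

theorem isPrimitive_snd (S : IsEdgeSystem q r r' χ χ₁ κ A) (hu : IsPrimitive 0 u u')
    (hu' : IsPrimitive 0 u' fun x => q x * u x - ε * u x - g x) :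
    IsPrimitive 0 (fun x => r x * u' x - r' x * u x) (fun x => -(r x * (ε * u x + g x))) :=
  ((S.prim_r.mul hu').sub (S.prim_r'.mul hu)).congr_right' fun x _ => by ring

theorem eq_fst_add_snd (S : IsEdgeSystem q r r' χ χ₁ κ A) {x : ℝ} (hx : 0 ≤ x) :
    u x = (u x * χ₁ x - u' x * χ x) * r x + (r x * u' x - r' x * u x) * χ x := by
  have : ((r x * χ₁ x - r' x * χ x : ℝ) : ℂ) = 1 := by rw [S.wronskian x hx]; simp
  push_cast at this
  linear_combination -u x * this

theorem nonneg (S : IsEdgeSystem q r r' χ χ₁ κ A) : 0 ≤ A :=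
  (abs_nonneg _).trans (S.r_le 0 le_rfl)

/-- The coordinate `r u' - r' u` of a square integrable `u` with square integrable `g` vanishes at
infinity: integrating by parts against a cutoff bounds it by local integrals of `u` and `g`. -/
theorem tendsto_snd (S : IsEdgeSystem q r r' χ χ₁ κ A) (hu : IsPrimitive 0 u u')
    (hu' : IsPrimitive 0 u' fun x => q x * u x - ε * u x - g x)
    (hu2 : ∫⁻ x in Ioi (0 : ℝ), ‖u x‖ₑ ^ 2 ≠ ⊤) (hg2 : ∫⁻ x in Ioi (0 : ℝ), ‖g x‖ₑ ^ 2 ≠ ⊤) :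
    Tendsto (fun x => r x * u' x - r' x * u x) atTop (𝓝 0) := by
  have hA := S.nonneg
  set C : ℝ := A * (6 * |ε| + 30) with hC
  have hC0 : 0 ≤ C := by positivity
  have hlim := (ENNReal.Tendsto.const_mul (a := ENNReal.ofReal C)
      (tendsto_setLIntegral_Ioc_of_sq hu2) (Or.inr ENNReal.ofReal_ne_top)).add
    (ENNReal.Tendsto.const_mul (a := ENNReal.ofReal C)
      (tendsto_setLIntegral_Ioc_of_sq hg2) (Or.inr ENNReal.ofReal_ne_top))
  rw [mul_zero, add_zero] at hlim
  refine tendsto_zero_of_enorm_le ?_ hlim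
  filter_upwards [eventually_ge_atTop 0] with x hx
  have hp := (((isPrimitive_cutoff x x).mul ((S.isPrimitive_snd hu hu').mono hx)).sub
    ((isPrimitive_cutoff' x x).mul ((S.prim_r.mul hu).mono hx)))
  have key := norm_sub_le_lintegral hp (b := x + 1) (by linarith)
    (r := fun t => ENNReal.ofReal C * ‖u t‖ₑ + ENNReal.ofReal C * ‖g t‖ₑ) <|
    Eventually.of_forall fun t h1 h2 => by
      have ht : 0 ≤ t := hx.trans h1.le
      obtain ⟨c0, c1, c2⟩ := abs_cutoff_le h1 h2
      have e1 := S.r_le t ht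
      have e2 := S.r'_le t ht
      rw [← ofReal_norm, ← ofReal_norm, ← ofReal_norm, ← ENNReal.ofReal_mul hC0,
        ← ENNReal.ofReal_mul hC0, ← ENNReal.ofReal_add (by positivity) (by positivity)]
      refine ENNReal.ofReal_le_ofReal ?_
      calc _ = ‖-(cutoff x t * r t * (ε * u t + g t)) -
              (cutoff'' x t * r t + 2 * cutoff' x t * r' t) * u t‖ := by congr 1; ring
        _ ≤ |cutoff x t| * |r t| * (|ε| * ‖u t‖ + ‖g t‖) +
              (|cutoff'' x t| * |r t| + 2 * |cutoff' x t| * |r' t|) * ‖u t‖ := by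
            refine (norm_sub_le _ _).trans (add_le_add ?_ ?_)
            · rw [norm_neg, norm_mul, norm_mul, Complex.norm_real, Complex.norm_real,
                Real.norm_eq_abs, Real.norm_eq_abs]
              gcongr
              refine (norm_add_le _ _).trans_eq ?_
              rw [norm_mul, Complex.norm_real, Real.norm_eq_abs]
            · rw [norm_mul]
              gcongr
              refine (norm_add_le _ _).trans_eq ?_
              simp
        _ ≤ 6 * A * (|ε| * ‖u t‖ + ‖g t‖) + (6 * A + 2 * 6 * A) * ‖u t‖ := by gcongr
        _ ≤ C * ‖u t‖ + C * ‖g t‖ := by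
            rw [hC]
            nlinarith [mul_nonneg hA (norm_nonneg (u t)), mul_nonneg hA (norm_nonneg (g t)),
              mul_nonneg (mul_nonneg hA (abs_nonneg ε)) (norm_nonneg (g t)), abs_nonneg ε]
  rw [lintegral_add_left' (((hu.continuousOn.mono fun t ht => hx.trans
      (le_of_lt ht.1)).aestronglyMeasurable measurableSet_Ioc).enorm.const_mul _),
    lintegral_const_mul' _ _ ENNReal.ofReal_ne_top,
    lintegral_const_mul' _ _ ENNReal.ofReal_ne_top] at key
  refine le_trans (le_of_eq ?_) key
  rw [← enorm_neg]
  congr 1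
  simp [cutoff, cutoff']
  ring

/-- The other coordinate vanishes at infinity by the same argument; its derivative contains
`κ (r u' - r' u)` in addition, which is already known to vanish at infinity. -/
theorem tendsto_fst (S : IsEdgeSystem q r r' χ χ₁ κ A) (hu : IsPrimitive 0 u u')
    (hu' : IsPrimitive 0 u' fun x => q x * u x - ε * u x - g x)
    (hu2 : ∫⁻ x in Ioi (0 : ℝ), ‖u x‖ₑ ^ 2 ≠ ⊤) (hg2 : ∫⁻ x in Ioi (0 : ℝ), ‖g x‖ₑ ^ 2 ≠ ⊤) :
    Tendsto (fun x => u x * χ₁ x - u' x * χ x) atTop (𝓝 0) := by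
  have hA := S.nonneg
  have hb := S.tendsto_snd hu hu' hu2 hg2
  set b : ℝ → ℂ := fun x => r x * u' x - r' x * u x with hbdef
  set C : ℝ := A * (6 * |ε| + 30 + 6 * |κ|) with hC
  have hC0 : 0 ≤ C := by positivity
  have hblim : Tendsto (fun x : ℝ => ∫⁻ t in Ioc x (x + 1), ‖b t‖ₑ) atTop (𝓝 0) := by
    rw [ENNReal.tendsto_nhds_zero]
    intro δ hδ
    obtain ⟨Y, hY⟩ := eventually_atTop.1
      ((tendsto_zero_iff_enorm_tendsto_zero.1 hb).eventually (ge_mem_nhds hδ))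
    filter_upwards [eventually_ge_atTop Y] with x hx
    calc ∫⁻ t in Ioc x (x + 1), ‖b t‖ₑ ≤ ∫⁻ t in Ioc x (x + 1), δ :=
          setLIntegral_mono' measurableSet_Ioc fun t ht => hY t (hx.trans ht.1.le)
      _ = δ := by simp
  have hlim := ((ENNReal.Tendsto.const_mul (a := ENNReal.ofReal C)
      (tendsto_setLIntegral_Ioc_of_sq hu2) (Or.inr ENNReal.ofReal_ne_top)).add
    (ENNReal.Tendsto.const_mul (a := ENNReal.ofReal C)
      (tendsto_setLIntegral_Ioc_of_sq hg2) (Or.inr ENNReal.ofReal_ne_top))).add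
    (ENNReal.Tendsto.const_mul (a := ENNReal.ofReal (6 * |κ|)) hblim
      (Or.inr ENNReal.ofReal_ne_top))
  simp only [mul_zero, add_zero] at hlim
  refine tendsto_zero_of_enorm_le ?_ hlim
  filter_upwards [eventually_ge_atTop 0] with x hx
  have hbp := S.isPrimitive_snd hu hu'
  have hp := (((isPrimitive_cutoff x x).mul ((S.isPrimitive_fst hu hu').mono hx)).add
    ((isPrimitive_cutoff' x x).mul ((S.prim_χ.mul hu).mono hx)))
  have key := norm_sub_le_lintegral hp (b := x + 1) (by linarith)
    (r := fun t => ENNReal.ofReal C * ‖u t‖ₑ + ENNReal.ofReal C * ‖g t‖ₑ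
      + ENNReal.ofReal (6 * |κ|) * ‖b t‖ₑ) <|
    Eventually.of_forall fun t h1 h2 => by
      have ht : 0 ≤ t := hx.trans h1.le
      obtain ⟨c0, c1, c2⟩ := abs_cutoff_le h1 h2
      have e1 := S.r_le t ht
      have e2 := S.χ_le t ht
      have e3 := S.χ₁_le t ht
      rw [← ofReal_norm, ← ofReal_norm, ← ofReal_norm, ← ofReal_norm, ← ENNReal.ofReal_mul hC0,
        ← ENNReal.ofReal_mul hC0, ← ENNReal.ofReal_mul (by positivity),
        ← ENNReal.ofReal_add (by positivity) (by positivity),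
        ← ENNReal.ofReal_add (by positivity) (by positivity)]
      refine ENNReal.ofReal_le_ofReal ?_
      calc _ = ‖(cutoff x t * κ * b t + cutoff x t * χ t * (ε * u t + g t)) +
              (cutoff'' x t * χ t + cutoff' x t * (2 * χ₁ t - κ * r t)) * u t‖ := by
            simp only [hbdef]; congr 1; ring
        _ ≤ (|cutoff x t| * |κ| * ‖b t‖ + |cutoff x t| * |χ t| * (|ε| * ‖u t‖ + ‖g t‖)) +
              (|cutoff'' x t| * |χ t| + |cutoff' x t| * (2 * |χ₁ t| + |κ| * |r t|)) * ‖u t‖ := by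
            refine (norm_add_le _ _).trans (add_le_add ((norm_add_le _ _).trans
              (add_le_add ?_ ?_)) ?_)
            · rw [norm_mul, norm_mul, Complex.norm_real, Complex.norm_real,
                Real.norm_eq_abs, Real.norm_eq_abs]
            · rw [norm_mul, norm_mul, Complex.norm_real, Complex.norm_real,
                Real.norm_eq_abs, Real.norm_eq_abs]
              gcongr
              refine (norm_add_le _ _).trans_eq ?_
              rw [norm_mul, Complex.norm_real, Real.norm_eq_abs]
            · rw [norm_mul]
              gcongr
              refine (norm_add_le _ _).trans (add_le_add (by simp) ?_)
              rw [norm_mul, Complex.norm_real, Real.norm_eq_abs]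
              gcongr
              exact (norm_sub_le _ _).trans (by simp)
        _ ≤ (6 * |κ| * ‖b t‖ + 6 * A * (|ε| * ‖u t‖ + ‖g t‖)) +
              (6 * A + 6 * (2 * A + |κ| * A)) * ‖u t‖ := by gcongr
        _ ≤ C * ‖u t‖ + C * ‖g t‖ + 6 * |κ| * ‖b t‖ := by
            rw [hC]
            nlinarith [mul_nonneg hA (norm_nonneg (u t)), mul_nonneg hA (norm_nonneg (g t)),
              mul_nonneg (mul_nonneg hA (abs_nonneg ε)) (norm_nonneg (g t)),
              mul_nonneg (mul_nonneg hA (abs_nonneg κ)) (norm_nonneg (g t))]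
  have hsub : Ioc x (x + 1) ⊆ Ici 0 := fun t ht => hx.trans (le_of_lt ht.1)
  rw [lintegral_add_right' _ (((hbp.continuousOn.mono hsub).aestronglyMeasurable
      measurableSet_Ioc).enorm.const_mul _),
    lintegral_add_left' (((hu.continuousOn.mono hsub).aestronglyMeasurable
      measurableSet_Ioc).enorm.const_mul _),
    lintegral_const_mul' _ _ ENNReal.ofReal_ne_top,
    lintegral_const_mul' _ _ ENNReal.ofReal_ne_top,
    lintegral_const_mul' _ _ ENNReal.ofReal_ne_top] at key
  refine le_trans (le_of_eq ?_) key
  rw [← enorm_neg]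
  congr 1
  simp [cutoff, cutoff']
  ring

/-- The pointwise estimate behind `integral_sq_le`, with `B = |b|`, `P = |r a|`, `G = |g|`, `U = |u|`
and `X = χ²`. -/
theorem lyapunov_inequality {A B G P U X κ μ c : ℝ} (hμ : 0 < μ)
    (hX : μ * X ≤ κ ^ 2 / 2) (hc : 0 ≤ c) (hc1 : c ≤ κ ^ 2 / (8 * (A ^ 2 + 1))) (hc2 : c ≤ μ / 4)
    (hU : U ^ 2 ≤ 2 * P ^ 2 + 2 * A ^ 2 * B ^ 2) :
    c * U ^ 2 - (A ^ 2 + κ ^ 2 / (2 * μ)) * G ^ 2 ≤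
      (κ ^ 2 - μ * X) * B ^ 2 + μ * P ^ 2 - |κ| * (G * A * B + P * G) := by
  have f1 : |κ| * (G * A * B) ≤ κ ^ 2 / 4 * B ^ 2 + A ^ 2 * G ^ 2 := by
    nlinarith [sq_nonneg (|κ| / 2 * B - A * G), sq_abs κ]
  have f2 : |κ| * (P * G) ≤ μ / 2 * P ^ 2 + κ ^ 2 / (2 * μ) * G ^ 2 := by
    have : μ / 2 * P ^ 2 + κ ^ 2 / (2 * μ) * G ^ 2 - |κ| * (P * G)
        = (μ * P - |κ| * G) ^ 2 / (2 * μ) := by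
      field_simp
      rw [← sq_abs κ]
      ring
    have h2 : 0 ≤ (μ * P - |κ| * G) ^ 2 / (2 * μ) := by positivity
    linarith
  have f3 : κ ^ 2 / 2 * B ^ 2 ≤ (κ ^ 2 - μ * X) * B ^ 2 := by
    gcongr
    linarith
  have c1 : c * (2 * P ^ 2) ≤ μ / 2 * P ^ 2 := by nlinarith [sq_nonneg P]
  have c2 : c * (2 * A ^ 2 * B ^ 2) ≤ κ ^ 2 / 4 * B ^ 2 := by
    rw [le_div_iff₀ (by positivity)] at hc1
    have h2 : 0 ≤ B ^ 2 := by positivity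
    nlinarith [mul_le_mul_of_nonneg_right hc1 h2, mul_nonneg hc h2]
  have c3 : c * U ^ 2 ≤ c * (2 * P ^ 2) + c * (2 * A ^ 2 * B ^ 2) := by
    rw [← mul_add]; gcongr
  linarith

/-- The a priori estimate: when `κ ε < 0` and `ε` is small, the real part of the product of the
coordinate `a` with the conjugate of `b` is a Lyapunov function, and `‖u‖₂` is controlled by
`‖g‖₂` for every `u` with zero initial data. -/
theorem integral_sq_le (S : IsEdgeSystem q r r' χ χ₁ κ A) (hκε : κ * ε < 0)
    (hε : |κ * ε| * A ^ 2 ≤ κ ^ 2 / 2) :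
    ∃ c > 0, ∀ u u' g : ℝ → ℂ, IsPrimitive 0 u u' →
      IsPrimitive 0 u' (fun x => q x * u x - ε * u x - g x) →
      u 0 = 0 → u' 0 = 0 →
      IntegrableOn (fun x => ‖u x‖ ^ 2) (Ioi 0) → IntegrableOn (fun x => ‖g x‖ ^ 2) (Ioi 0) →
      c * ∫ x in Ioi 0, ‖u x‖ ^ 2 ≤ ∫ x in Ioi 0, ‖g x‖ ^ 2 := by
  have hA := S.nonneg
  set μ := -(κ * ε) with hμ
  have hμ0 : 0 < μ := by linarith
  rw [abs_of_neg hκε, ← hμ] at hε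
  have hκ : 0 < κ ^ 2 := by
    have : κ ≠ 0 := fun h => by simp [h] at hκε
    positivity
  set C := A ^ 2 + κ ^ 2 / (2 * μ) with hC
  set c := min (κ ^ 2 / (8 * (A ^ 2 + 1))) (μ / 4) with hc
  have hc0 : 0 < c := lt_min (by positivity) (by positivity)
  have hC0 : 0 < C := by positivity
  refine ⟨c / C, by positivity, fun u u' g hu hu' h0 h0' hu2 hg2 => ?_⟩
  have lfin : ∀ y : ℝ → ℂ, IntegrableOn (fun x => ‖y x‖ ^ 2) (Ioi 0) →
      ∫⁻ x in Ioi (0 : ℝ), ‖y x‖ₑ ^ 2 ≠ ⊤ := fun y hy => by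
    have := hy.2
    rw [hasFiniteIntegral_iff_enorm] at this
    refine ne_of_lt (lt_of_eq_of_lt (lintegral_congr fun x => ?_) this)
    rw [enorm_pow, enorm_norm]
  have ha0 := S.tendsto_fst hu hu' (lfin u hu2) (lfin g hg2)
  have hb0 := S.tendsto_snd hu hu' (lfin u hu2) (lfin g hg2)
  have pa := S.isPrimitive_fst hu hu'
  have pb := S.isPrimitive_snd hu hu'
  have hdec : ∀ x, 0 ≤ x → u x = (u x * χ₁ x - u' x * χ x) * r x
      + (r x * u' x - r' x * u x) * χ x := fun x hx => S.eq_fst_add_snd hx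
  set a : ℝ → ℂ := fun x => u x * χ₁ x - u' x * χ x with hadef
  set b : ℝ → ℂ := fun x => r x * u' x - r' x * u x with hbdef
  have pL := (pa.mul pb.conj).const_mul (κ : ℂ)
  have hpt : ∀ x, 0 ≤ x → c * ‖u x‖ ^ 2 - C * ‖g x‖ ^ 2 ≤
      ((κ : ℂ) * ((κ * b x + (ε * u x + g x) * χ x) * conj (b x)
        + a x * conj (-(r x * (ε * u x + g x))))).re := by
    intro x hx
    have hux : u x = a x * r x + b x * χ x := hdec x hx
    have hχ := S.χ_le x hx
    have hχ2 : χ x ^ 2 ≤ A ^ 2 := sq_le_sq' (by linarith [abs_le.1 hχ]) (abs_le.1 hχ).2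
    have e0 : ((κ : ℂ) * ((κ * b x + (ε * u x + g x) * χ x) * conj (b x)
        + a x * conj (-(r x * (ε * u x + g x))))).re
        = (κ ^ 2 - μ * χ x ^ 2) * ‖b x‖ ^ 2 + μ * ‖r x * a x‖ ^ 2
          + κ * (g x * χ x * conj (b x) - r x * a x * conj (g x)).re := by
      rw [hux, ← Complex.normSq_eq_norm_sq, ← Complex.normSq_eq_norm_sq]
      simp [Complex.normSq_apply, hμ]
      ring
    have e1 : |(g x * χ x * conj (b x) - r x * a x * conj (g x)).re|
        ≤ ‖g x‖ * A * ‖b x‖ + ‖r x * a x‖ * ‖g x‖ := by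
      refine (Complex.abs_re_le_norm _).trans ((norm_sub_le _ _).trans (add_le_add ?_ ?_))
      · rw [norm_mul, norm_mul, Complex.norm_conj, Complex.norm_real, Real.norm_eq_abs]
        gcongr
      · rw [norm_mul _ (conj _), Complex.norm_conj]
    have e2 : -(|κ| * (‖g x‖ * A * ‖b x‖ + ‖r x * a x‖ * ‖g x‖)) ≤
        κ * (g x * χ x * conj (b x) - r x * a x * conj (g x)).re := by
      have := neg_abs_le (κ * (g x * χ x * conj (b x) - r x * a x * conj (g x)).re)
      rw [abs_mul] at this
      nlinarith [mul_le_mul_of_nonneg_left e1 (abs_nonneg κ)]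
    rw [e0]
    have e3 : ‖u x‖ ^ 2 ≤ 2 * ‖r x * a x‖ ^ 2 + 2 * A ^ 2 * ‖b x‖ ^ 2 := by
      have h1 : ‖u x‖ ≤ ‖r x * a x‖ + A * ‖b x‖ := by
        rw [hux]
        refine (norm_add_le _ _).trans (add_le_add (by rw [mul_comm]) ?_)
        rw [norm_mul, Complex.norm_real, Real.norm_eq_abs, mul_comm]
        gcongr
      have := pow_le_pow_left₀ (norm_nonneg _) h1 2
      nlinarith [sq_nonneg (‖r x * a x‖ - A * ‖b x‖)]
    have e4 : μ * χ x ^ 2 ≤ κ ^ 2 / 2 := (mul_le_mul_of_nonneg_left hχ2 hμ0.le).trans hε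
    have := lyapunov_inequality hμ0 e4 hc0.le (min_le_left _ _)
      (min_le_right _ _) e3 (G := ‖g x‖) (P := ‖r x * a x‖)
    linarith
  have hbound : ∀ N : ℝ, 0 ≤ N → (∫ x in (0 : ℝ)..N, (c * ‖u x‖ ^ 2 - C * ‖g x‖ ^ 2)) ≤
      ((κ : ℂ) * (a N * conj (b N))).re := fun N hN => by
    have h1 := pL.integral_re hN
    have h00 : b 0 = 0 := by simp [hbdef, h0, h0']
    have : ((κ : ℂ) * (a 0 * conj (b 0))).re = 0 := by rw [h00]; simp
    rw [this, sub_zero] at h1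
    rw [← h1]
    refine intervalIntegral.integral_mono_on hN ?_ (pL.intervalIntegrable_re hN)
      fun x hx => hpt x hx.1
    rw [intervalIntegrable_iff_integrableOn_Ioc_of_le hN]
    exact IntegrableOn.mono_set ((hu2.const_mul c).sub (hg2.const_mul C)) Ioc_subset_Ioi_self
  have hl1 := intervalIntegral_tendsto_integral_Ioi 0
    ((hu2.const_mul c).sub (hg2.const_mul C)) tendsto_id
  have hl2 : Tendsto (fun N => ((κ : ℂ) * (a N * conj (b N))).re) atTop (𝓝 0) := by
    have := ((ha0.mul (Complex.continuous_conj.tendsto' 0 0 (map_zero _) |>.comp hb0)).const_mul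
      (κ : ℂ))
    rw [mul_zero, mul_zero] at this
    exact (Complex.continuous_re.tendsto' 0 0 Complex.zero_re).comp this
  have := le_of_tendsto_of_tendsto hl1 hl2
    ((eventually_ge_atTop 0).mono fun N hN => hbound N hN)
  erw [integral_sub (hu2.const_mul c) (hg2.const_mul C), integral_const_mul,
    integral_const_mul] at this
  rw [div_mul_eq_mul_div, div_le_iff₀ hC0]
  linarith

end IsEdgeSystem

theorem integral_norm_sq_lt_of_eLpNorm_lt {μ : Measure ℝ} {g : ℝ → ℂ} (hg : MemLp g 2 μ) {δ : ℝ}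
    (hδ : 0 < δ) (h : eLpNorm g 2 μ < ENNReal.ofReal δ) : ∫ x, ‖g x‖ ^ 2 ∂μ < δ ^ 2 := by
  rw [hg.eLpNorm_eq_integral_rpow_norm (by simp) (by simp), ENNReal.ofReal_lt_ofReal_iff hδ] at h
  simp only [ENNReal.toReal_ofNat, Real.rpow_ofNat] at h
  have h0 : 0 ≤ ∫ x, ‖g x‖ ^ 2 ∂μ := integral_nonneg fun x => by positivity
  rw [← one_div, ← Real.sqrt_eq_rpow] at h
  exact (Real.sqrt_lt' hδ).1 h

/-- The Pythagorean theorem for two orthonormal functions. -/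
theorem integral_norm_sq_sub {μ : Measure ℝ} {f₁ f₂ : ℝ → ℂ} (h₁ : MemLp f₁ 2 μ)
    (h₂ : MemLp f₂ 2 μ) (h₁₁ : ∫ x, conj (f₁ x) * f₁ x ∂μ = 1)
    (h₂₂ : ∫ x, conj (f₂ x) * f₂ x ∂μ = 1) (h₁₂ : ∫ x, conj (f₁ x) * f₂ x ∂μ = 0)
    (h₂₁ : ∫ x, conj (f₂ x) * f₁ x ∂μ = 0) (a b : ℂ) :
    ∫ x, ‖a * f₁ x - b * f₂ x‖ ^ 2 ∂μ = ‖a‖ ^ 2 + ‖b‖ ^ 2 := by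
  have i : ∀ {f g : ℝ → ℂ}, MemLp f 2 μ → MemLp g 2 μ →
      Integrable (fun x => conj (f x) * g x) μ := fun hf hg => hf.star.integrable_mul hg
  apply Complex.ofReal_injective
  rw [← integral_complex_ofReal]
  have : ∀ x, ((‖a * f₁ x - b * f₂ x‖ ^ 2 : ℝ) : ℂ) =
      (conj a * a) * (conj (f₁ x) * f₁ x) + (conj b * b) * (conj (f₂ x) * f₂ x)
        - ((conj a * b) * (conj (f₁ x) * f₂ x) + (conj b * a) * (conj (f₂ x) * f₁ x)) := fun x => by
    rw [← Complex.normSq_eq_norm_sq, ← Complex.mul_conj]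
    simp only [map_sub, map_mul]
    ring
  simp only [this]
  rw [integral_sub, integral_add, integral_add, integral_const_mul, integral_const_mul,
    integral_const_mul, integral_const_mul, h₁₁, h₂₂, h₁₂, h₂₁, ← Complex.normSq_eq_conj_mul_self,
    ← Complex.normSq_eq_conj_mul_self, Complex.normSq_eq_norm_sq, Complex.normSq_eq_norm_sq]
  · simp
  · exact (i h₁ h₂).const_mul _
  · exact (i h₂ h₁).const_mul _
  · exact (i h₁ h₁).const_mul _
  · exact (i h₂ h₂).const_mul _
  · exact ((i h₁ h₁).const_mul _).add ((i h₂ h₂).const_mul _)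
  · exact ((i h₁ h₂).const_mul _).add ((i h₂ h₁).const_mul _)

/-- Since the initial data of functions in the domain span a line, every two members of a singular
sequence have a nontrivial combination with zero initial data, which violates the a priori
estimate. -/
theorem IsEdgeSystem.notMem_essSpectrum {V₀ r r' χ χ₁ : ℝ → ℝ} {E κ A ε : ℝ}
    (S : IsEdgeSystem (fun x => V₀ x - E) r r' χ χ₁ κ A) (hκε : κ * ε < 0)
    (hε : |κ * ε| * A ^ 2 ≤ κ ^ 2 / 2) (θ : ℝ) : E + ε ∉ essSpectrum θ V₀ := by
  rintro ⟨u, hdom, horth, hlim⟩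
  obtain ⟨c, hc, hest⟩ := S.integral_sq_le hκε hε
  set g : ℕ → ℝ → ℂ := fun n x => schrodinger V₀ (u n) x - ((E + ε : ℝ) : ℂ) * u n x with hg
  have hgm : ∀ n, MemLp (g n) 2 halfLine := fun n =>
    (hdom n).memLp_apply.sub ((hdom n).memLp.const_mul _)
  have sq_int : ∀ {f : ℝ → ℂ}, MemLp f 2 halfLine → IntegrableOn (fun x => ‖f x‖ ^ 2) (Ioi 0) :=
    fun hf => hf.integrable_norm_pow (by simp)
  -- the equation for the members of the sequence
  have pu : ∀ n, IsPrimitive 0 (u n) (D (u n)) := fun n => (hdom n).acLoc.isPrimitive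
  have pu' : ∀ n, IsPrimitive 0 (D (u n))
      (fun x => ((V₀ x - E : ℝ) : ℂ) * u n x - ε * u n x - g n x) := fun n =>
    (hdom n).acLoc.isPrimitive_deriv.congr_right' fun x _ => by
      simp only [hg, schrodinger]; push_cast; ring
  have comb : ∀ (n m : ℕ) (a b : ℂ), a * u n 0 = b * u m 0 → a * D (u n) 0 = b * D (u m) 0 →
      c * ∫ x in Ioi 0, ‖a * u n x - b * u m x‖ ^ 2 ≤
        ∫ x in Ioi 0, ‖a * g n x - b * g m x‖ ^ 2 := fun n m a b h1 h2 =>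
    hest _ _ (fun x => a * g n x - b * g m x) (((pu n).const_mul a).sub ((pu m).const_mul b))
      ((((pu' n).const_mul a).sub ((pu' m).const_mul b)).congr_right' fun x _ => by ring)
      (sub_eq_zero.2 h1) (sub_eq_zero.2 h2)
      (sq_int (((hdom n).memLp.const_mul a).sub ((hdom m).memLp.const_mul b)))
      (sq_int (((hgm n).const_mul a).sub ((hgm m).const_mul b)))
  have bcomb : ∀ (n m : ℕ) (a b : ℂ), ∫ x in Ioi 0, ‖a * g n x - b * g m x‖ ^ 2 ≤
      2 * ‖a‖ ^ 2 * (∫ x, ‖g n x‖ ^ 2 ∂halfLine) + 2 * ‖b‖ ^ 2 * ∫ x, ‖g m x‖ ^ 2 ∂halfLine := by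
    intro n m a b
    have i1 := (sq_int (hgm n)).const_mul (2 * ‖a‖ ^ 2)
    have i2 := (sq_int (hgm m)).const_mul (2 * ‖b‖ ^ 2)
    rw [← integral_const_mul, ← integral_const_mul]
    erw [← integral_add i1 i2]
    refine integral_mono (sq_int (((hgm n).const_mul a).sub ((hgm m).const_mul b))) (i1.add i2)
      fun x => ?_
    have h1 := norm_sub_le (a * g n x) (b * g m x)
    rw [norm_mul a, norm_mul b] at h1
    have := pow_le_pow_left₀ (norm_nonneg _) h1 2
    beta_reduce
    nlinarith [sq_nonneg (‖a‖ * ‖g n x‖ - ‖b‖ * ‖g m x‖)]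
  -- the initial data are `z n • (sin θ, cos θ)`
  set z : ℕ → ℂ := fun n => u n 0 * Real.sin θ + D (u n) 0 * Real.cos θ with hz
  have trig : (Real.sin θ : ℂ) ^ 2 + (Real.cos θ : ℂ) ^ 2 = 1 := by
    exact_mod_cast Real.sin_sq_add_cos_sq θ
  have hz1 : ∀ n, u n 0 = z n * Real.sin θ := fun n => by
    simp only [hz]
    linear_combination -(u n 0) * trig - (Real.cos θ : ℂ) * (hdom n).boundary
  have hz2 : ∀ n, D (u n) 0 = z n * Real.cos θ := fun n => by
    simp only [hz]
    linear_combination -(D (u n) 0) * trig + (Real.sin θ : ℂ) * (hdom n).boundary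
  obtain ⟨N, hN⟩ := eventually_atTop.1 (hlim.eventually
    (gt_mem_nhds (ENNReal.ofReal_pos.2 (Real.sqrt_pos.2 (by positivity : 0 < c / 4)))))
  have hsmall : ∀ n, N ≤ n → ∫ x, ‖g n x‖ ^ 2 ∂halfLine < c / 4 := fun n hn => by
    have := integral_norm_sq_lt_of_eLpNorm_lt (hgm n) (Real.sqrt_pos.2 (by positivity)) (hN n hn)
    rwa [Real.sq_sqrt (by positivity)] at this
  have hpyth : ∀ a b : ℂ, ∫ x in Ioi 0, ‖a * u N x - b * u (N + 1) x‖ ^ 2 = ‖a‖ ^ 2 + ‖b‖ ^ 2 :=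
    fun a b => integral_norm_sq_sub (hdom N).memLp (hdom (N + 1)).memLp (by simpa using horth N N)
      (by simpa using horth (N + 1) (N + 1)) (by simpa using horth N (N + 1))
      (by simpa using horth (N + 1) N) a b
  -- any combination with zero initial data is trivial
  have triv : ∀ a b : ℂ, a * u N 0 = b * u (N + 1) 0 → a * D (u N) 0 = b * D (u (N + 1)) 0 →
      ‖a‖ ^ 2 + ‖b‖ ^ 2 ≤ 0 := fun a b h1 h2 => by
    have k1 := comb N (N + 1) a b h1 h2
    have k2 := bcomb N (N + 1) a b
    rw [hpyth] at k1
    have k3 := mul_le_mul_of_nonneg_left (hsmall N le_rfl).le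
      (by positivity : 0 ≤ 2 * ‖a‖ ^ 2)
    have k4 := mul_le_mul_of_nonneg_left (hsmall (N + 1) (by simp)).le
      (by positivity : 0 ≤ 2 * ‖b‖ ^ 2)
    have : c * (‖a‖ ^ 2 + ‖b‖ ^ 2) ≤ c * ((‖a‖ ^ 2 + ‖b‖ ^ 2) / 2) := by linarith
    have := le_of_mul_le_mul_left this hc
    linarith
  have h1 := triv (z (N + 1)) (z N) (by rw [hz1, hz1 (N + 1)]; ring)
    (by rw [hz2, hz2 (N + 1)]; ring)
  have hzN : z N = 0 := by
    rw [← norm_eq_zero]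
    nlinarith [sq_nonneg ‖z (N + 1)‖, sq_nonneg ‖z N‖]
  have h2 := triv 1 0 (by rw [hz1, hzN]; simp) (by rw [hz2, hzN]; simp)
  norm_num at h2

/-! ### Two independent Floquet solutions inside the spectrum -/

theorem exists_bound_of_norm_periodic {F : ℝ → ℂ} (hc : ContinuousOn F (Ici 0))
    (hp : ∀ x, 0 ≤ x → ‖F (x + 1)‖ = ‖F x‖) : ∃ A, ∀ x, 0 ≤ x → ‖F x‖ ≤ A := by
  obtain ⟨A, hA⟩ := isCompact_Icc.exists_bound_of_continuousOn
    (hc.mono (Icc_subset_Ici_self : Icc (0 : ℝ) 1 ⊆ Ici 0))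
  have key : ∀ (n : ℕ) (t : ℝ), 0 ≤ t → ‖F (t + n)‖ = ‖F t‖ := by
    intro n t ht
    induction n with
    | zero => simp
    | succ n ih => rw [← ih, ← hp (t + n) (by positivity)]; push_cast; ring_nf
  refine ⟨A, fun x hx => ?_⟩
  have h1 := key ⌊x⌋₊ (Int.fract x) (Int.fract_nonneg x)
  rw [natCast_floor_eq_intCast_floor hx, Int.fract_add_floor] at h1
  rw [h1]
  exact hA _ ⟨Int.fract_nonneg x, (Int.fract_lt_one x).le⟩

theorem wronskian_eq {X : ℝ} {q : ℝ → ℝ} {y y' z z' : ℝ → ℂ} (hy : IsPrimitive X y y')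
    (hy' : IsPrimitive X y' fun x => q x * y x) (hz : IsPrimitive X z z')
    (hz' : IsPrimitive X z' fun x => q x * z x) {x : ℝ} (hx : X ≤ x) :
    y x * z' x - z x * y' x = y X * z' X - z X * y' X :=
  ((hy.mul hz').sub (hz.mul hy')).eq_of_deriv_eq_zero
    (Eventually.of_forall fun t _ => by ring) hx

theorem IsPrimitive.re {X : ℝ} {F f : ℝ → ℂ} (hF : IsPrimitive X F f) :
    IsPrimitive X (fun x => ((F x).re : ℂ)) (fun x => ((f x).re : ℂ)) where
  ac b hb := (hF.ac b hb).lipschitz_comp (Complex.ofRealCLM.comp Complex.reCLM).lipschitz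
  hasDerivAt := by
    filter_upwards [hF.hasDerivAt] with x h1 hx using (h1 hx).re_comp.ofReal_comp

theorem IsPrimitive.im {X : ℝ} {F f : ℝ → ℂ} (hF : IsPrimitive X F f) :
    IsPrimitive X (fun x => ((F x).im : ℂ)) (fun x => ((f x).im : ℂ)) where
  ac b hb := (hF.ac b hb).lipschitz_comp (Complex.ofRealCLM.comp Complex.imCLM).lipschitz
  hasDerivAt := by
    filter_upwards [hF.hasDerivAt] with x h1 hx using (h1 hx).im_comp.ofReal_comp

theorem IsFloquetSolution.add_one {q : ℝ → ℝ} {E k : ℝ} {ψ : ℝ → ℂ}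
    (h : IsFloquetSolution q E k ψ) {x : ℝ} (hx : 0 ≤ x) :
    ψ (x + 1) = Complex.exp (Complex.I * k) * ψ x := by
  obtain ⟨-, -, p, hp, hψ⟩ := h
  rw [hψ x hx, hψ (x + 1) (by linarith), hp x]
  push_cast
  rw [mul_add, mul_one, Complex.exp_add]
  ring

theorem IsFloquetSolution.D_add_one {q : ℝ → ℝ} {E k : ℝ} {ψ : ℝ → ℂ}
    (h : IsFloquetSolution q E k ψ) {x : ℝ} (hx : 0 ≤ x) :
    D ψ (x + 1) = Complex.exp (Complex.I * k) * D ψ x := by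
  have h1 : HasDerivWithinAt ψ (D ψ x) (Ici 0) x :=
    (h.1.acLoc.diff x hx).hasDerivWithinAt
  have h2 : HasDerivWithinAt ψ (D ψ (x + 1)) (Ici 0) (x + 1) :=
    (h.1.acLoc.diff (x + 1) (by simp only [mem_Ici]; linarith)).hasDerivWithinAt
  have h3 : HasDerivWithinAt (fun t => ψ (t + 1)) (D ψ (x + 1)) (Ici 0) x := by
    have := HasDerivWithinAt.scomp x h2 ((hasDerivWithinAt_id x (Ici 0)).add_const 1)
      (fun t ht => by simp only [mem_Ici, id] at *; linarith)
    simp only [one_smul] at this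
    exact this
  have h4 : HasDerivWithinAt (fun t => ψ (t + 1)) (Complex.exp (Complex.I * k) * D ψ x)
      (Ici 0) x :=
    (h1.const_mul _).congr (fun t ht => h.add_one ht) (h.add_one hx)
  exact (uniqueDiffOn_Ici 0 x hx).eq_deriv _ h3 h4

/-- Solutions `Φ` and `conj Φ` with quasimomenta `k` and `-k` and nonzero Wronskian `w`. -/
structure IsFloquetBasis (q : ℝ → ℝ) (k : ℝ) (Φ Φ' : ℝ → ℂ) (w : ℂ) : Prop where
  prim : IsPrimitive 0 Φ Φ'
  prim' : IsPrimitive 0 Φ' fun x => q x * Φ x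
  add_one : ∀ x, 0 ≤ x → Φ (x + 1) = Complex.exp (Complex.I * k) * Φ x
  wronskian : ∀ x, 0 ≤ x → conj (Φ x) * Φ' x - conj (Φ' x) * Φ x = w
  ne_zero : w ≠ 0

theorem intervalIntegrable_potential {V₀ : ℝ → ℝ} (hV₀ : LocallyIntegrable V₀ volume) (E a b : ℝ) :
    IntervalIntegrable (fun x => V₀ x - E) volume a b :=
  ((hV₀.integrableOn_isCompact isCompact_uIcc).mono_set uIoc_subset_uIcc |>
    intervalIntegrable_iff.2).sub intervalIntegrable_const

theorem isPrimitive_conj_solution {X : ℝ} {q : ℝ → ℝ} {y y' : ℝ → ℂ}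
    (hy' : IsPrimitive X y' fun x => q x * y x) :
    IsPrimitive X (fun x => conj (y' x)) fun x => q x * conj (y x) :=
  hy'.conj.congr_right' fun x _ => by rw [map_mul, Complex.conj_ofReal]

/-- If `ψ` and `conj ψ` were proportional, their multipliers `e^{ik}` and `e^{-ik}` would agree. -/
theorem isFloquetBasis_of_exp_ne_one {V₀ : ℝ → ℝ} (hV₀ : LocallyIntegrable V₀ volume) {E k : ℝ}
    {ψ : ℝ → ℂ} (h : IsFloquetSolution V₀ E k ψ)
    (hk : Complex.exp (Complex.I * k) ^ 2 ≠ 1) :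
    ∃ w, IsFloquetBasis (fun x => V₀ x - E) k ψ (D ψ) w := by
  have p := h.1.acLoc.isPrimitive
  have p' := h.1.isPrimitive_deriv
  have pc' := isPrimitive_conj_solution p'
  have hW : ∀ x, 0 ≤ x → conj (ψ x) * D ψ x - conj (D ψ x) * ψ x
      = conj (ψ 0) * D ψ 0 - conj (D ψ 0) * ψ 0 := fun x hx => by
    have := wronskian_eq p.conj pc' p p' hx
    linear_combination this
  refine ⟨_, p, p', fun x hx => h.add_one hx, hW, fun hw => hk ?_⟩
  obtain ⟨x₀, hx₀, hne⟩ := h.2.1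
  have hw0 := hW x₀ hx₀
  rw [hw] at hw0
  set c := conj (ψ x₀) / ψ x₀ with hc
  have q1 := (p.conj.sub (p.const_mul c)).mono hx₀
  have q2 : IsPrimitive x₀ (fun x => conj (D ψ x) - c * D ψ x)
      fun x => ((V₀ x - E : ℝ) : ℂ) * (conj (ψ x) - c * ψ x) :=
    ((pc'.sub (p'.const_mul c)).mono hx₀).congr_right' fun x _ => by ring
  have hz := (eq_zero_of_initial_eq_zero (fun b _ => intervalIntegrable_potential hV₀ E x₀ b) q1 q2
    (by rw [hc]; field_simp; ring) (by rw [hc]; field_simp; linear_combination -hw0)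
    (b := x₀ + 1) (by linarith)).1
  rw [h.add_one hx₀, map_mul, ← Complex.exp_conj, map_mul, Complex.conj_I, Complex.conj_ofReal,
    hc] at hz
  have hcne : conj (ψ x₀) ≠ 0 := by simpa using hne
  have e1 : Complex.exp (-Complex.I * k) * Complex.exp (Complex.I * k) = 1 := by
    rw [← Complex.exp_add]; simp
  have e2 : Complex.exp (-Complex.I * k) = Complex.exp (Complex.I * k) := by
    field_simp at hz
    have : conj (ψ x₀) * (Complex.exp (-Complex.I * k) - Complex.exp (Complex.I * k)) = 0 := by
      rw [neg_mul]
      linear_combination hz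
    exact sub_eq_zero.1 ((mul_eq_zero.1 this).resolve_left hcne)
  rw [e2] at e1
  rw [sq, e1]

/-- A nontrivial real solution of the periodic equation that is multiplied by `s = ±1` over a
period. -/
structure IsRealFloquet (q : ℝ → ℝ) (s : ℝ) (r r' : ℝ → ℝ) : Prop where
  prim : IsPrimitive 0 (fun x => (r x : ℂ)) (fun x => (r' x : ℂ))
  prim' : IsPrimitive 0 (fun x => (r' x : ℂ)) (fun x => q x * r x)
  add_one : ∀ x, 0 ≤ x → r (x + 1) = s * r x
  add_one' : ∀ x, 0 ≤ x → r' (x + 1) = s * r' x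
  nontrivial : ∃ x, 0 ≤ x ∧ r x ≠ 0

theorem exists_isRealFloquet {V₀ : ℝ → ℝ} {E k s : ℝ} {ψ : ℝ → ℂ} (h : IsFloquetSolution V₀ E k ψ)
    (hs : Complex.exp (Complex.I * k) = s) :
    ∃ r r', IsRealFloquet (fun x => V₀ x - E) s r r' := by
  have p := h.1.acLoc.isPrimitive
  have p' := h.1.isPrimitive_deriv
  obtain ⟨x, hx, hne⟩ := h.2.1
  have hadd : ∀ x, 0 ≤ x → ψ (x + 1) = s * ψ x := fun x hx => hs ▸ h.add_one hx
  have hadd' : ∀ x, 0 ≤ x → D ψ (x + 1) = s * D ψ x := fun x hx => hs ▸ h.D_add_one hx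
  by_cases hre : (ψ x).re = 0
  · refine ⟨fun x => (ψ x).im, fun x => (D ψ x).im, p.im, p'.im.congr_right' fun t _ => ?_,
      fun t ht => ?_, fun t ht => ?_, x, hx, fun him => hne (Complex.ext hre him)⟩
    · rw [Complex.im_ofReal_mul, Complex.ofReal_mul]
    · rw [hadd t ht, Complex.im_ofReal_mul]
    · rw [hadd' t ht, Complex.im_ofReal_mul]
  · refine ⟨fun x => (ψ x).re, fun x => (D ψ x).re, p.re, p'.re.congr_right' fun t _ => ?_,
      fun t ht => ?_, fun t ht => ?_, x, hx, hre⟩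
    · rw [Complex.re_ofReal_mul, Complex.ofReal_mul]
    · rw [hadd t ht, Complex.re_ofReal_mul]
    · rw [hadd' t ht, Complex.re_ofReal_mul]

theorem IsPrimitive.continuousOn_real {X : ℝ} {r : ℝ → ℝ} {f : ℝ → ℂ}
    (h : IsPrimitive X (fun x => (r x : ℂ)) f) : ContinuousOn r (Ici X) := by
  simpa [Function.comp_def] using Complex.continuous_re.comp_continuousOn h.continuousOn

namespace IsRealFloquet

variable {q r r' : ℝ → ℝ} {s : ℝ}

theorem sq_add_sq_add_one (R : IsRealFloquet q s r r') (hs : s ^ 2 = 1) {x : ℝ} (hx : 0 ≤ x) :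
    r (x + 1) ^ 2 + r' (x + 1) ^ 2 = r x ^ 2 + r' x ^ 2 := by
  rw [R.add_one x hx, R.add_one' x hx]
  linear_combination (r x ^ 2 + r' x ^ 2) * hs

theorem sq_add_sq_pos (R : IsRealFloquet q s r r') (hs : s ^ 2 = 1)
    (hq : ∀ a b, IntervalIntegrable q volume a b) {x : ℝ} (hx : 0 ≤ x) :
    0 < r x ^ 2 + r' x ^ 2 := by
  by_contra hcon
  have h1 : r x = 0 := by nlinarith [sq_nonneg (r x), sq_nonneg (r' x)]
  have h2 : r' x = 0 := by nlinarith [sq_nonneg (r x), sq_nonneg (r' x)]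
  obtain ⟨x₀, hx₀, hne⟩ := R.nontrivial
  have hn : ∀ n : ℕ, r (x₀ + n) ≠ 0 := by
    intro n
    induction n with
    | zero => simpa using hne
    | succ n ih =>
      have : s ≠ 0 := fun h => by simp [h] at hs
      push_cast
      rw [← add_assoc, R.add_one _ (by positivity)]
      exact mul_ne_zero this ih
  obtain ⟨n, hn'⟩ := exists_nat_ge x
  have := (eq_zero_of_initial_eq_zero (fun b _ => hq x b) (R.prim.mono hx) (R.prim'.mono hx)
    (by simp [h1]) (by simp [h2]) (b := x₀ + n) (by linarith)).1
  exact hn n (by exact_mod_cast this)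

/-- Reduction of order. Division by `r² + r'²` instead of `r²` keeps the second solution regular at
the zeros of `r`; over a period it gains the multiple `κ` of `r`. -/
theorem exists_second_solution (R : IsRealFloquet q s r r') (hs : s ^ 2 = 1)
    (hq : ∀ a b, IntervalIntegrable q volume a b) (hper : Function.Periodic q 1) :
    ∃ (z z' : ℝ → ℝ) (κ : ℝ), IsPrimitive 0 (fun x => (z x : ℂ)) (fun x => (z' x : ℂ)) ∧
      IsPrimitive 0 (fun x => (z' x : ℂ)) (fun x => q x * z x) ∧
      (∀ x, 0 ≤ x → r x * z' x - r' x * z x = 1) ∧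
      (∀ x, 0 ≤ x → z (x + 1) = s * (z x + κ * r x)) ∧
      ∀ x, 0 ≤ x → z' (x + 1) = s * (z' x + κ * r' x) := by
  have hpos : ∀ x, 0 ≤ x → 0 < r x ^ 2 + r' x ^ 2 := fun x hx => R.sq_add_sq_pos hs hq hx
  have hrc := R.prim.continuousOn_real
  have hrc' := R.prim'.continuousOn_real
  have hρc : ContinuousOn (fun x => r x ^ 2 + r' x ^ 2) (Ici 0) := (hrc.pow 2).add (hrc'.pow 2)
  set f : ℝ → ℝ := fun x => (1 + q x) * ((r x ^ 2 - r' x ^ 2) / (r x ^ 2 + r' x ^ 2) ^ 2) with hf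
  have hfi : ∀ b, 0 ≤ b → IntervalIntegrable f volume 0 b := fun b hb => by
    refine (intervalIntegrable_const.add (hq 0 b)).mul_continuousOn ?_
    rw [uIcc_of_le hb]
    exact (((hrc.pow 2).sub (hrc'.pow 2)).div (hρc.pow 2) fun x hx =>
      (pow_pos (hpos x hx) 2).ne').mono Icc_subset_Ici_self
  set S : ℝ → ℝ := fun x => ∫ t in (0 : ℝ)..x, f t with hS
  have pS : IsPrimitive 0 (fun x => (S x : ℂ)) (fun x => (f x : ℂ)) := IsPrimitive.of_integral hfi
  have hfper : ∀ x, 0 ≤ x → f (x + 1) = f x := fun x hx => by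
    have e2 : r (x + 1) ^ 2 - r' (x + 1) ^ 2 = r x ^ 2 - r' x ^ 2 := by
      rw [R.add_one x hx, R.add_one' x hx]
      linear_combination (r x ^ 2 - r' x ^ 2) * hs
    simp only [hf]
    rw [R.sq_add_sq_add_one hs hx, e2, hper x]
  have hSper : ∀ x, 0 ≤ x → S (x + 1) = S x + S 1 := fun x hx => by
    have h1 : IntervalIntegrable f volume 1 (x + 1) :=
      (hfi 1 zero_le_one).symm.trans (hfi (x + 1) (by linarith))
    have h2 : ∫ t in (1 : ℝ)..(x + 1), f t = ∫ t in (0 : ℝ)..x, f t := by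
      have := intervalIntegral.integral_comp_add_right (a := 0) (b := x) f 1
      rw [zero_add] at this
      rw [← this]
      refine intervalIntegral.integral_congr fun t ht => ?_
      rw [uIcc_of_le hx] at ht
      exact hfper t ht.1
    simp only [hS]
    rw [← intervalIntegral.integral_add_adjacent_intervals (hfi 1 zero_le_one) h1, h2, add_comm]
  -- a positive lower bound of `r² + r'²`
  obtain ⟨A, hA⟩ := exists_bound_of_norm_periodic
    (F := fun x => (((r x ^ 2 + r' x ^ 2)⁻¹ : ℝ) : ℂ))
    (Complex.continuous_ofReal.comp_continuousOn (hρc.inv₀ fun x hx => (hpos x hx).ne'))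
    fun x hx => by rw [R.sq_add_sq_add_one hs hx]
  have hA0 : 0 < A := by
    refine lt_of_lt_of_le ?_ (hA 0 le_rfl)
    have := hpos 0 le_rfl
    rw [norm_pos_iff]
    exact_mod_cast (inv_pos.2 this).ne'
  have hlow : ∀ x, 0 ≤ x → A⁻¹ ≤ ‖((r x : ℂ) * r x + (r' x : ℂ) * r' x)‖ := fun x hx => by
    have h1 := hA x hx
    have h2 := hpos x hx
    rw [Complex.norm_real, Real.norm_eq_abs, abs_of_pos (inv_pos.2 h2)] at h1
    have e : ((r x : ℂ) * r x + (r' x : ℂ) * r' x) = ((r x ^ 2 + r' x ^ 2 : ℝ) : ℂ) := by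
      push_cast; ring
    rw [e, Complex.norm_real, Real.norm_eq_abs, abs_of_pos h2]
    exact inv_le_of_inv_le₀ h2 h1
  have pinv := ((R.prim.mul R.prim).add (R.prim'.mul R.prim')).inv (inv_pos.2 hA0) hlow
  have hne : ∀ x, 0 ≤ x → ((r x : ℂ) * r x + (r' x : ℂ) * r' x) ≠ 0 := fun x hx =>
    norm_pos_iff.1 ((inv_pos.2 hA0).trans_le (hlow x hx))
  refine ⟨fun x => S x * r x - r' x * (r x * r x + r' x * r' x)⁻¹,
    fun x => S x * r' x + r x * (r x * r x + r' x * r' x)⁻¹, S 1, ?_, ?_, fun x hx => ?_,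
    fun x hx => ?_, fun x hx => ?_⟩
  · refine (((pS.mul R.prim).sub (R.prim'.mul pinv)).congr_left fun x _ => by push_cast; rfl)
      |>.congr_right' fun x hx => ?_
    have := hne x hx.le
    simp only [hf]
    push_cast
    rw [← sq, ← sq] at *
    field_simp
    ring
  · refine (((pS.mul R.prim').add (R.prim.mul pinv)).congr_left fun x _ => by push_cast; rfl)
      |>.congr_right' fun x hx => ?_
    have := hne x hx.le
    simp only [hf]
    push_cast
    rw [← sq, ← sq] at *
    field_simp
    ring
  · have := (hpos x hx).ne'
    simp only [← sq]
    field_simp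
    ring
  · have e := R.sq_add_sq_add_one hs hx
    simp only [← sq]
    rw [e, hSper x hx, R.add_one x hx, R.add_one' x hx]
    ring
  · have e := R.sq_add_sq_add_one hs hx
    simp only [← sq]
    rw [e, hSper x hx, R.add_one x hx, R.add_one' x hx]
    ring

end IsRealFloquet

/-- In the interior of the essential spectrum there are two independent Floquet solutions. When
`e^{2ik} = 1` this says that the monodromy matrix is `±1`; otherwise it would be a Jordan block, and
energies on one side of `E` would not belong to the essential spectrum. -/
theorem exists_isFloquetBasis {V₀ : ℝ → ℝ} (hper : Function.Periodic V₀ 1)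
    (hV₀ : LocallyIntegrable V₀ volume) {θ E k : ℝ} (hE : E ∈ interior (essSpectrum θ V₀))
    (hk : ∃ ψ, IsFloquetSolution V₀ E k ψ) :
    ∃ Φ Φ' w, IsFloquetBasis (fun x => V₀ x - E) k Φ Φ' w := by
  obtain ⟨ψ, hψ⟩ := hk
  by_cases hk2 : Complex.exp (Complex.I * k) ^ 2 = 1
  swap
  · obtain ⟨w, hw⟩ := isFloquetBasis_of_exp_ne_one hV₀ hψ hk2
    exact ⟨_, _, w, hw⟩
  obtain ⟨s, hs, hs2⟩ : ∃ s : ℝ, Complex.exp (Complex.I * k) = s ∧ s ^ 2 = 1 := by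
    rcases mul_self_eq_one_iff.1 ((sq _).symm.trans hk2) with h | h
    · exact ⟨1, by simpa using h, by norm_num⟩
    · exact ⟨-1, by simpa using h, by norm_num⟩
  obtain ⟨r, r', R⟩ := exists_isRealFloquet hψ hs
  have hsabs : |s| = 1 := by
    nlinarith [sq_abs s, abs_nonneg s]
  obtain ⟨z, z', κ, pz, pz', hW, hz, hz'⟩ := R.exists_second_solution hs2
    (intervalIntegrable_potential hV₀ E) (fun x => by simp only [hper x])
  rcases eq_or_ne κ 0 with rfl | hκ
  · refine ⟨fun x => r x + Complex.I * z x, fun x => r' x + Complex.I * z' x, 2 * Complex.I,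
      R.prim.add (pz.const_mul _), (R.prim'.add (pz'.const_mul _)).congr_right' fun x _ => by ring,
      fun x hx => ?_, fun x hx => ?_, by simp⟩
    · rw [hs, R.add_one x hx, hz x hx]; push_cast; ring
    · have : ((r x * z' x - r' x * z x : ℝ) : ℂ) = 1 := by rw [hW x hx]; simp
      push_cast at this
      simp only [map_add, map_mul, Complex.conj_I, Complex.conj_ofReal]
      linear_combination 2 * Complex.I * this
  · exfalso
    have pid : IsPrimitive 0 (fun x : ℝ => (x : ℂ)) (fun _ => 1) :=
      .of_hasDerivAt continuousOn_const fun x _ => (hasDerivAt_id x).ofReal_comp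
    have pχ : IsPrimitive 0 (fun x => ((z x - κ * (x * r x) : ℝ) : ℂ))
        (fun x => ((z' x - κ * (x * r' x) : ℝ) : ℂ) - κ * r x) :=
      ((pz.sub ((pid.mul R.prim).const_mul κ)).congr_left fun x _ => by push_cast; rfl)
        |>.congr_right' fun x _ => by push_cast; ring
    have pχ₁ : IsPrimitive 0 (fun x => ((z' x - κ * (x * r' x) : ℝ) : ℂ))
        (fun x => ((V₀ x - E : ℝ) : ℂ) * ((z x - κ * (x * r x) : ℝ) : ℂ) - κ * r' x) :=
      ((pz'.sub ((pid.mul R.prim').const_mul κ)).congr_left fun x _ => by push_cast; rfl)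
        |>.congr_right' fun x _ => by push_cast; ring
    have bound : ∀ {y : ℝ → ℝ} {f : ℝ → ℂ}, IsPrimitive 0 (fun x => (y x : ℂ)) f →
        (∀ x, 0 ≤ x → y (x + 1) = s * y x) → ∃ A, ∀ x, 0 ≤ x → |y x| ≤ A := fun {y f} hy h => by
      obtain ⟨A, hA⟩ := exists_bound_of_norm_periodic hy.continuousOn fun x hx => by
        rw [Complex.norm_real, Complex.norm_real, h x hx, norm_mul, Real.norm_eq_abs s, hsabs,
          one_mul]
      exact ⟨A, fun x hx => by simpa using hA x hx⟩
    obtain ⟨A₁, h₁⟩ := bound R.prim R.add_one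
    obtain ⟨A₂, h₂⟩ := bound R.prim' R.add_one'
    obtain ⟨A₃, h₃⟩ := bound pχ fun x hx => by rw [hz x hx, R.add_one x hx]; ring
    obtain ⟨A₄, h₄⟩ := bound pχ₁ fun x hx => by rw [hz' x hx, R.add_one' x hx]; ring
    set A := max (max A₁ A₂) (max A₃ A₄) with hA
    have S : IsEdgeSystem (fun x => V₀ x - E) r r' _ _ κ A :=
      ⟨R.prim, R.prim', pχ, pχ₁, fun x hx => by rw [← hW x hx]; ring,
        fun x hx => (h₁ x hx).trans (by simp [hA]), fun x hx => (h₂ x hx).trans (by simp [hA]),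
        fun x hx => (h₃ x hx).trans (by simp [hA]), fun x hx => (h₄ x hx).trans (by simp [hA])⟩
    have hlim : Tendsto (fun t : ℝ => E + -(κ * t)) (𝓝[>] 0) (𝓝 E) := by
      have : Continuous fun t : ℝ => E + -(κ * t) := by fun_prop
      exact (this.tendsto' 0 E (by simp)).mono_left nhdsWithin_le_nhds
    have hlim2 : Tendsto (fun t : ℝ => κ ^ 2 * t * A ^ 2) (𝓝[>] 0) (𝓝 0) := by
      have : Continuous fun t : ℝ => κ ^ 2 * t * A ^ 2 := by fun_prop
      exact (this.tendsto' 0 0 (by simp)).mono_left nhdsWithin_le_nhds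
    have hκ2 : 0 < κ ^ 2 := by positivity
    -- a small `ε = -κ t` with `κ ε < 0` for which `E + ε` is still in the interior
    obtain ⟨t, ht1, ht2, ht3⟩ := ((hlim.eventually (isOpen_interior.mem_nhds hE)).and
      ((hlim2.eventually (ge_mem_nhds (by positivity : 0 < κ ^ 2 / 2))).and
        self_mem_nhdsWithin)).exists
    have ht : 0 < t := ht3
    refine S.notMem_essSpectrum (ε := -(κ * t)) (by nlinarith) ?_ θ (interior_subset ht1)
    have : κ * -(κ * t) = -(κ ^ 2 * t) := by ring
    rwa [this, abs_neg, abs_of_pos (by positivity)]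

/-! ### Smoothing of functions of bounded variation -/

/-- The variation of `γ` on `(0, x]`. -/
def variationUpTo (γ : ℝ → ℂ) (x : ℝ) : ℝ := (eVariationOn γ (Ioc 0 x)).toReal

section variationUpTo

variable {γ : ℝ → ℂ} {K : ℝ}

theorem eVariationOn_Ioc_ne_top (hK : eVariationOn γ (Ioi 0) ≤ ENNReal.ofReal K) (x : ℝ) :
    eVariationOn γ (Ioc 0 x) ≠ ⊤ :=
  ((eVariationOn.mono γ Ioc_subset_Ioi_self).trans hK).trans_lt ENNReal.ofReal_lt_top |>.ne

theorem variationUpTo_nonneg (x : ℝ) : 0 ≤ variationUpTo γ x := ENNReal.toReal_nonneg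

theorem variationUpTo_le (hK0 : 0 ≤ K) (hK : eVariationOn γ (Ioi 0) ≤ ENNReal.ofReal K) (x : ℝ) :
    variationUpTo γ x ≤ K :=
  ENNReal.toReal_le_of_le_ofReal hK0 ((eVariationOn.mono γ Ioc_subset_Ioi_self).trans hK)

theorem monotone_variationUpTo (hK : eVariationOn γ (Ioi 0) ≤ ENNReal.ofReal K) :
    Monotone (variationUpTo γ) := fun _ y h =>
  ENNReal.toReal_mono (eVariationOn_Ioc_ne_top hK y) (eVariationOn.mono γ (Ioc_subset_Ioc_right h))

theorem norm_sub_le_variationUpTo (hK : eVariationOn γ (Ioi 0) ≤ ENNReal.ofReal K) {x y : ℝ}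
    (hx : 0 < x) (hxy : x ≤ y) : ‖γ y - γ x‖ ≤ variationUpTo γ y - variationUpTo γ x := by
  have h1 := eVariationOn.add_le_union γ (s := Ioc 0 x) (t := Icc x y)
    fun a ha b hb => ha.2.trans hb.1
  rw [Ioc_union_Icc_eq_Ioc hx hxy] at h1
  have h2 : edist (γ y) (γ x) ≤ eVariationOn γ (Icc x y) :=
    eVariationOn.edist_le γ (right_mem_Icc.2 hxy) (left_mem_Icc.2 hxy)
  have h3 : eVariationOn γ (Ioc 0 x) + edist (γ y) (γ x) ≤ eVariationOn γ (Ioc 0 y) :=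
    (add_le_add_right h2 _).trans h1
  have h4 := ENNReal.toReal_mono (eVariationOn_Ioc_ne_top hK y) h3
  rw [ENNReal.toReal_add (eVariationOn_Ioc_ne_top hK x) (edist_ne_top _ _), ← dist_edist,
    dist_eq_norm] at h4
  simp only [variationUpTo]
  linarith

theorem integral_variationUpTo_sub_le (hK0 : 0 ≤ K)
    (hK : eVariationOn γ (Ioi 0) ≤ ENNReal.ofReal K) :
    ∫⁻ x in Ioi (0 : ℝ), ENNReal.ofReal (variationUpTo γ (x + 2) - variationUpTo γ x)
      ≤ ENNReal.ofReal (2 * K) := by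
  set v := variationUpTo γ
  have hv : Monotone v := monotone_variationUpTo hK
  have hvi : ∀ a b, IntervalIntegrable v volume a b := fun a b => hv.intervalIntegrable
  have hvi2 : ∀ a b, IntervalIntegrable (fun x => v (x + 2)) volume a b := fun a b =>
    (hv.comp (monotone_id.add_const 2)).intervalIntegrable
  have hd0 : ∀ x, 0 ≤ v (x + 2) - v x := fun x => sub_nonneg.2 (hv (by linarith))
  have hN : ∀ N : ℝ, ∫ x in (0 : ℝ)..N, (v (x + 2) - v x) ≤ 2 * K := fun N => by
    rw [intervalIntegral.integral_sub (hvi2 _ _) (hvi _ _),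
      intervalIntegral.integral_comp_add_right v 2, zero_add]
    have e1 := intervalIntegral.integral_add_adjacent_intervals (hvi 0 2) (hvi 2 (N + 2))
    have e2 := intervalIntegral.integral_add_adjacent_intervals (hvi 0 N) (hvi N (N + 2))
    have e3 : 0 ≤ ∫ x in (0 : ℝ)..2, v x :=
      intervalIntegral.integral_nonneg (by norm_num) fun x _ => variationUpTo_nonneg x
    have e4 : ∫ x in N..(N + 2), v x ≤ ∫ x in N..(N + 2), K :=
      intervalIntegral.integral_mono_on (by linarith) (hvi _ _) intervalIntegrable_const
        fun x _ => variationUpTo_le hK0 hK x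
    rw [intervalIntegral.integral_const, smul_eq_mul, add_sub_cancel_left] at e4
    linarith
  have hint : IntegrableOn (fun x => v (x + 2) - v x) (Ioi 0) :=
    integrableOn_Ioi_of_intervalIntegral_norm_bounded (2 * K) 0
      (fun N : ℝ => ((hvi2 0 N).sub (hvi 0 N)).1) tendsto_id
      (Eventually.of_forall fun N => by
        simp only [Real.norm_eq_abs, abs_of_nonneg (hd0 _)]
        exact hN N)
  rw [← ofReal_integral_eq_lintegral_ofReal hint (Eventually.of_forall hd0)]
  exact ENNReal.ofReal_le_ofReal
    (le_of_tendsto' (intervalIntegral_tendsto_integral_Ioi 0 hint tendsto_id) hN)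

/-- Both `v - Re γ` and `v - Im γ` are monotone, where `v` is the variation up to a point. -/
theorem aestronglyMeasurable_of_eVariationOn (hK : eVariationOn γ (Ioi 0) ≤ ENNReal.ofReal K) :
    AEStronglyMeasurable γ (volume.restrict (Ioi 0)) := by
  have hv := monotone_variationUpTo hK
  have key : ∀ r : ℂ → ℝ, (∀ z w, |r z - r w| ≤ ‖z - w‖) →
      AEMeasurable (fun x => r (γ x)) (volume.restrict (Ioi 0)) := fun r hr => by
    have hm : MonotoneOn (fun x => variationUpTo γ x - r (γ x)) (Ioi 0) := fun x hx y _ hxy => by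
      have h1 := norm_sub_le_variationUpTo hK hx hxy
      have h2 := (abs_le.1 ((hr (γ y) (γ x)).trans h1)).2
      simp only
      linarith
    have h1 := aemeasurable_restrict_of_monotoneOn (μ := volume) measurableSet_Ioi hm
    refine (hv.measurable.aemeasurable.sub h1).congr (Eventually.of_forall fun x => ?_)
    simp
  have hre := key Complex.re fun z w => by
    rw [← Complex.sub_re]; exact Complex.abs_re_le_norm _
  have him := key Complex.im fun z w => by
    rw [← Complex.sub_im]; exact Complex.abs_im_le_norm _
  refine AEMeasurable.aestronglyMeasurable ?_
  have h2 : AEMeasurable (fun x => ((γ x).re : ℂ) + ((γ x).im : ℂ) * Complex.I)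
      (volume.restrict (Ioi 0)) :=
    (Complex.measurable_ofReal.comp_aemeasurable hre).add
      ((Complex.measurable_ofReal.comp_aemeasurable him).mul_const _)
  simpa only [Complex.re_add_im] using h2

/-- A function of bounded variation with an integrable power vanishes at infinity, hence is bounded
by its remaining variation. -/
theorem norm_le_sub_variationUpTo (hK : eVariationOn γ (Ioi 0) ≤ ENNReal.ofReal K) {p : ℕ}
    (hL : ∫⁻ x in Ioi (0 : ℝ), ‖γ x‖ₑ ^ p ≠ ⊤) {M : ℝ} (hM : ∀ x, variationUpTo γ x ≤ M) {x : ℝ}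
    (hx : 0 < x) : ‖γ x‖ ≤ M - variationUpTo γ x := by
  by_contra! hcon
  set δ := ‖γ x‖ - (M - variationUpTo γ x) with hδ
  have hδ0 : 0 < δ := sub_pos.2 hcon
  have hlow : ∀ y, x < y → δ ≤ ‖γ y‖ := fun y hy => by
    have h1 := norm_sub_le_variationUpTo hK hx hy.le
    have h2 := norm_sub_norm_le (γ x) (γ y)
    rw [norm_sub_rev] at h2
    have := hM y
    linarith
  refine hL (top_unique ?_)
  calc ⊤ = ∫⁻ y in Ioi x, ENNReal.ofReal δ ^ p := by
        rw [setLIntegral_const, Real.volume_Ioi, ENNReal.mul_top]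
        exact pow_ne_zero _ (ENNReal.ofReal_pos.2 hδ0).ne'
    _ ≤ ∫⁻ y in Ioi x, ‖γ y‖ₑ ^ p := by
        refine setLIntegral_mono' measurableSet_Ioi fun y hy => ?_
        rw [← ofReal_norm]
        gcongr
        exact hlow y hy
    _ ≤ _ := lintegral_mono_set (Ioi_subset_Ioi hx.le)

/-- Averaging twice over unit intervals replaces `γ` by a continuously differentiable function; the
error and the derivative are bounded by the variation of `γ` over `(x, x + 2]`, which is an
integrable function of `x`. -/
theorem exists_smoothing (hK0 : 0 ≤ K) (hK : eVariationOn γ (Ioi 0) ≤ ENNReal.ofReal K) {p : ℕ}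
    (hp : 1 ≤ p) {L : ℝ≥0∞} (hL : ∫⁻ x in Ioi (0 : ℝ), ‖γ x‖ₑ ^ p ≤ L) (hLt : L ≠ ⊤) :
    ∃ (g g' : ℝ → ℂ) (d : ℝ → ℝ≥0∞), Continuous g' ∧ (∀ x, HasDerivAt g (g' x) x) ∧ Measurable d ∧
      (∀ x, 0 < x → ‖g x‖ ≤ 2 * K ∧ ‖g' x‖ₑ ≤ d x ∧ ‖γ x - g x‖ₑ ≤ d x ∧
        d x ≤ ENNReal.ofReal K) ∧
      ∫⁻ x in Ioi (0 : ℝ), d x ≤ ENNReal.ofReal (2 * K) ∧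
      ∫⁻ x in Ioi (0 : ℝ), ‖g x‖ₑ ^ p ≤
        2 ^ p * (L + ENNReal.ofReal K ^ (p - 1) * ENNReal.ofReal (2 * K)) ∧
      Tendsto g atTop (𝓝 0) := by
  have hLf : ∫⁻ x in Ioi (0 : ℝ), ‖γ x‖ₑ ^ p ≠ ⊤ := (hL.trans_lt hLt.lt_top).ne
  set v := variationUpTo γ with hvdef
  have hv : Monotone v := monotone_variationUpTo hK
  have hvK : ∀ x, v x ≤ K := variationUpTo_le hK0 hK
  have hv0 : ∀ x, 0 ≤ v x := variationUpTo_nonneg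
  have hγv : ∀ {x y : ℝ}, 0 < x → x ≤ y → ‖γ y - γ x‖ ≤ v y - v x :=
    fun hx hxy => norm_sub_le_variationUpTo hK hx hxy
  have hbdd : BddAbove (range v) := ⟨K, by rintro _ ⟨x, rfl⟩; exact hvK x⟩
  set M := ⨆ x, v x with hM
  have hvM : ∀ x, v x ≤ M := le_ciSup hbdd
  have hlimv : Tendsto v atTop (𝓝 M) := tendsto_atTop_ciSup hv hbdd
  have hMK : M ≤ K := ciSup_le hvK
  have hγM : ∀ {x : ℝ}, 0 < x → ‖γ x‖ ≤ M - v x := fun hx => norm_le_sub_variationUpTo hK hLf hvM hx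
  -- the extension by zero is locally integrable
  set η : ℝ → ℂ := (Ioi 0).indicator γ with hη
  have hηi : ∀ a b, IntervalIntegrable η volume a b := fun a b => by
    refine (intervalIntegrable_const (c := K)).mono_fun
      (AEStronglyMeasurable.restrict ?_) (Eventually.of_forall fun x => ?_)
    · exact (aestronglyMeasurable_indicator_iff measurableSet_Ioi).2
        (aestronglyMeasurable_of_eVariationOn hK)
    · rw [Real.norm_eq_abs, abs_of_nonneg hK0, hη]
      beta_reduce
      by_cases hx : x ∈ Ioi (0 : ℝ)
      · rw [indicator_of_mem hx]
        exact (hγM hx).trans (by linarith [hv0 x])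
      · rw [indicator_of_notMem hx, norm_zero]
        exact hK0
  have hηγ : ∀ {x : ℝ}, 0 < x → η x = γ x := fun hx => indicator_of_mem (mem_Ioi.2 hx) _
  set m : ℝ → ℂ := fun x => ∫ t in x..(x + 1), η t with hm
  have hmc : Continuous m := by
    have h1 := intervalIntegral.continuous_primitive hηi 0
    have h2 : m = fun x => (∫ t in (0 : ℝ)..(x + 1), η t) - ∫ t in (0 : ℝ)..x, η t := by
      ext x
      rw [intervalIntegral.integral_interval_sub_left (hηi _ _) (hηi _ _)]
    rw [h2]
    exact (h1.comp (continuous_id.add continuous_const)).sub h1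
  set g : ℝ → ℂ := fun x => ∫ t in x..(x + 1), m t with hg
  have hgd : ∀ x, HasDerivAt g (m (x + 1) - m x) x := fun x => by
    have h1 : ∀ y, HasDerivAt (fun y => ∫ t in (0 : ℝ)..y, m t) (m y) y := fun y =>
      (hmc.integral_hasStrictDerivAt 0 y).hasDerivAt
    have h2 : g = fun x => (∫ t in (0 : ℝ)..(x + 1), m t) - ∫ t in (0 : ℝ)..x, m t := by
      ext x
      rw [intervalIntegral.integral_interval_sub_left (hmc.intervalIntegrable _ _)
        (hmc.intervalIntegrable _ _)]
    rw [h2]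
    exact ((h1 (x + 1)).comp_add_const x 1).sub (h1 x)
  have hd0 : ∀ x, 0 ≤ v (x + 2) - v x := fun x => sub_nonneg.2 (hv (by linarith))
  have hg' : ∀ x, 0 < x → ‖m (x + 1) - m x‖ ≤ v (x + 2) - v x := fun x hx => by
    have h1 : m (x + 1) - m x = ∫ t in x..(x + 1), (η (t + 1) - η t) := by
      rw [intervalIntegral.integral_sub _ (hηi _ _), intervalIntegral.integral_comp_add_right η 1]
      have := (hηi (x + 1) (x + 1 + 1)).comp_add_right 1
      simpa using this
    rw [h1]
    refine (intervalIntegral.norm_integral_le_of_norm_le_const fun t ht => ?_).trans_eq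
      (by rw [add_sub_cancel_left, abs_one, mul_one])
    rw [uIoc_of_le (by linarith)] at ht
    have ht0 : 0 < t := hx.trans ht.1
    rw [hηγ ht0, hηγ (by linarith)]
    have h2 := hγv ht0 (by linarith : t ≤ t + 1)
    have h3 := hv ht.1.le
    have h4 := hv (by linarith [ht.2] : t + 1 ≤ x + 2)
    linarith
  have hmγ : ∀ x, 0 < x → ∀ t ∈ Icc x (x + 1), ‖m t - γ x‖ ≤ v (x + 2) - v x := by
    intro x hx t ht
    have h1 : m t - γ x = ∫ s in t..(t + 1), (η s - γ x) := by
      rw [intervalIntegral.integral_sub (hηi _ _) intervalIntegrable_const,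
        intervalIntegral.integral_const, add_sub_cancel_left, one_smul]
    rw [h1]
    refine (intervalIntegral.norm_integral_le_of_norm_le_const fun s hs => ?_).trans_eq
      (by rw [add_sub_cancel_left, abs_one, mul_one])
    rw [uIoc_of_le (by linarith)] at hs
    rw [hηγ (by linarith [hs.1, ht.1])]
    have h2 := hγv hx (by linarith [hs.1, ht.1] : x ≤ s)
    have h3 := hv (by linarith [hs.2, ht.2] : s ≤ x + 2)
    linarith
  have hgγ : ∀ x, 0 < x → ‖g x - γ x‖ ≤ v (x + 2) - v x := fun x hx => by
    have h1 : g x - γ x = ∫ t in x..(x + 1), (m t - γ x) := by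
      rw [intervalIntegral.integral_sub (hmc.intervalIntegrable _ _) intervalIntegrable_const,
        intervalIntegral.integral_const, add_sub_cancel_left, one_smul]
    rw [h1]
    refine (intervalIntegral.norm_integral_le_of_norm_le_const fun t ht => ?_).trans_eq
      (by rw [add_sub_cancel_left, abs_one, mul_one])
    rw [uIoc_of_le (by linarith)] at ht
    exact hmγ x hx t ⟨ht.1.le, ht.2⟩
  have hgn : ∀ x, 0 < x → ‖g x‖ ≤ ‖γ x‖ + (v (x + 2) - v x) := fun x hx => by
    have := norm_add_le (γ x) (g x - γ x)
    rw [add_sub_cancel] at this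
    linarith [hgγ x hx]
  have hdm : Measurable fun x => ENNReal.ofReal (v (x + 2) - v x) :=
    ((hv.measurable.comp (measurable_id.add_const 2)).sub hv.measurable).ennreal_ofReal
  have hdi := integral_variationUpTo_sub_le hK0 hK
  refine ⟨g, fun x => m (x + 1) - m x, fun x => ENNReal.ofReal (v (x + 2) - v x),
    (hmc.comp (continuous_id.add continuous_const)).sub hmc, hgd, hdm, fun x hx => ⟨?_, ?_, ?_, ?_⟩,
    hdi, ?_, ?_⟩
  · have h1 := hgn x hx
    have h2 := hγM hx
    have h3 := hvK (x + 2)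
    have h4 := hv0 x
    linarith
  · rw [← ofReal_norm]; exact ENNReal.ofReal_le_ofReal (hg' x hx)
  · rw [← ofReal_norm, norm_sub_rev]; exact ENNReal.ofReal_le_ofReal (hgγ x hx)
  · exact ENNReal.ofReal_le_ofReal (by linarith [hvK (x + 2), hv0 x])
  · obtain ⟨n, rfl⟩ : ∃ n, p = n + 1 := ⟨p - 1, by omega⟩
    rw [Nat.add_sub_cancel]
    have hpt : ∀ x ∈ Ioi (0 : ℝ), ‖g x‖ₑ ^ (n + 1) ≤ 2 ^ (n + 1) * (‖γ x‖ₑ ^ (n + 1)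
        + ENNReal.ofReal K ^ n * ENNReal.ofReal (v (x + 2) - v x)) := fun x hx => by
      set a := ‖γ x‖ₑ with ha
      set b := ENNReal.ofReal (v (x + 2) - v x) with hb
      have h1 : ‖g x‖ₑ ≤ 2 * max a b := by
        rw [two_mul]
        refine le_trans ?_ (add_le_add (le_max_left a b) (le_max_right a b))
        rw [ha, hb, ← ofReal_norm, ← ofReal_norm, ← ENNReal.ofReal_add (norm_nonneg _) (hd0 x)]
        exact ENNReal.ofReal_le_ofReal (hgn x hx)
      have h2 : b ^ (n + 1) ≤ ENNReal.ofReal K ^ n * b := by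
        rw [pow_succ]
        gcongr
        exact ENNReal.ofReal_le_ofReal (by linarith [hvK (x + 2), hv0 x])
      calc ‖g x‖ₑ ^ (n + 1) ≤ (2 * max a b) ^ (n + 1) := by gcongr
        _ = 2 ^ (n + 1) * max a b ^ (n + 1) := mul_pow _ _ _
        _ ≤ 2 ^ (n + 1) * (a ^ (n + 1) + b ^ (n + 1)) := by
            gcongr
            rcases le_total a b with h | h
            · rw [max_eq_right h]; exact le_add_self
            · rw [max_eq_left h]; exact le_self_add
        _ ≤ _ := by gcongr
    refine (setLIntegral_mono' measurableSet_Ioi hpt).trans ?_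
    rw [lintegral_const_mul' _ _ (by simp), lintegral_add_right _ (hdm.const_mul _),
      lintegral_const_mul' _ _ (by simp)]
    gcongr
  · refine squeeze_zero_norm' (a := fun x => (M - v x) + (v (x + 2) - v x)) ?_ ?_
    · filter_upwards [eventually_gt_atTop 0] with x hx
      exact (hgn x hx).trans (by linarith [hγM hx])
    · have h2 : Tendsto (fun x => v (x + 2)) atTop (𝓝 M) :=
        hlimv.comp (tendsto_atTop_add_const_right _ 2 tendsto_id)
      simpa using (hlimv.const_sub M).add (h2.sub hlimv)

end variationUpTo

/-! ### Splitting tuples of indices -/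

/-- A tuple of length `J + 1` as a tuple of length `j`, a tuple of length `J - j` and a last
entry. -/
def splitTuple {J : ℕ} (j : Fin (J + 1)) :
    (Fin (J + 1) → ℕ) ≃ ((Fin j → ℕ) × (Fin (J - j) → ℕ)) × ℕ where
  toFun m := ((fun i => m ⟨i, by omega⟩, fun i => m ⟨j + i, by omega⟩), m (Fin.last J))
  invFun t i := if h₁ : (i : ℕ) < j then t.1.1 ⟨i, h₁⟩ else
    if h₂ : (i : ℕ) < J then t.1.2 ⟨i - j, by omega⟩ else t.2
  left_inv m := by
    ext i
    simp only
    split_ifs with h₁ h₂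
    · rfl
    · congr 1; ext; simp only; omega
    · congr 1; ext; simp only [Fin.val_last]; omega
  right_inv t := by
    obtain ⟨⟨a, b⟩, l⟩ := t
    refine Prod.ext (Prod.ext (funext fun i => ?_) (funext fun i => ?_)) ?_
    · simp
    · have h₁ : ¬ ((j : ℕ) + i < j) := by omega
      have h₂ : (j : ℕ) + i < J := by omega
      simp [h₂]
    · have h₁ : ¬ (J < (j : ℕ)) := by omega
      simp [h₁]

@[to_additive]
theorem prod_splitTuple {M : Type*} [CommMonoid M] {J : ℕ} (j : Fin (J + 1)) (F : Fin (J + 1) → M) :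
    ∏ i, F i = ((∏ i : Fin j, F ⟨i, by omega⟩) * ∏ i : Fin (J - j), F ⟨j + i, by omega⟩) *
      F (Fin.last J) := by
  set f : ℕ → M := fun n => if h : n < J + 1 then F ⟨n, h⟩ else 1 with hf
  have hfF : ∀ (n : ℕ) (hn : n < J + 1), f n = F ⟨n, hn⟩ := fun n hn => dif_pos hn
  have h1 : ∏ i, F i = ∏ n ∈ Finset.range (J + 1), f n := by
    rw [← Fin.prod_univ_eq_prod_range]
    exact Finset.prod_congr rfl fun i _ => (hfF i i.2).symm
  have hJ : J = j + (J - j) := by omega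
  have h2 : ∏ n ∈ Finset.range J, f n = (∏ n ∈ Finset.range j, f n) *
      ∏ n ∈ Finset.range (J - j), f (j + n) := by
    conv_lhs => rw [hJ]
    rw [Finset.prod_range_add]
  rw [h1, Finset.prod_range_succ, h2, ← Fin.prod_univ_eq_prod_range,
    ← Fin.prod_univ_eq_prod_range (fun n => f (j + n))]
  congr 1
  · congr 1
    · exact Finset.prod_congr rfl fun i _ => hfF _ _
    · exact Finset.prod_congr rfl fun i _ => hfF _ _
  · exact hfF _ _

/-! ### The oscillating amplitudes -/

/-- The amplitudes of the iterated solution of the Riccati equation, for frozen coefficients: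
`amp 0 = Φ`, and `amp (J + 1)` is `conj Φ` times the quasiperiodic primitive of
`-w⁻¹ e^{-iφ_{J+1} x} ∑_j amp j * amp (J - j)`. For a vanishing divisor the value is zero. -/
def amp (Φ : ℝ → ℂ) (w : ℂ) (k : ℝ) : (J : ℕ) → (Fin J → ℝ) → ℝ → ℂ
  | 0, _ => Φ
  | J + 1, φ => fun x => conj (Φ x) *
      ((Complex.exp (Complex.I * ((2 * k - ∑ i, φ i : ℝ) : ℂ)) - 1)⁻¹ *
        ∫ t in x..(x + 1), -(w⁻¹ * Complex.exp (-(Complex.I * φ (Fin.last J) * t))) *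
          ∑ j : Fin (J + 1), amp Φ w k j (fun i => φ ⟨i, by omega⟩) t *
            amp Φ w k (J - j) (fun i => φ ⟨j + i, by omega⟩) t)
termination_by J => J
decreasing_by all_goals omega

/-- The right-hand side `-w⁻¹ e^{-iφ_{J+1} t} ∑_j amp j * amp (J - j)` at order `J + 1`. -/
def ampSource (Φ : ℝ → ℂ) (w : ℂ) (k : ℝ) (J : ℕ) (φ : Fin (J + 1) → ℝ) (t : ℝ) : ℂ :=
  -(w⁻¹ * Complex.exp (-(Complex.I * φ (Fin.last J) * t))) *
    ∑ j : Fin (J + 1), amp Φ w k j (fun i => φ ⟨i, by omega⟩) t *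
      amp Φ w k (J - j) (fun i => φ ⟨j + i, by omega⟩) t

/-- The quasiperiodic primitive of `ampSource`. -/
def ampPrimitive (Φ : ℝ → ℂ) (w : ℂ) (k : ℝ) (J : ℕ) (φ : Fin (J + 1) → ℝ) (x : ℝ) : ℂ :=
  (Complex.exp (Complex.I * ((2 * k - ∑ i, φ i : ℝ) : ℂ)) - 1)⁻¹ *
    ∫ t in x..(x + 1), ampSource Φ w k J φ t

section amp

variable {Φ : ℝ → ℂ} {w : ℂ} {k : ℝ}

theorem amp_zero (φ : Fin 0 → ℝ) : amp Φ w k 0 φ = Φ := by rw [amp]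

theorem amp_succ (J : ℕ) (φ : Fin (J + 1) → ℝ) :
    amp Φ w k (J + 1) φ = fun x => conj (Φ x) * ampPrimitive Φ w k J φ x := by
  rw [amp]; rfl

theorem h_succ (J : ℕ) (φ : Fin (J + 1) → ℝ) :
    h k (J + 1) φ = ‖(1 : ℂ) - Complex.exp (Complex.I * ((2 * k - ∑ i, φ i : ℝ) : ℂ))‖ₑ⁻¹ *
      ∑ j : Fin (J + 1), h k j (fun i => φ ⟨i, by omega⟩) *
        h k (J - j) (fun i => φ ⟨j + i, by omega⟩) := by
  rw [h]

theorem h_ne_zero (J : ℕ) (φ : Fin J → ℝ) : h k J φ ≠ 0 := by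
  induction J using Nat.strong_induction_on with
  | _ J ih =>
    cases J with
    | zero => rw [h]; exact one_ne_zero
    | succ J =>
      rw [h_succ]
      refine mul_ne_zero (ENNReal.inv_ne_zero.2 enorm_ne_top) ?_
      intro h0
      exact mul_ne_zero (ih _ (by simp) _) (ih _ (by simp) _)
        (Finset.sum_eq_zero_iff.1 h0 0 (Finset.mem_univ _))

/-- A vanishing divisor makes `h` infinite, because the sum in its definition is not zero. -/
theorem h_eq_top_of_exp_eq_one (J : ℕ) (φ : Fin (J + 1) → ℝ)
    (he : Complex.exp (Complex.I * ((2 * k - ∑ i, φ i : ℝ) : ℂ)) = 1) : h k (J + 1) φ = ⊤ := by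
  have := h_ne_zero (k := k) (J + 1) φ
  rw [h_succ, he, sub_self, enorm_zero, ENNReal.inv_zero] at this ⊢
  exact ENNReal.top_mul (right_ne_zero_of_mul this)

theorem continuous_ampSource_of (J : ℕ) (φ : Fin (J + 1) → ℝ)
    (ih : ∀ j < J + 1, ∀ φ : Fin j → ℝ, Continuous (amp Φ w k j φ)) :
    Continuous (ampSource Φ w k J φ) := by
  unfold ampSource
  refine Continuous.mul (by fun_prop) (continuous_finsetSum _ fun j _ => ?_)
  exact (ih _ (by omega) _).mul (ih _ (by omega) _)

theorem continuous_ampPrimitive_of (J : ℕ) (φ : Fin (J + 1) → ℝ)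
    (hc : Continuous (ampSource Φ w k J φ)) : Continuous (ampPrimitive Φ w k J φ) := by
  unfold ampPrimitive
  refine continuous_const.mul ?_
  have h1 : Continuous fun x => ∫ t in (0 : ℝ)..x, ampSource Φ w k J φ t :=
    intervalIntegral.continuous_primitive (fun a b => hc.intervalIntegrable a b) 0
  have h2 : (fun x => ∫ t in x..(x + 1), ampSource Φ w k J φ t) = fun x =>
      (∫ t in (0 : ℝ)..(x + 1), ampSource Φ w k J φ t) - ∫ t in (0 : ℝ)..x, ampSource Φ w k J φ t := by
    ext x
    rw [intervalIntegral.integral_interval_sub_left (hc.intervalIntegrable _ _)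
      (hc.intervalIntegrable _ _)]
  rw [h2]
  exact (h1.comp (continuous_id.add continuous_const)).sub h1

theorem continuous_amp (hΦ : Continuous Φ) (J : ℕ) (φ : Fin J → ℝ) :
    Continuous (amp Φ w k J φ) := by
  induction J using Nat.strong_induction_on with
  | _ J ih =>
    cases J with
    | zero => rwa [amp_zero]
    | succ J =>
      rw [amp_succ]
      exact (Complex.continuous_conj.comp hΦ).mul
        (continuous_ampPrimitive_of J φ (continuous_ampSource_of J φ ih))

theorem continuous_ampSource (hΦ : Continuous Φ) (J : ℕ) (φ : Fin (J + 1) → ℝ) :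
    Continuous (ampSource Φ w k J φ) :=
  continuous_ampSource_of J φ fun j _ φ => continuous_amp hΦ j φ

theorem continuous_ampPrimitive (hΦ : Continuous Φ) (J : ℕ) (φ : Fin (J + 1) → ℝ) :
    Continuous (ampPrimitive Φ w k J φ) :=
  continuous_ampPrimitive_of J φ (continuous_ampSource hΦ J φ)

theorem ampSource_add_one_of (J : ℕ) (φ : Fin (J + 1) → ℝ) {x : ℝ}
    (ih : ∀ j < J + 1, ∀ φ : Fin j → ℝ, amp Φ w k j φ (x + 1) =
      Complex.exp (Complex.I * ((k - ∑ i, φ i : ℝ) : ℂ)) * amp Φ w k j φ x) :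
    ampSource Φ w k J φ (x + 1) =
      Complex.exp (Complex.I * ((2 * k - ∑ i, φ i : ℝ) : ℂ)) * ampSource Φ w k J φ x := by
  unfold ampSource
  rw [Finset.mul_sum, Finset.mul_sum, Finset.mul_sum]
  refine Finset.sum_congr rfl fun j _ => ?_
  rw [ih _ (by omega), ih _ (by omega), sum_splitTuple j φ]
  have : ∀ a b c d e f : ℂ, a = b + c + d + e → Complex.exp b = f → Complex.exp a =
      f * Complex.exp c * Complex.exp d * Complex.exp e := by
    rintro a b c d e f rfl rfl
    rw [Complex.exp_add, Complex.exp_add, Complex.exp_add]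
  set S₁ := ∑ i : Fin j, φ ⟨i, by omega⟩
  set S₂ := ∑ i : Fin (J - j), φ ⟨j + i, by omega⟩
  have e1 : Complex.exp (-(Complex.I * φ (Fin.last J) * ((x + 1 : ℝ) : ℂ))) *
      Complex.exp (Complex.I * ((k - S₁ : ℝ) : ℂ)) * Complex.exp (Complex.I * ((k - S₂ : ℝ) : ℂ)) =
      Complex.exp (Complex.I * ((2 * k - (S₁ + S₂ + φ (Fin.last J)) : ℝ) : ℂ)) *
        Complex.exp (-(Complex.I * φ (Fin.last J) * x)) := by
    rw [← Complex.exp_add, ← Complex.exp_add, ← Complex.exp_add]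
    congr 1
    push_cast
    ring
  linear_combination (-w⁻¹ * amp Φ w k j (fun i => φ ⟨i, by omega⟩) x *
    amp Φ w k (J - j) (fun i => φ ⟨j + i, by omega⟩) x) * e1

theorem ampPrimitive_add_one_of (J : ℕ) (φ : Fin (J + 1) → ℝ)
    (hs : ∀ x, 0 ≤ x → ampSource Φ w k J φ (x + 1) =
      Complex.exp (Complex.I * ((2 * k - ∑ i, φ i : ℝ) : ℂ)) * ampSource Φ w k J φ x)
    {x : ℝ} (hx : 0 ≤ x) :
    ampPrimitive Φ w k J φ (x + 1) =
      Complex.exp (Complex.I * ((2 * k - ∑ i, φ i : ℝ) : ℂ)) * ampPrimitive Φ w k J φ x := by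
  unfold ampPrimitive
  have h1 := intervalIntegral.integral_comp_add_right (a := x) (b := x + 1) (ampSource Φ w k J φ) 1
  have h2 : ∫ t in x..(x + 1), ampSource Φ w k J φ (t + 1) =
      Complex.exp (Complex.I * ((2 * k - ∑ i, φ i : ℝ) : ℂ)) *
        ∫ t in x..(x + 1), ampSource Φ w k J φ t := by
    rw [← intervalIntegral.integral_const_mul]
    refine intervalIntegral.integral_congr fun t ht => ?_
    rw [uIcc_of_le (by linarith)] at ht
    exact hs t (hx.trans ht.1)
  rw [← h1, h2, mul_left_comm]

/-- The amplitude of the frequencies `φ` has quasimomentum `k - ∑ φ`. -/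
theorem amp_add_one (hΦ : ∀ x, 0 ≤ x → Φ (x + 1) = Complex.exp (Complex.I * k) * Φ x) (J : ℕ)
    (φ : Fin J → ℝ) {x : ℝ} (hx : 0 ≤ x) :
    amp Φ w k J φ (x + 1) =
      Complex.exp (Complex.I * ((k - ∑ i, φ i : ℝ) : ℂ)) * amp Φ w k J φ x := by
  induction J using Nat.strong_induction_on generalizing x with
  | _ J ih =>
    cases J with
    | zero => simp [amp_zero, hΦ x hx]
    | succ J =>
      simp only [amp_succ]
      rw [ampPrimitive_add_one_of J φ (fun x hx => ampSource_add_one_of J φ fun j hj φ => ih j hj φ hx)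
        hx, hΦ x hx, map_mul, ← Complex.exp_conj, map_mul, Complex.conj_I, Complex.conj_ofReal]
      have : Complex.exp (Complex.I * ((k - ∑ i, φ i : ℝ) : ℂ)) = Complex.exp (-Complex.I * k) *
          Complex.exp (Complex.I * ((2 * k - ∑ i, φ i : ℝ) : ℂ)) := by
        rw [← Complex.exp_add]
        congr 1
        push_cast
        ring
      rw [this]
      ring

theorem hasDerivAt_ampPrimitive (hc : Continuous Φ)
    (hΦ : ∀ x, 0 ≤ x → Φ (x + 1) = Complex.exp (Complex.I * k) * Φ x) (J : ℕ)
    (φ : Fin (J + 1) → ℝ)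
    (he : Complex.exp (Complex.I * ((2 * k - ∑ i, φ i : ℝ) : ℂ)) ≠ 1) {x : ℝ} (hx : 0 ≤ x) :
    HasDerivAt (ampPrimitive Φ w k J φ) (ampSource Φ w k J φ x) x := by
  have hs := continuous_ampSource (w := w) (k := k) hc J φ
  have h1 : ∀ y, HasDerivAt (fun y => ∫ t in (0 : ℝ)..y, ampSource Φ w k J φ t)
      (ampSource Φ w k J φ y) y := fun y => (hs.integral_hasStrictDerivAt 0 y).hasDerivAt
  have h2 : ampPrimitive Φ w k J φ = fun x =>
      (Complex.exp (Complex.I * ((2 * k - ∑ i, φ i : ℝ) : ℂ)) - 1)⁻¹ *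
      ((∫ t in (0 : ℝ)..(x + 1), ampSource Φ w k J φ t) -
        ∫ t in (0 : ℝ)..x, ampSource Φ w k J φ t) := by
    ext x
    rw [intervalIntegral.integral_interval_sub_left (hs.intervalIntegrable _ _)
      (hs.intervalIntegrable _ _)]
    rfl
  rw [h2]
  refine ((((h1 (x + 1)).comp_add_const x 1).sub (h1 x)).const_mul _).congr_deriv ?_
  rw [ampSource_add_one_of J φ fun j _ φ => amp_add_one hΦ j φ hx]
  have := sub_ne_zero.2 he
  field_simp

theorem enorm_ampSource_le_of (J : ℕ) {C : ℕ → ℝ≥0∞}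
    (hC : ∀ j < J + 1, ∀ (φ : Fin j → ℝ) x, ‖amp Φ w k j φ x‖ₑ ≤ C j * h k j φ)
    (φ : Fin (J + 1) → ℝ) (x : ℝ) :
    ‖ampSource Φ w k J φ x‖ₑ ≤ (‖w⁻¹‖ₑ * ∑ j : Fin (J + 1), C j * C (J - j)) *
      ∑ j : Fin (J + 1), h k j (fun i => φ ⟨i, by omega⟩) *
        h k (J - j) (fun i => φ ⟨j + i, by omega⟩) := by
  unfold ampSource
  have e1 : ‖Complex.exp (-(Complex.I * φ (Fin.last J) * x))‖ₑ = 1 := by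
    have : -(Complex.I * φ (Fin.last J) * x) = ((-(φ (Fin.last J) * x) : ℝ) : ℂ) * Complex.I := by
      push_cast; ring
    rw [this, ← ofReal_norm, Complex.norm_exp_ofReal_mul_I, ENNReal.ofReal_one]
  rw [enorm_mul, enorm_neg, enorm_mul, e1, mul_one, mul_assoc]
  gcongr
  refine (enorm_sum_le _ _).trans ?_
  rw [Finset.mul_sum]
  refine Finset.sum_le_sum fun j _ => ?_
  rw [enorm_mul]
  calc _ ≤ (C j * h k j fun i => φ ⟨i, by omega⟩) *
        (C (J - j) * h k (J - j) fun i => φ ⟨j + i, by omega⟩) := by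
        gcongr
        · exact hC _ (by omega) _ _
        · exact hC _ (by omega) _ _
    _ = (C j * C (J - j)) * (h k j (fun i => φ ⟨i, by omega⟩) *
          h k (J - j) fun i => φ ⟨j + i, by omega⟩) := by ring
    _ ≤ _ := by
        gcongr
        exact Finset.single_le_sum (f := fun j : Fin (J + 1) => C j * C (J - j))
          (fun _ _ => zero_le) (Finset.mem_univ j)

theorem enorm_ampPrimitive_le_of (J : ℕ) {D : ℝ≥0∞} (φ : Fin (J + 1) → ℝ)
    (hD : ∀ x, ‖ampSource Φ w k J φ x‖ₑ ≤ D * ∑ j : Fin (J + 1), h k j (fun i => φ ⟨i, by omega⟩) *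
        h k (J - j) (fun i => φ ⟨j + i, by omega⟩)) (x : ℝ) :
    ‖ampPrimitive Φ w k J φ x‖ₑ ≤ D * h k (J + 1) φ := by
  unfold ampPrimitive
  rw [h_succ, enorm_mul, intervalIntegral.integral_of_le (by linarith), mul_left_comm]
  gcongr
  · rw [enorm_sub_rev]
    rcases eq_or_ne (Complex.exp (Complex.I * ((2 * k - ∑ i, φ i : ℝ) : ℂ)) - 1) 0 with he | he
    · rw [he, inv_zero, enorm_zero]; exact zero_le
    · rw [enorm_inv he]
  · refine (enorm_integral_le_lintegral_enorm _).trans ?_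
    refine (lintegral_mono hD).trans ?_
    simp

/-- The amplitudes are controlled by the small divisor functions. -/
theorem exists_enorm_amp_le {A : ℝ≥0∞} (hA : A ≠ ⊤) (hΦ : ∀ x, ‖Φ x‖ₑ ≤ A) (J : ℕ) :
    ∃ C : ℝ≥0∞, C ≠ ⊤ ∧ (∀ (φ : Fin J → ℝ) x, ‖amp Φ w k J φ x‖ₑ ≤ C * h k J φ) ∧
      (∀ (φ : Fin (J + 1) → ℝ) x, ‖ampPrimitive Φ w k J φ x‖ₑ ≤ C * h k (J + 1) φ) ∧
      ∀ (φ : Fin (J + 1) → ℝ) x, ‖ampSource Φ w k J φ x‖ₑ ≤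
        C * ∑ j : Fin (J + 1), h k j (fun i => φ ⟨i, by omega⟩) *
          h k (J - j) (fun i => φ ⟨j + i, by omega⟩) := by
  have hw' : ‖w⁻¹‖ₑ ≠ ⊤ := enorm_ne_top
  have key : ∀ J, ∃ C : ℝ≥0∞, C ≠ ⊤ ∧ ∀ (φ : Fin J → ℝ) x, ‖amp Φ w k J φ x‖ₑ ≤ C * h k J φ := by
    intro J
    induction J using Nat.strong_induction_on with
    | _ J ih =>
      cases J with
      | zero => exact ⟨A, hA, fun φ x => by rw [amp_zero, h, mul_one]; exact hΦ x⟩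
      | succ J =>
        choose! C hCt hC using ih
        refine ⟨A * (‖w⁻¹‖ₑ * ∑ j : Fin (J + 1), C j * C (J - j)), ?_, fun φ x => ?_⟩
        · refine ENNReal.mul_ne_top hA (ENNReal.mul_ne_top hw' (ENNReal.sum_ne_top.2 fun j _ =>
            ENNReal.mul_ne_top (hCt _ (by omega)) (hCt _ (by omega))))
        · simp only [amp_succ]
          rw [enorm_mul, mul_assoc, ← ofReal_norm, Complex.norm_conj, ofReal_norm]
          gcongr
          · exact hΦ x
          · exact enorm_ampPrimitive_le_of J φ (fun x => enorm_ampSource_le_of J hC φ x) x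
  choose C hCt hC using key
  have hs : ∀ (φ : Fin (J + 1) → ℝ) x, _ := fun φ x =>
    enorm_ampSource_le_of J (fun j _ φ x => hC j φ x) φ x
  set C' := ‖w⁻¹‖ₑ * ∑ j : Fin (J + 1), C j * C (J - j)
  refine ⟨max (C J) C', ?_, fun φ x => (hC J φ x).trans ?_, fun φ x =>
    (enorm_ampPrimitive_le_of J φ (hs φ) x).trans ?_, fun φ x => (hs φ x).trans ?_⟩
  · exact max_lt (hCt J).lt_top (ENNReal.mul_ne_top hw' (ENNReal.sum_ne_top.2 fun j _ =>
      ENNReal.mul_ne_top (hCt _) (hCt _))).lt_top |>.ne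
  · gcongr; exact le_max_left _ _
  · gcongr; exact le_max_right _ _
  · gcongr; exact le_max_right _ _

end amp

/-! ### Functions with an integrable majorant, and series of functions -/

/-- `r` is dominated on `(0, ∞)` by a measurable function of finite integral; `r` itself need not
be measurable. -/
def HasIntegrableMajorant (r : ℝ → ℂ) : Prop :=
  ∃ e : ℝ → ℝ≥0∞, Measurable e ∧ ∫⁻ x in Ioi (0 : ℝ), e x ≠ ⊤ ∧ ∀ x, 0 < x → ‖r x‖ₑ ≤ e x

namespace HasIntegrableMajorant

variable {r s : ℝ → ℂ}

theorem congr (hr : HasIntegrableMajorant r) (h : ∀ x, 0 < x → s x = r x) :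
    HasIntegrableMajorant s := by
  obtain ⟨e, he, hi, hre⟩ := hr
  exact ⟨e, he, hi, fun x hx => by rw [h x hx]; exact hre x hx⟩

theorem add (hr : HasIntegrableMajorant r) (hs : HasIntegrableMajorant s) :
    HasIntegrableMajorant fun x => r x + s x := by
  obtain ⟨e, he, hi, hre⟩ := hr
  obtain ⟨e', he', hi', hse⟩ := hs
  refine ⟨fun x => e x + e' x, he.add he', ?_, fun x hx => (enorm_add_le _ _).trans
    (add_le_add (hre x hx) (hse x hx))⟩
  rw [lintegral_add_left he]
  exact ENNReal.add_ne_top.2 ⟨hi, hi'⟩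

theorem sum {ι : Type*} (t : Finset ι) {r : ι → ℝ → ℂ} (hr : ∀ i ∈ t, HasIntegrableMajorant (r i)) :
    HasIntegrableMajorant fun x => ∑ i ∈ t, r i x := by
  classical
  induction t using Finset.induction_on with
  | empty => exact ⟨fun _ => 0, measurable_const, by simp, by simp⟩
  | insert i t hi ih =>
    refine ((hr i (Finset.mem_insert_self _ _)).add
      (ih fun j hj => hr j (Finset.mem_insert_of_mem hj))).congr fun x _ => ?_
    rw [Finset.sum_insert hi]

theorem mul_bounded (hr : HasIntegrableMajorant r) {M : ℝ≥0∞} (hM : M ≠ ⊤)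
    (hs : ∀ x, 0 < x → ‖s x‖ₑ ≤ M) : HasIntegrableMajorant fun x => s x * r x := by
  obtain ⟨e, he, hi, hre⟩ := hr
  refine ⟨fun x => M * e x, he.const_mul M, ?_, fun x hx => ?_⟩
  · rw [lintegral_const_mul _ he]
    exact ENNReal.mul_ne_top hM hi
  · rw [enorm_mul]
    exact mul_le_mul' (hs x hx) (hre x hx)

/-- A majorant that is a series of functions with uniformly bounded integrals and summable
coefficients. -/
theorem of_enorm_le_tsum {ι : Type*} [Countable ι] {κ : ι → ℝ≥0∞} {q : ι → ℝ → ℝ≥0∞} {Q : ℝ≥0∞}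
    (hκ : ∑' t, κ t ≠ ⊤) (hQ : Q ≠ ⊤) (hq : ∀ t, Measurable (q t))
    (hqQ : ∀ t, ∫⁻ x in Ioi (0 : ℝ), q t x ≤ Q) (h : ∀ x, 0 < x → ‖r x‖ₑ ≤ ∑' t, κ t * q t x) :
    HasIntegrableMajorant r := by
  refine ⟨fun x => ∑' t, κ t * q t x, by fun_prop, ?_, h⟩
  rw [lintegral_tsum fun t => ((hq t).const_mul _).aemeasurable]
  refine ne_top_of_le_ne_top (ENNReal.mul_ne_top hκ hQ) ?_
  rw [← ENNReal.tsum_mul_right]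
  refine ENNReal.tsum_le_tsum fun t => ?_
  rw [lintegral_const_mul _ (hq t)]
  gcongr
  exact hqQ t

end HasIntegrableMajorant

theorem norm_le_toReal_of_enorm_le {z : ℂ} {a : ℝ≥0∞} (ha : a ≠ ⊤) (h : ‖z‖ₑ ≤ a) :
    ‖z‖ ≤ a.toReal := by
  rw [← toReal_enorm]
  exact ENNReal.toReal_mono ha h

theorem summable_norm_of_enorm_le {ι : Type*} {a : ι → ℂ} {κ : ι → ℝ≥0∞}
    (h : ∀ t, ‖a t‖ₑ ≤ κ t) (hκ : ∑' t, κ t ≠ ⊤) : Summable fun t => ‖a t‖ :=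
  Summable.of_nonneg_of_le (fun _ => norm_nonneg _)
    (fun t => norm_le_toReal_of_enorm_le (ENNReal.ne_top_of_tsum_ne_top hκ t) (h t))
    (ENNReal.summable_toReal hκ)

theorem enorm_tsum_le_of_enorm_le {ι : Type*} {a : ι → ℂ} {κ : ι → ℝ≥0∞}
    (h : ∀ t, ‖a t‖ₑ ≤ κ t) : ‖∑' t, a t‖ₑ ≤ ∑' t, κ t :=
  enorm_tsum_le_tsum_enorm.trans (ENNReal.tsum_le_tsum h)

theorem IsPrimitive.sum_range {X : ℝ} {F f : ℕ → ℝ → ℂ} (n : ℕ)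
    (hF : ∀ J < n, IsPrimitive X (F J) (f J)) :
    IsPrimitive X (fun x => ∑ J ∈ Finset.range n, F J x) fun x => ∑ J ∈ Finset.range n, f J x := by
  induction n with
  | zero => simpa using IsPrimitive.const X 0
  | succ n ih =>
    simp only [Finset.sum_range_succ]
    exact (ih fun J hJ => hF J (by omega)).add (hF n (by omega))

/-- Termwise differentiation of a series that is controlled on the open half line `(0, ∞)`; the
primitive is restricted to `[1, ∞)` because nothing is known at the origin. -/
theorem isPrimitive_tsum {ι : Type*} {F F' : ι → ℝ → ℂ} {κ : ι → ℝ≥0∞}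
    (hκ : ∑' t, κ t ≠ ⊤) (hF : ∀ t x, 0 < x → ‖F t x‖ₑ ≤ κ t)
    (hF' : ∀ t x, 0 < x → ‖F' t x‖ₑ ≤ κ t) (hd : ∀ t x, 0 < x → HasDerivAt (F t) (F' t x) x)
    (hc : ∀ t, ContinuousOn (F' t) (Ioi 0)) :
    IsPrimitive 1 (fun x => ∑' t, F t x) fun x => ∑' t, F' t x := by
  have hs := ENNReal.summable_toReal hκ
  have hb : ∀ t x, x ∈ Ioi (0 : ℝ) → ‖F' t x‖ ≤ (κ t).toReal := fun t x hx =>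
    norm_le_toReal_of_enorm_le (ENNReal.ne_top_of_tsum_ne_top hκ t) (hF' t x hx)
  refine .of_hasDerivAt ?_ fun x hx => ?_
  · exact (continuousOn_tsum hc hs hb).mono (Ici_subset_Ioi.2 one_pos)
  · have hx0 : (0 : ℝ) < x := lt_of_lt_of_le one_pos hx
    exact hasDerivAt_tsum_of_isPreconnected hs isOpen_Ioi isPreconnected_Ioi
      (fun t y hy => hd t y hy) hb (mem_Ioi.2 one_pos)
      (summable_norm_of_enorm_le (fun t => hF t 1 one_pos) hκ).of_norm hx0

theorem tendsto_tsum_zero {ι : Type*} {F : ι → ℝ → ℂ} {κ : ι → ℝ≥0∞}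
    (hκ : ∑' t, κ t ≠ ⊤) (hF : ∀ t x, 0 < x → ‖F t x‖ₑ ≤ κ t)
    (h0 : ∀ t, Tendsto (F t) atTop (𝓝 0)) : Tendsto (fun x => ∑' t, F t x) atTop (𝓝 0) := by
  have := tendsto_tsum_of_dominated_convergence (ENNReal.summable_toReal hκ) h0
    ((eventually_gt_atTop 0).mono fun x hx t =>
      norm_le_toReal_of_enorm_le (ENNReal.ne_top_of_tsum_ne_top hκ t) (hF t x hx))
  simpa using this

/-- A product of at least `p` factors, all bounded by `B ≥ 1`, is controlled by the sum of their
`p`-th powers. -/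
theorem prod_le_pow_mul_sum_pow {ι : Type*} [Fintype ι] {p : ℕ} (hp : 0 < p)
    (hι : p ≤ Fintype.card ι) {B : ℝ≥0∞} (hB : 1 ≤ B) {y : ι → ℝ≥0∞} (hy : ∀ i, y i ≤ B) :
    ∏ i, y i ≤ B ^ Fintype.card ι * ∑ i, y i ^ p := by
  have : Nonempty ι := Fintype.card_pos_iff.1 (hp.trans_le hι)
  obtain ⟨i₀, hi₀⟩ := Finite.exists_max y
  calc ∏ i, y i ≤ ∏ _i : ι, y i₀ := Finset.prod_le_prod' fun i _ => hi₀ i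
    _ = y i₀ ^ (Fintype.card ι - p) * y i₀ ^ p := by
        rw [Finset.prod_const, ← pow_add, Nat.sub_add_cancel hι, Finset.card_univ]
    _ ≤ B ^ Fintype.card ι * ∑ i, y i ^ p := by
        refine mul_le_mul' ?_ ?_
        · exact (pow_le_pow_left' (hy i₀) _).trans (pow_le_pow_right' hB (Nat.sub_le _ _))
        · exact Finset.single_le_sum (f := fun i => y i ^ p) (fun _ _ => zero_le)
            (Finset.mem_univ i₀)

/-- The part of total degree below `n` of the square of a sum is a sum of convolutions. -/
theorem sum_conv_add_sum_filter_eq_sq (S : ℕ → ℂ) (n : ℕ) :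
    ∑ J ∈ Finset.range n, ∑ j : Fin (J + 1), S j * S (J - j) +
      ∑ t ∈ (Finset.range (n + 1) ×ˢ Finset.range (n + 1)).filter fun t => ¬ t.1 + t.2 < n,
        S t.1 * S t.2 = (∑ a ∈ Finset.range (n + 1), S a) ^ 2 := by
  rw [sq, Finset.sum_mul_sum, ← Finset.sum_product',
    ← Finset.sum_filter_add_sum_filter_not (Finset.range (n + 1) ×ˢ Finset.range (n + 1))
      fun t : ℕ × ℕ => t.1 + t.2 < n]
  congr 1
  have hmaps : ∀ t ∈ (Finset.range (n + 1) ×ˢ Finset.range (n + 1)).filter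
      (fun t : ℕ × ℕ => t.1 + t.2 < n), t.1 + t.2 ∈ Finset.range n :=
    fun t ht => Finset.mem_range.2 (Finset.mem_filter.1 ht).2
  rw [← Finset.sum_fiberwise_of_maps_to hmaps]
  refine Finset.sum_congr rfl fun J hJ => ?_
  rw [Finset.mem_range] at hJ
  rw [Fin.sum_univ_eq_sum_range (fun j => S j * S (J - j)),
    ← Finset.Nat.sum_antidiagonal_eq_sum_range_succ (fun a b => S a * S b)]
  refine Finset.sum_congr ?_ fun _ _ => rfl
  ext ⟨a, b⟩
  simp only [Finset.HasAntidiagonal.mem_antidiagonal, Finset.mem_filter, Finset.mem_product, Finset.mem_range]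
  omega

/-! ### The approximate solution of the Riccati equation -/

/-- Smoothed coefficient functions `g l` together with common majorants `d l` for their derivatives
and for the error made in the smoothing. -/
structure IsSmoothFamily (g g' : ℕ → ℝ → ℂ) (d : ℕ → ℝ → ℝ≥0∞) (p : ℕ) (B Q : ℝ≥0∞) : Prop where
  one_le : 1 ≤ B
  ne_top : B ≠ ⊤
  integral_ne_top : Q ≠ ⊤
  continuous_deriv : ∀ l, Continuous (g' l)
  hasDerivAt : ∀ l x, HasDerivAt (g l) (g' l x) x
  measurable : ∀ l, Measurable (d l)
  enorm_le : ∀ l x, 0 < x → ‖g l x‖ₑ ≤ B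
  enorm_deriv_le : ∀ l x, 0 < x → ‖g' l x‖ₑ ≤ d l x
  le : ∀ l x, 0 < x → d l x ≤ B
  lintegral_le : ∀ l, ∫⁻ x in Ioi (0 : ℝ), d l x ≤ Q
  lintegral_pow_le : ∀ l, ∫⁻ x in Ioi (0 : ℝ), ‖g l x‖ₑ ^ p ≤ Q
  tendsto : ∀ l, Tendsto (g l) atTop (𝓝 0)

/-- The weight of a tuple of frequencies in the small divisor condition. -/
def weight (c : ℕ → ℂ) (φ : ℕ → ℝ) (k : ℝ) (J : ℕ) (m : Fin J → ℕ) : ℝ≥0∞ :=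
  ‖∏ i, c (m i)‖ₑ * h k J (fun i => φ (m i))

/-- The homogeneous part of degree `J` of `Φ + conj Φ * f`, where `f` is the approximate solution
of the Riccati equation. -/
def solutionTerm (c : ℕ → ℂ) (φ : ℕ → ℝ) (k : ℝ) (g : ℕ → ℝ → ℂ) (Φ : ℝ → ℂ) (w : ℂ) (J : ℕ)
    (x : ℝ) : ℂ :=
  ∑' m : Fin J → ℕ, (∏ i, c (m i)) * ((∏ i, g (m i) x) * amp Φ w k J (fun i => φ (m i)) x)

/-- The homogeneous part of degree `J + 1` of the approximate solution of the Riccati equation. -/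
def riccatiTerm (c : ℕ → ℂ) (φ : ℕ → ℝ) (k : ℝ) (g : ℕ → ℝ → ℂ) (Φ : ℝ → ℂ) (w : ℂ) (J : ℕ)
    (x : ℝ) : ℂ :=
  ∑' m : Fin (J + 1) → ℕ,
    (∏ i, c (m i)) * ((∏ i, g (m i) x) * ampPrimitive Φ w k J (fun i => φ (m i)) x)

/-- The part of the derivative of `riccatiTerm` in which the derivative falls on a coefficient
function. -/
def riccatiRemainder (c : ℕ → ℂ) (φ : ℕ → ℝ) (k : ℝ) (g g' : ℕ → ℝ → ℂ) (Φ : ℝ → ℂ) (w : ℂ)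
    (J : ℕ) (x : ℝ) : ℂ :=
  ∑' m : Fin (J + 1) → ℕ, (∏ i, c (m i)) *
    ((∑ i, (∏ j ∈ Finset.univ.erase i, g (m j) x) * g' (m i) x) *
      ampPrimitive Φ w k J (fun i => φ (m i)) x)

/-- The potential with smoothed coefficient functions. -/
def smoothPotential (c : ℕ → ℂ) (φ : ℕ → ℝ) (g : ℕ → ℝ → ℂ) (x : ℝ) : ℂ :=
  ∑' l, c l * Complex.exp (-(Complex.I * φ l * x)) * g l x

section riccati

variable {c : ℕ → ℂ} {φ : ℕ → ℝ} {k : ℝ} {g g' : ℕ → ℝ → ℂ} {Φ : ℝ → ℂ} {w : ℂ}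
  {d : ℕ → ℝ → ℝ≥0∞} {p : ℕ} {B Q A : ℝ≥0∞}

theorem enorm_exp_neg_I_mul (a x : ℝ) : ‖Complex.exp (-(Complex.I * a * x))‖ₑ = 1 := by
  have : -(Complex.I * a * x) = ((-(a * x) : ℝ) : ℂ) * Complex.I := by
    push_cast; ring
  rw [this, ← ofReal_norm, Complex.norm_exp_ofReal_mul_I, ENNReal.ofReal_one]

theorem enorm_prod {ι : Type*} (s : Finset ι) (f : ι → ℂ) :
    ‖∏ i ∈ s, f i‖ₑ = ∏ i ∈ s, ‖f i‖ₑ := by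
  classical
  induction s using Finset.induction_on with
  | empty => simp
  | insert i s hi ih => rw [Finset.prod_insert hi, Finset.prod_insert hi, enorm_mul, ih]

namespace IsSmoothFamily

theorem continuous (hg : IsSmoothFamily g g' d p B Q) (l : ℕ) : Continuous (g l) :=
  continuous_iff_continuousAt.2 fun x => (hg.hasDerivAt l x).continuousAt

theorem enorm_prod_le (hg : IsSmoothFamily g g' d p B Q) {ι : Type*} (s : Finset ι) (m : ι → ℕ)
    {x : ℝ} (hx : 0 < x) : ∏ i ∈ s, ‖g (m i) x‖ₑ ≤ B ^ s.card := by
  refine (Finset.prod_le_prod' fun i _ => hg.enorm_le (m i) x hx).trans_eq ?_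
  rw [Finset.prod_const]

theorem enorm_sum_prod_le (hg : IsSmoothFamily g g' d p B Q) {J : ℕ} (m : Fin (J + 1) → ℕ)
    {x : ℝ} (hx : 0 < x) :
    ‖∑ i, (∏ j ∈ Finset.univ.erase i, g (m j) x) * g' (m i) x‖ₑ ≤
      B ^ J * ∑ i, d (m i) x := by
  refine (enorm_sum_le _ _).trans ?_
  rw [Finset.mul_sum]
  refine Finset.sum_le_sum fun i _ => ?_
  rw [enorm_mul, enorm_prod]
  refine mul_le_mul' ((hg.enorm_prod_le _ m hx).trans_eq ?_) (hg.enorm_deriv_le _ x hx)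
  rw [Finset.card_erase_of_mem (Finset.mem_univ _)]
  simp

theorem enorm_sum_prod_le' (hg : IsSmoothFamily g g' d p B Q) {J : ℕ} (m : Fin (J + 1) → ℕ)
    {x : ℝ} (hx : 0 < x) :
    ‖∑ i, (∏ j ∈ Finset.univ.erase i, g (m j) x) * g' (m i) x‖ₑ ≤
      B ^ J * ((J + 1 : ℕ) * B) := by
  refine (hg.enorm_sum_prod_le m hx).trans ?_
  gcongr
  refine (Finset.sum_le_sum fun i _ => hg.le (m i) x hx).trans_eq ?_
  simp

end IsSmoothFamily

theorem sum_h_mul_h_le (J : ℕ) (φ : Fin (J + 1) → ℝ) :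
    ∑ j : Fin (J + 1), h k j (fun i => φ ⟨i, by omega⟩) *
      h k (J - j) (fun i => φ ⟨j + i, by omega⟩) ≤ 2 * h k (J + 1) φ := by
  by_cases he : Complex.exp (Complex.I * ((2 * k - ∑ i, φ i : ℝ) : ℂ)) = 1
  · rw [h_eq_top_of_exp_eq_one J φ he, ENNReal.mul_top two_ne_zero]
    exact le_top
  · rw [h_succ]
    set z := (1 : ℂ) - Complex.exp (Complex.I * ((2 * k - ∑ i, φ i : ℝ) : ℂ)) with hz
    have hz0 : ‖z‖ₑ ≠ 0 := enorm_ne_zero.2 (sub_ne_zero.2 (Ne.symm he))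
    have hz2 : ‖z‖ₑ ≤ 2 := by
      refine (enorm_sub_le).trans_eq ?_
      rw [mul_comm Complex.I, ← ofReal_norm (Complex.exp _), Complex.norm_exp_ofReal_mul_I,
        enorm_one, ENNReal.ofReal_one, one_add_one_eq_two]
    calc _ = ‖z‖ₑ * (‖z‖ₑ⁻¹ * ∑ j : Fin (J + 1), h k j (fun i => φ ⟨i, by omega⟩) *
          h k (J - j) (fun i => φ ⟨j + i, by omega⟩)) := by
          rw [← mul_assoc, ENNReal.mul_inv_cancel hz0 enorm_ne_top, one_mul]
      _ ≤ _ := by gcongr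

theorem solutionTerm_zero (x : ℝ) : solutionTerm c φ k g Φ w 0 x = Φ x := by
  unfold solutionTerm
  rw [tsum_eq_single default fun m hm => (hm (Subsingleton.elim _ _)).elim]
  simp [amp_zero]

theorem solutionTerm_succ (J : ℕ) (x : ℝ) :
    solutionTerm c φ k g Φ w (J + 1) x = conj (Φ x) * riccatiTerm c φ k g Φ w J x := by
  unfold solutionTerm riccatiTerm
  rw [← tsum_mul_left]
  refine tsum_congr fun m => ?_
  rw [amp_succ]
  ring

theorem enorm_term_le {J : ℕ} {C a : ℝ≥0∞} (m : Fin J → ℕ) {F b : ℂ}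
    (hF : ‖F‖ₑ ≤ C * h k J fun i => φ (m i)) (hb : ‖b‖ₑ ≤ a) :
    ‖(∏ i, c (m i)) * (b * F)‖ₑ ≤ weight c φ k J m * (C * a) := by
  rw [enorm_mul, enorm_mul, weight]
  calc _ ≤ ‖∏ i, c (m i)‖ₑ * (a * (C * h k J fun i => φ (m i))) := by gcongr
    _ = _ := by ring

theorem exists_enorm_solutionTerm_le (hA : A ≠ ⊤) (hΦ : ∀ x, ‖Φ x‖ₑ ≤ A) (J : ℕ) :
    ∃ C : ℝ≥0∞, C ≠ ⊤ ∧ ∀ x, (∀ m : Fin J → ℕ, ‖(∏ i, c (m i)) *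
        ((∏ i, g (m i) x) * amp Φ w k J (fun i => φ (m i)) x)‖ₑ ≤
          weight c φ k J m * (C * ∏ i, ‖g (m i) x‖ₑ)) ∧
      ‖solutionTerm c φ k g Φ w J x‖ₑ ≤
        ∑' m : Fin J → ℕ, weight c φ k J m * (C * ∏ i, ‖g (m i) x‖ₑ) := by
  obtain ⟨C, hCt, hC, -, -⟩ := exists_enorm_amp_le (w := w) (k := k) hA hΦ J
  have key : ∀ x, ∀ m : Fin J → ℕ, ‖(∏ i, c (m i)) *
        ((∏ i, g (m i) x) * amp Φ w k J (fun i => φ (m i)) x)‖ₑ ≤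
          weight c φ k J m * (C * ∏ i, ‖g (m i) x‖ₑ) := fun x m =>
    enorm_term_le m (hC _ x) (enorm_prod ..).le
  exact ⟨C, hCt, fun x => ⟨key x, enorm_tsum_le_of_enorm_le (key x)⟩⟩

theorem tsum_mul_const_ne_top {ι : Type*} {κ : ι → ℝ≥0∞} (hκ : ∑' t, κ t ≠ ⊤) {C : ℝ≥0∞}
    (hC : C ≠ ⊤) : ∑' t, κ t * C ≠ ⊤ := by
  rw [ENNReal.tsum_mul_right]
  exact ENNReal.mul_ne_top hκ hC

theorem exists_enorm_solutionTerm_le_const (hA : A ≠ ⊤) (hΦ : ∀ x, ‖Φ x‖ₑ ≤ A)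
    (hg : IsSmoothFamily g g' d p B Q) {J : ℕ} (hW : ∑' m, weight c φ k J m ≠ ⊤) :
    ∃ M : ℝ≥0∞, M ≠ ⊤ ∧ ∀ x, 0 < x → ‖solutionTerm c φ k g Φ w J x‖ₑ ≤ M := by
  obtain ⟨C, hCt, hC⟩ := exists_enorm_solutionTerm_le (c := c) (φ := φ) (k := k) (g := g) (w := w)
    hA hΦ J
  refine ⟨∑' m : Fin J → ℕ, weight c φ k J m * (C * B ^ J), tsum_mul_const_ne_top hW
    (ENNReal.mul_ne_top hCt (ENNReal.pow_ne_top hg.ne_top)), fun x hx => (hC x).2.trans ?_⟩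
  refine ENNReal.tsum_le_tsum fun m => ?_
  gcongr
  simpa using hg.enorm_prod_le Finset.univ m hx

theorem summable_norm_solutionTerm (hA : A ≠ ⊤) (hΦ : ∀ x, ‖Φ x‖ₑ ≤ A)
    (hg : IsSmoothFamily g g' d p B Q) {J : ℕ} (hW : ∑' m, weight c φ k J m ≠ ⊤) {x : ℝ}
    (hx : 0 < x) : Summable fun m : Fin J → ℕ => ‖(∏ i, c (m i)) *
        ((∏ i, g (m i) x) * amp Φ w k J (fun i => φ (m i)) x)‖ := by
  obtain ⟨C, hCt, hC⟩ := exists_enorm_solutionTerm_le (c := c) (φ := φ) (k := k) (g := g) (w := w)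
    hA hΦ J
  refine summable_norm_of_enorm_le (fun m => ((hC x).1 m).trans ?_)
    (tsum_mul_const_ne_top hW (ENNReal.mul_ne_top hCt (ENNReal.pow_ne_top (n := J) hg.ne_top)))
  gcongr
  simpa using hg.enorm_prod_le Finset.univ m hx

theorem enorm_smoothPotential_term (l : ℕ) (x : ℝ) :
    ‖c l * Complex.exp (-(Complex.I * φ l * x)) * g l x‖ₑ = ‖c l‖ₑ * ‖g l x‖ₑ := by
  rw [enorm_mul, enorm_mul, enorm_exp_neg_I_mul, mul_one]

theorem summable_norm_smoothPotential (hg : IsSmoothFamily g g' d p B Q)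
    (hc : ∑' l, ‖c l‖ₑ ≠ ⊤) {x : ℝ} (hx : 0 < x) :
    Summable fun l => ‖c l * Complex.exp (-(Complex.I * φ l * x)) * g l x‖ := by
  refine summable_norm_of_enorm_le (fun l => ?_) (tsum_mul_const_ne_top hc hg.ne_top)
  rw [enorm_smoothPotential_term]
  gcongr
  exact hg.enorm_le l x hx

/-- Convolution identity: the part of the derivative of `riccatiTerm` in which the derivative
falls on the oscillating factor is the homogeneous part of degree `J + 1` of the right-hand side
of the Riccati equation. -/
theorem tsum_ampSource (hA : A ≠ ⊤) (hΦ : ∀ x, ‖Φ x‖ₑ ≤ A) (hg : IsSmoothFamily g g' d p B Q)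
    (hc : ∑' l, ‖c l‖ₑ ≠ ⊤) {J : ℕ} (hW : ∀ j ≤ J, ∑' m, weight c φ k j m ≠ ⊤) {x : ℝ}
    (hx : 0 < x) :
    ∑' m : Fin (J + 1) → ℕ,
      (∏ i, c (m i)) * ((∏ i, g (m i) x) * ampSource Φ w k J (fun i => φ (m i)) x) =
    -(w⁻¹ * smoothPotential c φ g x) * ∑ j : Fin (J + 1),
      solutionTerm c φ k g Φ w j x * solutionTerm c φ k g Φ w (J - j) x := by
  set σ : (J : ℕ) → (Fin J → ℕ) → ℂ := fun J m => (∏ i, c (m i)) *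
    ((∏ i, g (m i) x) * amp Φ w k J (fun i => φ (m i)) x) with hσ
  set v : ℕ → ℂ := fun l => c l * Complex.exp (-(Complex.I * φ l * x)) * g l x with hv
  have hσs : ∀ j ≤ J, Summable fun m => ‖σ j m‖ := fun j hj =>
    summable_norm_solutionTerm hA hΦ hg (hW j hj) hx
  have hvs : Summable fun l => ‖v l‖ := summable_norm_smoothPotential hg hc hx
  -- each summand of `ampSource` splits into the terms of three separate series
  have h1 : ∀ m : Fin (J + 1) → ℕ, (∏ i, c (m i)) * ((∏ i, g (m i) x) *
      ampSource Φ w k J (fun i => φ (m i)) x) = ∑ j : Fin (J + 1), -w⁻¹ *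
        (σ j (splitTuple j m).1.1 * σ (J - j) (splitTuple j m).1.2 * v (splitTuple j m).2) := by
    intro m
    unfold ampSource
    rw [Finset.mul_sum, Finset.mul_sum, Finset.mul_sum]
    refine Finset.sum_congr rfl fun j _ => ?_
    rw [prod_splitTuple j fun i => c (m i), prod_splitTuple j fun i => g (m i) x]
    simp only [hσ, hv, splitTuple, Equiv.coe_fn_mk]
    ring
  have hprod : ∀ j : Fin (J + 1), Summable fun t : ((Fin j → ℕ) × (Fin (J - j) → ℕ)) × ℕ =>
      ‖σ j t.1.1 * σ (J - j) t.1.2 * v t.2‖ := fun j =>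
    (((hσs j (by omega)).mul_norm (hσs (J - j) (by omega)))).mul_norm hvs
  have h2 : ∀ j : Fin (J + 1), HasSum (fun m : Fin (J + 1) → ℕ => -w⁻¹ *
        (σ j (splitTuple j m).1.1 * σ (J - j) (splitTuple j m).1.2 * v (splitTuple j m).2))
      (-w⁻¹ * ((∑' m, σ j m) * (∑' m, σ (J - j) m) * ∑' l, v l)) := by
    intro j
    refine HasSum.mul_left _ ?_
    have hs := (splitTuple j).hasSum_iff.2 (hprod j).of_norm.hasSum
    rwa [tsum_mul_tsum_of_summable_norm (hσs j (by omega)) (hσs (J - j) (by omega)),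
      tsum_mul_tsum_of_summable_norm ((hσs j (by omega)).mul_norm (hσs (J - j) (by omega))) hvs]
  rw [tsum_congr h1, (hasSum_sum fun j _ => h2 j).tsum_eq, Finset.mul_sum]
  refine Finset.sum_congr rfl fun j _ => ?_
  unfold solutionTerm smoothPotential
  ring

/-- Differentiation of `riccatiTerm`; the terms with a vanishing divisor have coefficient zero. -/
theorem isPrimitive_riccatiTerm (hc0 : Continuous Φ)
    (hper : ∀ x, 0 ≤ x → Φ (x + 1) = Complex.exp (Complex.I * k) * Φ x) (hA : A ≠ ⊤)
    (hΦ : ∀ x, ‖Φ x‖ₑ ≤ A) (hg : IsSmoothFamily g g' d p B Q) (hc : ∑' l, ‖c l‖ₑ ≠ ⊤) {J : ℕ}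
    (hW : ∀ j ≤ J + 1, ∑' m, weight c φ k j m ≠ ⊤) :
    IsPrimitive 1 (riccatiTerm c φ k g Φ w J) fun x => riccatiRemainder c φ k g g' Φ w J x -
      w⁻¹ * smoothPotential c φ g x * ∑ j : Fin (J + 1),
        solutionTerm c φ k g Φ w j x * solutionTerm c φ k g Φ w (J - j) x := by
  obtain ⟨C, hCt, -, hCp, hCs⟩ := exists_enorm_amp_le (w := w) (k := k) hA hΦ J
  have hB := hg.ne_top
  set M : ℝ≥0∞ := C * B ^ (J + 1) + C * (B ^ J * ((J + 1 : ℕ) * B)) + 2 * C * B ^ (J + 1) with hM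
  have hMt : M ≠ ⊤ := by
    rw [hM]
    finiteness
  have hprod : ∀ (m : Fin (J + 1) → ℕ) x, 0 < x → ‖∏ i, g (m i) x‖ₑ ≤ B ^ (J + 1) := by
    intro m x hx
    rw [enorm_prod]
    simpa using hg.enorm_prod_le Finset.univ m hx
  have hF1 : ∀ (m : Fin (J + 1) → ℕ) x, 0 < x → ‖(∏ i, c (m i)) * ((∏ i, g (m i) x) *
      ampPrimitive Φ w k J (fun i => φ (m i)) x)‖ₑ ≤
        weight c φ k (J + 1) m * (C * B ^ (J + 1)) := fun m x hx =>
    enorm_term_le m (hCp _ x) (hprod m x hx)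
  have hF2 : ∀ (m : Fin (J + 1) → ℕ) x, 0 < x → ‖(∏ i, c (m i)) *
      ((∑ i, (∏ j ∈ Finset.univ.erase i, g (m j) x) * g' (m i) x) *
      ampPrimitive Φ w k J (fun i => φ (m i)) x)‖ₑ ≤
        weight c φ k (J + 1) m * (C * (B ^ J * ((J + 1 : ℕ) * B))) := fun m x hx =>
    enorm_term_le m (hCp _ x) (hg.enorm_sum_prod_le' m hx)
  have hF3 : ∀ (m : Fin (J + 1) → ℕ) x, 0 < x → ‖(∏ i, c (m i)) * ((∏ i, g (m i) x) *
      ampSource Φ w k J (fun i => φ (m i)) x)‖ₑ ≤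
        weight c φ k (J + 1) m * (2 * C * B ^ (J + 1)) := by
    refine fun m x hx => enorm_term_le m ((hCs _ x).trans ?_) (hprod m x hx)
    rw [mul_comm 2 C, mul_assoc]
    gcongr
    exact sum_h_mul_h_le J _
  have hW1 := hW (J + 1) le_rfl
  have key := isPrimitive_tsum (F := fun (m : Fin (J + 1) → ℕ) x => (∏ i, c (m i)) *
      ((∏ i, g (m i) x) * ampPrimitive Φ w k J (fun i => φ (m i)) x))
    (F' := fun m x => (∏ i, c (m i)) *
      ((∑ i, (∏ j ∈ Finset.univ.erase i, g (m j) x) * g' (m i) x) *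
        ampPrimitive Φ w k J (fun i => φ (m i)) x) +
      (∏ i, c (m i)) * ((∏ i, g (m i) x) * ampSource Φ w k J (fun i => φ (m i)) x))
    (tsum_mul_const_ne_top hW1 hMt) ?_ ?_ ?_ ?_
  · refine key.congr_right' fun x hx => ?_
    have hx0 : 0 < x := one_pos.trans hx
    rw [Summable.tsum_add, tsum_ampSource hA hΦ hg hc (fun j hj => hW j (by omega)) hx0]
    · unfold riccatiRemainder
      ring
    · exact (summable_norm_of_enorm_le (fun m => hF2 m x hx0)
        (tsum_mul_const_ne_top hW1 (by finiteness))).of_norm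
    · exact (summable_norm_of_enorm_le (fun m => hF3 m x hx0)
        (tsum_mul_const_ne_top hW1 (by finiteness))).of_norm
  · intro m x hx
    refine (hF1 m x hx).trans ?_
    gcongr
    rw [hM, add_assoc]
    exact le_self_add
  · intro m x hx
    refine (enorm_add_le _ _).trans ((add_le_add (hF2 m x hx) (hF3 m x hx)).trans ?_)
    rw [← mul_add]
    gcongr
    rw [hM, add_assoc]
    exact le_add_self
  · intro m x hx
    by_cases he : Complex.exp (Complex.I * ((2 * k - ∑ i, φ (m i) : ℝ) : ℂ)) = 1
    · have hc : ∏ i, c (m i) = 0 := by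
        have hwt := ENNReal.ne_top_of_tsum_ne_top hW1 m
        rw [weight, h_eq_top_of_exp_eq_one J _ he] at hwt
        by_contra hne
        exact hwt (ENNReal.mul_top (enorm_ne_zero.2 hne))
      simpa [hc] using hasDerivAt_const x (0 : ℂ)
    · have hP := HasDerivAt.fun_finsetProd (u := Finset.univ) fun (i : Fin (J + 1)) _ =>
        hg.hasDerivAt (m i) x
      refine ((hP.mul (hasDerivAt_ampPrimitive hc0 hper J _ he hx.le)).const_mul _).congr_deriv ?_
      simp only [smul_eq_mul]
      ring
  · intro m
    have h1 := continuous_ampPrimitive (w := w) (k := k) hc0 J fun i => φ (m i)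
    have h2 := continuous_ampSource (w := w) (k := k) hc0 J fun i => φ (m i)
    have h3 := hg.continuous
    have h4 := hg.continuous_deriv
    exact Continuous.continuousOn (by fun_prop)

theorem tendsto_riccatiTerm (hA : A ≠ ⊤) (hΦ : ∀ x, ‖Φ x‖ₑ ≤ A)
    (hg : IsSmoothFamily g g' d p B Q) {J : ℕ} (hW : ∑' m, weight c φ k (J + 1) m ≠ ⊤) :
    Tendsto (riccatiTerm c φ k g Φ w J) atTop (𝓝 0) := by
  obtain ⟨C, hCt, -, hC, -⟩ := exists_enorm_amp_le (w := w) (k := k) hA hΦ J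
  have hB := hg.ne_top
  have hb : ∀ (m : Fin (J + 1) → ℕ) x, 0 < x → ‖(∏ i, c (m i)) * ((∏ i, g (m i) x) *
      ampPrimitive Φ w k J (fun i => φ (m i)) x)‖ₑ ≤
        weight c φ k (J + 1) m * (C * (‖g (m 0) x‖ₑ * B ^ J)) := by
    refine fun m x hx => enorm_term_le m (hC _ x) ?_
    rw [enorm_prod, Fin.prod_univ_succ]
    gcongr
    simpa using hg.enorm_prod_le Finset.univ (fun i => m (Fin.succ i)) hx
  refine tendsto_tsum_zero (κ := fun m => weight c φ k (J + 1) m * (C * (B * B ^ J)))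
    (tsum_mul_const_ne_top hW (by finiteness)) (fun m x hx => (hb m x hx).trans ?_) fun m => ?_
  · gcongr
    exact hg.enorm_le _ x hx
  · refine tendsto_zero_of_enorm_le ((eventually_gt_atTop 0).mono fun x hx => hb m x hx) ?_
    have h0 : Tendsto (fun x => ‖g (m 0) x‖ₑ) atTop (𝓝 0) := by
      simpa using (hg.tendsto (m 0)).enorm
    have := ENNReal.Tendsto.const_mul (ENNReal.Tendsto.const_mul
      (ENNReal.Tendsto.mul_const h0 (Or.inr (ENNReal.pow_ne_top hB (n := J)))) (Or.inr hCt))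
      (Or.inr (ENNReal.ne_top_of_tsum_ne_top hW m))
    simpa using this

theorem hasIntegrableMajorant_riccatiRemainder (hA : A ≠ ⊤) (hΦ : ∀ x, ‖Φ x‖ₑ ≤ A)
    (hg : IsSmoothFamily g g' d p B Q) {J : ℕ} (hW : ∑' m, weight c φ k (J + 1) m ≠ ⊤) :
    HasIntegrableMajorant (riccatiRemainder c φ k g g' Φ w J) := by
  obtain ⟨C, hCt, -, hC, -⟩ := exists_enorm_amp_le (w := w) (k := k) hA hΦ J
  have hB := hg.ne_top
  have hQ := hg.integral_ne_top
  refine .of_enorm_le_tsum (κ := weight c φ k (J + 1))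
    (q := fun m x => C * (B ^ J * ∑ i, d (m i) x)) (Q := C * (B ^ J * ((J + 1 : ℕ) * Q)))
    hW (by finiteness) (fun m => ?_) (fun m => ?_) fun x hx => ?_
  · have := hg.measurable
    fun_prop
  · have := hg.measurable
    rw [lintegral_const_mul _ (by fun_prop), lintegral_const_mul _ (by fun_prop),
      lintegral_finsetSum _ (fun i _ => hg.measurable _)]
    gcongr
    refine (Finset.sum_le_sum fun i _ => hg.lintegral_le (m i)).trans_eq ?_
    simp
  · exact enorm_tsum_le_of_enorm_le fun m =>
      enorm_term_le m (hC _ x) (hg.enorm_sum_prod_le m hx)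

/-- Products of total degree at least `p` in the coefficient functions are integrable. -/
theorem hasIntegrableMajorant_of_le (hA : A ≠ ⊤) (hΦ : ∀ x, ‖Φ x‖ₑ ≤ A) (hp : 0 < p)
    (hg : IsSmoothFamily g g' d p B Q) (hc : ∑' l, ‖c l‖ₑ ≠ ⊤) {a b : ℕ}
    (hWa : ∑' m, weight c φ k a m ≠ ⊤) (hWb : ∑' m, weight c φ k b m ≠ ⊤) (hab : p ≤ a + b + 1) :
    HasIntegrableMajorant fun x => smoothPotential c φ g x *
      (solutionTerm c φ k g Φ w a x * solutionTerm c φ k g Φ w b x) := by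
  obtain ⟨C, hCt, hC⟩ := exists_enorm_solutionTerm_le (c := c) (φ := φ) (k := k) (g := g) (w := w)
    hA hΦ a
  obtain ⟨C', hCt', hC'⟩ := exists_enorm_solutionTerm_le (c := c) (φ := φ) (k := k) (g := g)
    (w := w) hA hΦ b
  have hB := hg.ne_top
  have hQ := hg.integral_ne_top
  -- one index for all the coefficient functions that occur in a term of the triple product
  let ix : ℕ × (Fin a → ℕ) × (Fin b → ℕ) → Unit ⊕ Fin a ⊕ Fin b → ℕ :=
    fun t => Sum.elim (fun _ => t.1) (Sum.elim t.2.1 t.2.2)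
  have hcard : Fintype.card (Unit ⊕ Fin a ⊕ Fin b) = a + b + 1 := by
    simp; ring
  have hm := fun l => (hg.continuous l).measurable
  refine .of_enorm_le_tsum
    (κ := fun t : ℕ × (Fin a → ℕ) × (Fin b → ℕ) =>
      ‖c t.1‖ₑ * (weight c φ k a t.2.1 * weight c φ k b t.2.2))
    (q := fun t x => C * C' * ∏ i, ‖g (ix t i) x‖ₑ)
    (Q := C * C' * (B ^ (a + b + 1) * ((a + b + 1 : ℕ) * Q))) ?_ (by finiteness) (fun t => ?_)
    (fun t => ?_) fun x hx => ?_
  · rw [ENNReal.tsum_prod']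
    simp_rw [ENNReal.tsum_mul_left, ENNReal.tsum_prod', ENNReal.tsum_mul_left,
      ENNReal.tsum_mul_right]
    finiteness
  · fun_prop
  · calc ∫⁻ x in Ioi (0 : ℝ), C * C' * ∏ i, ‖g (ix t i) x‖ₑ
        ≤ ∫⁻ x in Ioi (0 : ℝ), C * C' * (B ^ (a + b + 1) * ∑ i, ‖g (ix t i) x‖ₑ ^ p) := by
          refine setLIntegral_mono' measurableSet_Ioi fun x hx => ?_
          gcongr
          rw [← hcard]
          exact prod_le_pow_mul_sum_pow hp (by omega) hg.one_le fun i => hg.enorm_le _ x hx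
      _ = C * C' * (B ^ (a + b + 1) * ∑ i, ∫⁻ x in Ioi (0 : ℝ), ‖g (ix t i) x‖ₑ ^ p) := by
          rw [lintegral_const_mul _ (by fun_prop), lintegral_const_mul _ (by fun_prop),
            lintegral_finsetSum _ (fun i _ => by fun_prop)]
      _ ≤ _ := by
          gcongr
          refine (Finset.sum_le_sum fun i _ => hg.lintegral_pow_le (ix t i)).trans_eq ?_
          rw [Finset.sum_const, Finset.card_univ, hcard, nsmul_eq_mul]
  · have hv : ‖smoothPotential c φ g x‖ₑ ≤ ∑' l, ‖c l‖ₑ * ‖g l x‖ₑ :=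
      enorm_tsum_le_of_enorm_le fun l => (enorm_smoothPotential_term l x).le
    rw [enorm_mul, enorm_mul]
    refine (mul_le_mul' hv (mul_le_mul' (hC x).2 (hC' x).2)).trans_eq ?_
    rw [ENNReal.tsum_prod', ← ENNReal.tsum_mul_right]
    refine tsum_congr fun l => ?_
    rw [ENNReal.tsum_prod', ← ENNReal.tsum_mul_right, ← ENNReal.tsum_mul_left]
    refine tsum_congr fun m => ?_
    rw [← ENNReal.tsum_mul_left, ← ENNReal.tsum_mul_left]
    refine tsum_congr fun m' => ?_
    simp only [ix, Fintype.prod_sum_type, Sum.elim_inl, Sum.elim_inr, Finset.univ_unique,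
      Finset.prod_singleton]
    ring

/-- Replacing the potential by its smoothed version changes it by an integrable function. -/
theorem hasIntegrableMajorant_sub_smoothPotential (hg : IsSmoothFamily g g' d p B Q)
    (hc : ∑' l, ‖c l‖ₑ ≠ ⊤) {γ : ℕ → ℝ → ℂ} (hγ : ∀ l x, 0 < x → ‖γ l x - g l x‖ₑ ≤ d l x)
    {V : ℝ → ℂ}
    (hV : ∀ x : ℝ, 0 < x →
      HasSum (fun l => c l * Complex.exp (-(Complex.I * φ l * x)) * γ l x) (V x)) :
    HasIntegrableMajorant fun x => V x - smoothPotential c φ g x := by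
  refine .of_enorm_le_tsum (q := d) hc hg.integral_ne_top hg.measurable hg.lintegral_le
    fun x hx => ?_
  have h1 := (hV x hx).sub (summable_norm_smoothPotential (φ := φ) hg hc hx).of_norm.hasSum
  rw [show V x - smoothPotential c φ g x = _ from h1.tsum_eq.symm]
  refine enorm_tsum_le_of_enorm_le fun l => ?_
  rw [← mul_sub, enorm_mul, enorm_mul, enorm_exp_neg_I_mul, mul_one]
  gcongr
  exact hγ l x hx

/-- Truncating the iteration after `n` steps leaves an integrable error in the Riccati equation. -/
theorem exists_approximate_riccati {n : ℕ} (hc0 : Continuous Φ)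
    (hper : ∀ x, 0 ≤ x → Φ (x + 1) = Complex.exp (Complex.I * k) * Φ x) (hA : A ≠ ⊤)
    (hΦ : ∀ x, ‖Φ x‖ₑ ≤ A) (hg : IsSmoothFamily g g' d (n + 1) B Q) (hc : ∑' l, ‖c l‖ₑ ≠ ⊤)
    (hW : ∀ j ≤ n, ∑' m, weight c φ k j m ≠ ⊤) {γ : ℕ → ℝ → ℂ}
    (hγ : ∀ l x, 0 < x → ‖γ l x - g l x‖ₑ ≤ d l x) {V : ℝ → ℂ}
    (hV : ∀ x : ℝ, 0 < x →
      HasSum (fun l => c l * Complex.exp (-(Complex.I * φ l * x)) * γ l x) (V x)) :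
    ∃ f f' : ℝ → ℂ, IsPrimitive 1 f f' ∧ Tendsto f atTop (𝓝 0) ∧
      HasIntegrableMajorant fun x => f' x + V x / w * (Φ x + conj (Φ x) * f x) ^ 2 := by
  set s : ℕ → ℝ → ℂ := solutionTerm c φ k g Φ w with hs
  set v : ℝ → ℂ := smoothPotential c φ g
  refine ⟨fun x => ∑ J ∈ Finset.range n, riccatiTerm c φ k g Φ w J x,
    fun x => ∑ J ∈ Finset.range n, (riccatiRemainder c φ k g g' Φ w J x -
      w⁻¹ * v x * ∑ j : Fin (J + 1), s j x * s (J - j) x),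
    .sum_range n fun J hJ => isPrimitive_riccatiTerm hc0 hper hA hΦ hg hc fun j hj =>
      hW j (by omega), ?_, ?_⟩
  · have := tendsto_finsetSum (Finset.range n) fun J hJ =>
      tendsto_riccatiTerm (c := c) (φ := φ) (k := k) (w := w) hA hΦ hg
        (hW (J + 1) (by have := Finset.mem_range.1 hJ; omega))
    simpa using this
  choose! M hMt hM using fun J (hJ : J ≤ n) =>
    exists_enorm_solutionTerm_le_const (w := w) hA hΦ hg (hW J hJ)
  have hS : ∀ x, 0 < x →
      ‖w⁻¹ * (∑ a ∈ Finset.range (n + 1), s a x) ^ 2‖ₑ ≤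
        ‖w⁻¹‖ₑ * (∑ a ∈ Finset.range (n + 1), M a) ^ 2 := by
    intro x hx
    rw [enorm_mul, enorm_pow]
    gcongr
    refine (enorm_sum_le _ _).trans (Finset.sum_le_sum fun a ha => ?_)
    exact hM a (by have := Finset.mem_range.1 ha; omega) x hx
  have hSt : ‖w⁻¹‖ₑ * (∑ a ∈ Finset.range (n + 1), M a) ^ 2 ≠ ⊤ := by
    refine ENNReal.mul_ne_top enorm_ne_top (ENNReal.pow_ne_top (ENNReal.sum_ne_top.2 fun a ha => ?_))
    exact hMt a (by have := Finset.mem_range.1 ha; omega)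
  have h1 : HasIntegrableMajorant fun x =>
      ∑ J ∈ Finset.range n, riccatiRemainder c φ k g g' Φ w J x :=
    .sum _ fun J hJ => hasIntegrableMajorant_riccatiRemainder hA hΦ hg
      (hW (J + 1) (by have := Finset.mem_range.1 hJ; omega))
  have h2 := (hasIntegrableMajorant_sub_smoothPotential hg hc hγ hV).mul_bounded hSt hS
  have h3 : HasIntegrableMajorant fun x => ∑ t ∈ (Finset.range (n + 1) ×ˢ
      Finset.range (n + 1)).filter (fun t => ¬ t.1 + t.2 < n), v x * (s t.1 x * s t.2 x) := by
    refine .sum _ fun t ht => ?_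
    simp only [Finset.mem_filter, Finset.mem_product, Finset.mem_range] at ht
    exact hasIntegrableMajorant_of_le hA hΦ n.succ_pos hg hc (hW _ (by omega)) (hW _ (by omega))
      (by omega)
  refine ((h1.add h2).add (h3.mul_bounded (s := fun _ => w⁻¹) enorm_ne_top
    fun _ _ => le_rfl)).congr fun x _ => ?_
  have hsum : Φ x + conj (Φ x) * ∑ J ∈ Finset.range n, riccatiTerm c φ k g Φ w J x =
      ∑ a ∈ Finset.range (n + 1), s a x := by
    rw [Finset.sum_range_succ', hs, solutionTerm_zero, Finset.mul_sum, add_comm]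
    simp only [solutionTerm_succ]
  simp only [hsum]
  rw [Finset.sum_sub_distrib, ← Finset.mul_sum, ← Finset.mul_sum]
  have := sum_conv_add_sum_filter_eq_sq (fun a => s a x) n
  linear_combination (-(w⁻¹ * v x)) * this

end riccati

/-- The smoothing of all the coefficient functions at once. -/
theorem exists_isSmoothFamily {γ : ℕ → ℝ → ℂ} {p : ℕ} (hp : 1 ≤ p)
    (hvar : (⨆ l, eVariationOn (γ l) (Ioi 0)) < ⊤)
    (hLp : (⨆ l, ∫⁻ x in Ioi (0 : ℝ), ‖γ l x‖ₑ ^ p) < ⊤) :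
    ∃ g g' d B Q, IsSmoothFamily g g' d p B Q ∧ ∀ l x, 0 < x → ‖γ l x - g l x‖ₑ ≤ d l x := by
  set K : ℝ := (⨆ l, eVariationOn (γ l) (Ioi 0)).toReal with hK
  set L : ℝ≥0∞ := ⨆ l, ∫⁻ x in Ioi (0 : ℝ), ‖γ l x‖ₑ ^ p with hL
  have hK0 : 0 ≤ K := ENNReal.toReal_nonneg
  choose g g' d hc hd hm hb h1 hpow ht using fun l => exists_smoothing (γ := γ l) hK0
    (by rw [hK, ENNReal.ofReal_toReal hvar.ne]; exact le_iSup (fun l => eVariationOn (γ l) _) l) hp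
    (le_iSup (fun l => ∫⁻ x in Ioi (0 : ℝ), ‖γ l x‖ₑ ^ p) l) hLp.ne
  refine ⟨g, g', d, max 1 (ENNReal.ofReal (2 * K)), max (ENNReal.ofReal (2 * K))
    (2 ^ p * (L + ENNReal.ofReal K ^ (p - 1) * ENNReal.ofReal (2 * K))),
    { one_le := le_max_left _ _
      ne_top := (max_lt ENNReal.one_lt_top ENNReal.ofReal_lt_top).ne
      integral_ne_top := (max_lt ENNReal.ofReal_lt_top (lt_top_iff_ne_top.2 ?_)).ne
      continuous_deriv := hc
      hasDerivAt := hd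
      measurable := hm
      enorm_le := fun l x hx => le_max_of_le_right ?_
      enorm_deriv_le := fun l x hx => (hb l x hx).2.1
      le := fun l x hx => le_max_of_le_right ((hb l x hx).2.2.2.trans
        (ENNReal.ofReal_le_ofReal (by linarith)))
      lintegral_le := fun l => le_max_of_le_left (h1 l)
      lintegral_pow_le := fun l => le_max_of_le_right (hpow l)
      tendsto := ht }, fun l x hx => (hb l x hx).2.2.1⟩
  · have := hLp.ne
    finiteness
  · rw [← ofReal_norm]
    exact ENNReal.ofReal_le_ofReal (hb l x hx).1

end PeriodicSchrodinger

end

open PeriodicSchrodinger in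
theorem mainTheorem3
    -- the unperturbed operator: a real, locally integrable potential of period one
    (V₀ : ℝ → ℝ) (hV₀_per : Function.Periodic V₀ 1) (hV₀_int : LocallyIntegrable V₀ volume)
    -- the perturbation: a real function `V(x) = ∑ c_l e^{-i φ_l x} γ_l(x)` on `(0, ∞)`
    (V : ℝ → ℝ) (c : ℕ → ℂ) (φ : ℕ → ℝ) (γ : ℕ → ℝ → ℂ)
    (hV : ∀ x : ℝ, 0 < x →
      HasSum (fun l => c l * Complex.exp (-(Complex.I * φ l * x)) * γ l x) (V x : ℂ))
    (hγ_var : (⨆ l, eVariationOn (γ l) (Set.Ioi 0)) < ⊤)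
    (p : ℕ) (hp : 2 ≤ p)
    (hγ_Lp : (⨆ l, ∫⁻ x in Set.Ioi (0 : ℝ), ‖γ l x‖ₑ ^ p) < ⊤)
    -- an energy in the interior of the essential spectrum and its quasimomentum
    (θ : ℝ) (hθ : θ ∈ Set.Ico 0 Real.pi)
    (E : ℝ) (hE : E ∈ interior (PeriodicSchrodinger.essSpectrum θ V₀))
    (k : ℝ) (hk : ∃ ψ, PeriodicSchrodinger.IsFloquetSolution V₀ E k ψ)
    -- summability of the coefficients and the small-divisor condition
    (hc : Summable fun l => ‖c l‖)
    (hsmall : ∀ j : ℕ, 1 ≤ j → j ≤ p - 1 →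
      (∑' m : Fin j → ℕ,
        ‖∏ i, c (m i)‖ₑ * PeriodicSchrodinger.h k j (fun i => φ (m i))) < ⊤) :
    ∀ u : ℝ → ℂ, PeriodicSchrodinger.IsSolution (fun x => V x + V₀ x) E u →
      ∃ C : ℝ, ∀ x : ℝ, 0 ≤ x → ‖u x‖ ≤ C := by
  intro u hu
  obtain ⟨n, rfl⟩ : ∃ n, p = n + 1 := ⟨p - 1, by omega⟩
  obtain ⟨Φ, Φ', w, hΦ⟩ := exists_isFloquetBasis hV₀_per hV₀_int hE hk
  obtain ⟨A, hA⟩ := exists_bound_of_norm_periodic hΦ.prim.continuousOn fun x hx => by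
    rw [hΦ.add_one x hx, norm_mul, mul_comm Complex.I, Complex.norm_exp_ofReal_mul_I, one_mul]
  obtain ⟨g, g', d, B, Q, hg, hγg⟩ := exists_isSmoothFamily (by omega) hγ_var hγ_Lp
  -- the Floquet solution, extended continuously to the whole line
  set Ψ : ℝ → ℂ := fun x => Φ (max x 0) with hΨ
  have hΨΦ : ∀ x, 0 ≤ x → Ψ x = Φ x := fun x hx => by simp only [hΨ, max_eq_left hx]
  have hΨc : Continuous Ψ :=
    hΦ.prim.continuousOn.comp_continuous (by fun_prop) fun x => le_max_right x 0
  have hcs : ∑' l, ‖c l‖ₑ ≠ ⊤ :=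
     ENNReal.tsum_coe_ne_top_iff_summable.2 (NNReal.summable_coe.1 hc)
  have hW : ∀ j ≤ n, ∑' m, weight c φ k j m ≠ ⊤ := by
    intro j hj
    rcases Nat.eq_zero_or_pos j with rfl | hj0
    · rw [tsum_eq_single default fun m hm => (hm (Subsingleton.elim _ _)).elim]
      simp [weight, PeriodicSchrodinger.h]
    · exact (hsmall j hj0 (by omega)).ne
  obtain ⟨f, f', hf, hf0, e, -, he, hfe⟩ := exists_approximate_riccati (w := w) (Φ := Ψ)
    (A := ENNReal.ofReal A) hΨc (fun x hx => by
      rw [hΨΦ x hx, hΨΦ _ (by linarith)]; exact hΦ.add_one x hx) ENNReal.ofReal_ne_top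
    (fun x => by
      rw [← ofReal_norm]; exact ENNReal.ofReal_le_ofReal (hA _ (le_max_right x 0)))
    hg hcs hW hγg hV
  refine bounded_of_approximate_riccati (V := V) zero_le_one hΦ.prim hΦ.prim' hA hΦ.wronskian
    hΦ.ne_zero hu.acLoc.isPrimitive (hu.isPrimitive_deriv.congr_right' fun x _ => ?_) hf hf0
    (fun x hx => ?_) (ne_top_of_le_ne_top he
      (lintegral_mono_set (Ioi_subset_Ioi zero_le_one)))
  · push_cast
    ring
  · have := hfe x (one_pos.trans hx)
    simpa only [hΨΦ x (one_pos.trans hx).le] using this
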